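/- Let $F_2$ be the free group on $\{a,b\}$. For $x,y\in F_2$ let $\varphi_{x,y}$ be the endomorphism of $F_2$ with $a\mapsto x$, $b\mapsto y$; let $\Sigma=\{\varphi_{a,ba},\ \varphi_{b^{-1},a^{-1}},\ \varphi_{b,a}\}\subseteq \mathrm{Aut}\,F_2$, and let $\Sigma^*$ be the submonoid of $\mathrm{Aut}\,F_2$ generated by $\Sigma$. For $w\in F_2$ let $\lambda_w(x)=wxw^{-1}$. A subset of a monoid is rational if it can be obtained from finite subsets by finitely many unions, products and stars (generated submonoids); the rational subsets of $\Sigma^*$ are the images of the languages, over $\Sigma$ seen as an alphabet, recognized by finite automata. In the algorithmic problems below, elements of $F_2$ are given by words over $a^{\pm1},b^{\pm1}$, finitely generated subgroups by finite lists of generators, and rational subsets of $\Sigma^*$ by finite automata over the alphabet $\Sigma$. Let $H,K\le F_2$ be finitely generated subgroups, $k\ge 0$, $u,u_1,\dots,u_k\in F_2$, and $R$ a rational subset of $\Sigma^*$. Then each of the following problems is decidable (by one algorithm taking all the data, including $R$ and $k$, as input): (1) whether $u\in\mu(H)$ for some $\mu\in R$; (1') whether a conjugate of $u$ lies in $\mu(H)$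 for some $\mu\in R$; (2) whether $K\subseteq\mu(H)$ for some $\mu\in R$; (2') whether a conjugate of $K$ is contained in $\mu(H)$ for some $\mu\in R$; (3) whether $K=\mu(H)$ for some $\mu\in R$; (3') whether a conjugate of $K$ is equal to $\mu(H)$ for some $\mu\in R$; (4) whether there exist $w_1,\dots,w_k\in F_2$ such that $\lambda_{w_1}(u_1),\dots,\lambda_{w_k}(u_k)\in\mu(H)$ for some $\mu\in R$. In addition, for each of these problems, the set $X$ of all $\mu\in\Sigma^*$ that satisfy the condition imposed on $\mu$ is a rational subset of $\Sigma^*$ and is effectively constructible: there is an algorithm which produces, from $H$ and the other data ($u$, or $K$, or $u_1,\dots,u_k$), a finite automaton over the alphabet $\Sigma$ whose language consists of all words $\varphi_1\varphi_2\cdots\varphi_n$ over $\Sigma$ whose value $\varphi_1\circ\cdots\circ\varphi_n$ lies in $X$; in particular the image of this language in $\Sigma^*$ is $X$. -/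

import Mathlib

open scoped Pointwise

/-- The free group of rank 2 on the letters `a = of 0` and `b = of 1`. -/
abbrev F2 : Type := FreeGroup (Fin 2)

namespace F2

abbrev a : F2 := FreeGroup.of 0

abbrev b : F2 := FreeGroup.of 1

/-- `endo x y` is the endomorphism of `F2` mapping `a` to `x` and `b` to `y`. -/
def endo (x y : F2) : F2 →* F2 := FreeGroup.lift ![x, y]

@[simp] theorem endo_zero (x y : F2) : endo x y (FreeGroup.of 0) = x := by simp [endo]

@[simp] theorem endo_one (x y : F2) : endo x y (FreeGroup.of 1) = y := by simp [endo]

theorem hom_ext {f g : F2 →* F2} (ha : f a = g a) (hb : f b = g b) : f = g := by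
  refine FreeGroup.ext_hom f g fun i => ?_
  fin_cases i
  · exact ha
  · exact hb

/-- The automorphism `a ↦ a, b ↦ b * a`. -/
def phi0 : MulAut F2 :=
  MonoidHom.toMulEquiv (endo a (b * a)) (endo a (b * a⁻¹))
    (hom_ext (by simp) (by simp)) (hom_ext (by simp) (by simp))

/-- The automorphism `a ↦ b⁻¹, b ↦ a⁻¹`. -/
def phi1 : MulAut F2 :=
  MonoidHom.toMulEquiv (endo b⁻¹ a⁻¹) (endo b⁻¹ a⁻¹)
    (hom_ext (by simp) (by simp)) (hom_ext (by simp) (by simp))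

/-- The automorphism `a ↦ b, b ↦ a`. -/
def phi2 : MulAut F2 :=
  MonoidHom.toMulEquiv (endo b a) (endo b a)
    (hom_ext (by simp) (by simp)) (hom_ext (by simp) (by simp))

/-- The three-element set `Σ` of automorphisms of `F2`, indexed by `Fin 3`. -/
def sigma : Fin 3 → MulAut F2 := ![phi0, phi1, phi2]

/-- The submonoid `Σ^*` of `Aut F2` generated by `Σ`. -/
def SigmaStar : Submonoid (MulAut F2) := Submonoid.closure (Set.range sigma)

/-- The letters of `Σ` as elements of the monoid `Σ^*`. -/
def letter (i : Fin 3) : SigmaStar := ⟨sigma i, Submonoid.subset_closure ⟨i, rfl⟩⟩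

/-- The canonical morphism from words over the alphabet `Σ` onto the monoid `Σ^*`;
the word `[i₁, …, iₙ]` is sent to the composition `φ_{i₁} ∘ ⋯ ∘ φ_{iₙ}`. -/
def value (w : List (Fin 3)) : SigmaStar := (w.map letter).prod

end F2

/-- Rational subsets of a monoid: the sets obtained from finite subsets using finitely many
times union, product and star, where the star of `S` is the submonoid generated by `S`. -/
inductive IsRational {M : Type*} [Monoid M] : Set M → Prop
  | of_finite {S : Set M} : S.Finite → IsRational S
  | union {S T : Set M} : IsRational S → IsRational T → IsRational (S ∪ T)
  | mul {S T : Set M} : IsRational S → IsRational T → IsRational (S * T)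
  | star {S : Set M} : IsRational S → IsRational (Submonoid.closure S : Set M)

/-- A finite automaton over the alphabet `Σ`, as a finite piece of data
`(q₀, T, E)`: its initial state, the list of its terminal states and the list of its transitions
`(p, i, q)`, where the states are named by natural numbers. -/
abbrev SigmaAutomaton : Type := ℕ × List ℕ × List (ℕ × Fin 3 × ℕ)

namespace SigmaAutomaton

/-- The language over the alphabet `Σ` recognized by the automaton. -/
def language (A : SigmaAutomaton) : Language (Fin 3) :=
  NFA.accepts
    { step := fun p i => {q | (p, i, q) ∈ A.2.2}
      start := {A.1}
      accept := {q | q ∈ A.2.1} : NFA (Fin 3) ℕ }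

/-- The rational subset of the monoid `Σ^*` described by the automaton: the image of the language
that it recognizes. -/
def rationalSubset (A : SigmaAutomaton) : Set F2.SigmaStar := F2.value '' {w | w ∈ A.language}

end SigmaAutomaton

/-- Words over the letters `a, b` and their inverses: `(0, true)` is `a`, `(0, false)` is `a⁻¹`,
`(1, true)` is `b` and `(1, false)` is `b⁻¹`. The element of `F2` given by the word `w` is
`FreeGroup.mk w`. -/
abbrev F2Word : Type := List (Fin 2 × Bool)

/-- The finitely generated subgroup of `F2` given by a finite list of generators. -/
def generatedSubgroup (L : List F2Word) : Subgroup F2 :=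
  Subgroup.closure {g | ∃ w ∈ L, g = FreeGroup.mk w}

/-- Uniform decidability of the problem "given an instance `i` and a rational subset `R` of
`Σ^*`, is there `μ ∈ R` with property `P i μ`?". -/
def DecidableOverRational {ι : Type} [Primcodable ι] (P : ι → MulAut F2 → Prop) : Prop :=
  ComputablePred fun p : SigmaAutomaton × ι => ∃ μ ∈ p.1.rationalSubset, P p.2 μ

/-- The subsets `S i` of `Σ^*` are effectively constructible as rational subsets of `Σ^*`: there
is an algorithm which produces, from the instance `i`, a finite automaton over `Σ` describing
`S i`. The automaton is required to recognize all the words over `Σ` with value in `S i`. -/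
def EffectivelyConstructible {ι : Type} [Primcodable ι] (S : ι → Set F2.SigmaStar) : Prop :=
  ∃ f : ι → SigmaAutomaton, Computable f ∧
    ∀ i, (f i).rationalSubset = S i ∧ ∀ w, w ∈ (f i).language ↔ F2.value w ∈ S i

/-- The problem "is there `μ ∈ R` with property `P i μ`?" is decidable for `R` rational in `Σ^*`;
in addition, for each `i` the set of all `μ ∈ Σ^*` with property `P i μ` is rational, and it is
effectively constructible. -/
def SolvableOverRational {ι : Type} [Primcodable ι] (P : ι → MulAut F2 → Prop) : Prop :=
  DecidableOverRational P ∧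
    (∀ i, IsRational {μ : F2.SigmaStar | P i μ}) ∧
    EffectivelyConstructible fun i => {μ : F2.SigmaStar | P i μ}

/-! Since `μ` is invertible, `u ∈ μ(H)` means `μ⁻¹(u) ∈ H`. The automorphism `a ↦ a⁻¹, b ↦ b`
conjugates the inverses of the letters of `Σ` to letters of `Σ` (`sigma_flip_sigma`). After flipping
`H` and `u`, the condition concerns the element obtained by applying the letters of a word from left
to right (`act`): does it lie in a fixed finitely generated subgroup (`mem_map_value_iff`)? The
heart of the proof is that the words with this property form a language with finitely many
residuals, with a computable bound on their number (`IndexLE`).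

The letters of `Σ` send words of constant sign to words of constant sign, and cancellation in the
image of a reduced word occurs only where the sign changes. The scanning cost counts, in every block
of constant sign but the first, the letters up to the first change of letter; the other letters are
free. The resulting weight never increases (`weight_sigma_le`), so a long image contains a long
factor of constant sign, free when read in either direction. On such a factor all further
automorphisms act as plain substitutions (`toWord_sigma_of_guard`). It may be replaced by a shorter
one describing the same relation on the finite Stallings core of `H`, for every interpretation of
the generators as relations on the core. This equivalence has finitely many classes and is stable
under substitution, so the exchange changes no later membership (`Exchange.sigma`,
`Exchange.smul_eq_iff`), and every image has a substitute of bounded length (`exists_bounded_rep`).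

A conjugate of a tuple lies in `H` iff the tuple fixes some coset, which may lie outside the core.
As long as no member of the tuple, and no product of two members, is conjugate to a stable element,
all their translation lengths are bounded, and then the tuple is conjugate to a bounded one
(`length_reduceCyclically_le`, `exists_conj_norm_le`). Once one of them is conjugate to a stable
element, its later images remain conjugate to cyclically reduced elements, after one fixed
conjugation of the tuple; fixed points are then forced into the core (`PathConvex.mem_of_smul_eq`)
and exchanges apply again (`indexLE_conj`).

Equality is a pair of inclusions, the second one read on the reversed word; for conjugates one also
needs that a finitely generated subgroup contains no proper conjugate of itself
(`map_conj_eq_of_le`). Membership in `H` is decided by testing all actions on boundedly many points,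
by separability of `H`. Finally, a decidable language with a known index bound has a computable
automaton, and meeting a rational set is settled by a bounded search
(`solvableOverRational_of_index`). Problem (4) is a conjunction of instances of (1'). -/

/-! ### Substitutions on words -/

/-- A letter of the alphabet `{a, a⁻¹, b, b⁻¹}`. -/
abbrev Letter : Type := Fin 2 × Bool

/-- The inverse letter. -/
def Letter.inv (c : Letter) : Letter := (c.1, !c.2)

/-- The image of a letter under the `i`-th automorphism of `Σ`. -/
def sub (i : Fin 3) (c : Letter) : F2Word :=
  if i = 0 then
    if c.1 = 0 then [c] else if c.2 then [(1, true), (0, true)] else [(0, false), (1, false)]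
  else if i = 1 then [(1 - c.1, !c.2)]
  else [(1 - c.1, c.2)]

/-- The image of a word under the `i`-th automorphism of `Σ`. -/
def subWord (i : Fin 3) (w : F2Word) : F2Word := w.flatMap (sub i)

@[simp] theorem subWord_nil (i : Fin 3) : subWord i [] = [] := rfl

theorem subWord_append (i : Fin 3) (v w : F2Word) :
    subWord i (v ++ w) = subWord i v ++ subWord i w := by simp [subWord]

theorem subWord_singleton (i : Fin 3) (c : Letter) : subWord i [c] = sub i c := by
  simp [subWord]

theorem mk_cons_eq (c : Letter) (w : F2Word) :
    FreeGroup.mk (c :: w) = FreeGroup.mk [c] * FreeGroup.mk w := by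
  simp

theorem mk_append (v w : F2Word) :
    FreeGroup.mk (v ++ w) = FreeGroup.mk v * FreeGroup.mk w := by
  simp

theorem mk_sub (i : Fin 3) (c : Letter) :
    FreeGroup.mk (sub i c) = F2.sigma i (FreeGroup.mk [c]) := by
  have ha : FreeGroup.mk [((0 : Fin 2), true)] = F2.a := rfl
  have hb : FreeGroup.mk [((1 : Fin 2), true)] = F2.b := rfl
  have hA : FreeGroup.mk [((0 : Fin 2), false)] = F2.a⁻¹ := rfl
  have hB : FreeGroup.mk [((1 : Fin 2), false)] = F2.b⁻¹ := rfl
  obtain ⟨x, s⟩ := c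
  fin_cases i <;> fin_cases x <;> cases s <;>
    simp [sub, F2.sigma, F2.phi0, F2.phi1, F2.phi2, ha, hb, hA, hB, mk_cons_eq _ [_]]

theorem mk_subWord (i : Fin 3) (w : F2Word) :
    FreeGroup.mk (subWord i w) = F2.sigma i (FreeGroup.mk w) := by
  induction w with
  | nil => simp [← FreeGroup.one_eq_mk]
  | cons c w ih =>
    rw [← List.singleton_append, subWord_append, mk_append, mk_append, map_mul, ih,
      subWord_singleton, mk_sub]

theorem isReduced_append_iff {v w : F2Word} :
    FreeGroup.IsReduced (v ++ w) ↔ FreeGroup.IsReduced v ∧ FreeGroup.IsReduced w ∧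
      ∀ x ∈ v.getLast?, ∀ y ∈ w.head?, x.1 = y.1 → x.2 = y.2 :=
  List.isChain_append

theorem toWord_eq_of_isReduced {g : F2} {w : F2Word} (h : FreeGroup.IsReduced w)
    (hg : g = FreeGroup.mk w) : g.toWord = w := by
  rw [hg, FreeGroup.toWord_mk, h.reduce_eq]

/-! ### Scanning a reduced word -/

/-- The states of the scan: `none` at the start of the word, `some (inl s)` when the current
block of letters of sign `s` is the first one or contains both letters, and `some (inr c)` when
the current block is not the first one and is a power of `c`. -/
abbrev Scan : Type := Option (Bool ⊕ Letter)

/-- Reading a letter. -/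
def scanStep : Scan → Letter → Scan
  | none, c => some (Sum.inl c.2)
  | some (Sum.inl s), c => if s = c.2 then some (Sum.inl s) else some (Sum.inr c)
  | some (Sum.inr d), c =>
    if d.2 = c.2 then (if d = c then some (Sum.inr c) else some (Sum.inl c.2))
    else some (Sum.inr c)

/-- The cost of reading a letter. -/
def scanCost : Scan → Letter → ℕ
  | none, _ => 0
  | some (Sum.inl s), c => if s = c.2 then 0 else 1
  | some (Sum.inr _), _ => 1

/-- The state reached from `q` by reading a word. -/
def scanFrom (q : Scan) (w : F2Word) : Scan := w.foldl scanStep q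

/-- The total cost of reading a word from `q`. -/
def costFrom : Scan → F2Word → ℕ
  | _, [] => 0
  | q, c :: w => scanCost q c + costFrom (scanStep q c) w

@[simp] theorem scanFrom_nil (q : Scan) : scanFrom q [] = q := rfl

@[simp] theorem costFrom_nil (q : Scan) : costFrom q [] = 0 := rfl

@[simp] theorem scanFrom_cons (q : Scan) (c : Letter) (w : F2Word) :
    scanFrom q (c :: w) = scanFrom (scanStep q c) w := rfl

@[simp] theorem costFrom_cons (q : Scan) (c : Letter) (w : F2Word) :
    costFrom q (c :: w) = scanCost q c + costFrom (scanStep q c) w := rfl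

theorem scanFrom_append (q : Scan) (v w : F2Word) :
    scanFrom q (v ++ w) = scanFrom (scanFrom q v) w := by simp [scanFrom]

theorem costFrom_append (q : Scan) (v w : F2Word) :
    costFrom q (v ++ w) = costFrom q v + costFrom (scanFrom q v) w := by
  induction v generalizing q with
  | nil => simp
  | cons c v ih => simp [ih, add_assoc]

/-- One more if the final block of a word is a power, and not the first block. -/
def scanExtra : Scan → ℕ
  | some (Sum.inr _) => 1
  | _ => 0

/-- The scanning weight of a word. -/
def scanWeight (w : F2Word) : ℕ := costFrom none w + scanExtra (scanFrom none w)

theorem costFrom_le_length (q : Scan) (w : F2Word) : costFrom q w ≤ w.length := by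
  induction w generalizing q with
  | nil => simp
  | cons c w ih =>
    have h1 : scanCost q c ≤ 1 := by
      rcases q with _ | s | d <;> simp only [scanCost] <;> (try split_ifs) <;> omega
    have h2 := ih (scanStep q c)
    simp only [costFrom_cons, List.length_cons]
    omega

theorem scanWeight_le_length (w : F2Word) : scanWeight w ≤ w.length + 1 := by
  have h1 := costFrom_le_length none w
  have h2 : scanExtra (scanFrom none w) ≤ 1 := by
    rcases scanFrom none w with _ | s | d <;> simp [scanExtra]
  simp only [scanWeight]
  omega

/-! #### The automorphism `a ↦ a, b ↦ b * a` -/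

/-- The letter `a` that a following negative letter cancels in the image of a word with the given
last letter. -/
def pending : Option Letter → F2Word
  | some (_, true) => [(0, true)]
  | _ => []

/-- What reading the letter `c` after the letter `l` adds to the image, the pending letter
excluded. -/
def image0 (l : Option Letter) (c : Letter) : F2Word :=
  if c = (0, true) then pending l
  else if c = (1, true) then pending l ++ [(1, true)]
  else if c = (0, false) then (if l = some (1, true) then [] else [(0, false)])
  else if l = some (0, true) then [(1, false)] else [(0, false), (1, false)]

/-- The last letters of the image, the pending letter excluded, which are possible after a word
with the given last letter. -/
def lastOk : Option Letter → Option Letter → Bool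
  | none, d => d = none
  | some (0, true), d => d = none ∨ d = some (0, true) ∨ d = some (1, false)
  | some (1, true), d => d = some (1, true)
  | some (0, false), d => d = some (1, true) ∨ d = some (0, false)
  | some (1, false), d => d = some (1, false)

/-- The possible combinations of the last letter of a word, the state of the word, the state of
its image without the pending letter, and a lower bound for the decrease of the cost. -/
def scanTable : List (Option Letter × Scan × Scan × ℕ) :=
  [(none, none, none, 0),
   (some (0, false), some (Sum.inl false), some (Sum.inl false), 0),
   (some (0, false), some (Sum.inr (0, false)), some (Sum.inl true), 1),
   (some (0, false), some (Sum.inr (0, false)), some (Sum.inr (0, false)), 1),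
   (some (0, false), some (Sum.inr (0, false)), some (Sum.inr (1, true)), 1),
   (some (0, true), some (Sum.inl true), none, 0),
   (some (0, true), some (Sum.inl true), some (Sum.inl true), 0),
   (some (0, true), some (Sum.inr (0, true)), some (Sum.inl false), 1),
   (some (0, true), some (Sum.inr (0, true)), some (Sum.inr (0, true)), 1),
   (some (0, true), some (Sum.inr (0, true)), some (Sum.inr (1, false)), 1),
   (some (1, false), some (Sum.inl false), some (Sum.inl false), 0),
   (some (1, false), some (Sum.inr (1, false)), some (Sum.inl false), 0),
   (some (1, false), some (Sum.inr (1, false)), some (Sum.inr (1, false)), 0),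
   (some (1, true), some (Sum.inl true), some (Sum.inl true), 0),
   (some (1, true), some (Sum.inr (1, true)), some (Sum.inl true), 0),
   (some (1, true), some (Sum.inr (1, true)), some (Sum.inr (1, true)), 0)]

/-- The table is closed under reading a letter that keeps the word reduced. Its last entry is a
credit, spent where the image costs more than the letter read. -/
theorem scanTable_step : ∀ t ∈ scanTable, ∀ c : Letter, (∀ x ∈ t.1, x.1 = c.1 → x.2 = c.2) →
    ∃ t' ∈ scanTable, t'.1 = some c ∧ t'.2.1 = scanStep t.2.1 c ∧
      t'.2.2.1 = scanFrom t.2.2.1 (image0 t.1 c) ∧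
      costFrom t.2.2.1 (image0 t.1 c) + t'.2.2.2 ≤ scanCost t.2.1 c + t.2.2.2 := by
  decide

/-- The remaining credit and the extra unit of the source pay for restoring the pending letter. -/
theorem scanTable_final : ∀ t ∈ scanTable,
    costFrom t.2.2.1 (pending t.1) + scanExtra (scanFrom t.2.2.1 (pending t.1)) ≤
      t.2.2.2 + scanExtra t.2.1 := by
  decide

theorem scanTable_free : ∀ t ∈ scanTable, ∀ s, t.2.1 = some (Sum.inl s) →
    scanFrom t.2.2.1 (pending t.1) = some (Sum.inl s) := by
  decide

/-- The last letter of the image is part of the invariant because `image0` may be empty, and then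
reducedness at the next seam depends on an older letter. -/
theorem lastOk_step : ∀ l c : Option Letter, ∀ x : Letter, lastOk l c = true →
    (∀ y ∈ l, y.1 = x.1 → y.2 = x.2) →
    lastOk (some x) ((image0 l x).getLast?.or c) = true ∧
    FreeGroup.IsReduced (c.toList ++ image0 l x ++ pending (some x)) := by
  unfold FreeGroup.IsReduced
  decide

/-- A final `a` of the image is withheld until the next letter is known, since only a following
negative letter can cancel it. -/
theorem mk_image0 : ∀ (l : Option Letter) (c : Letter), (∀ y ∈ l, y.1 = c.1 → y.2 = c.2) →
    FreeGroup.reduce (pending l ++ sub 0 c) =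
      FreeGroup.reduce (image0 l c ++ pending (some c)) := by
  decide

/-- The reduced form of the image of a reduced word. -/
theorem exists_image0 (w : F2Word) (hw : FreeGroup.IsReduced w) :
    ∃ core : F2Word, ∃ k : ℕ,
      FreeGroup.mk (subWord 0 w) = FreeGroup.mk (core ++ pending w.getLast?) ∧
      FreeGroup.IsReduced (core ++ pending w.getLast?) ∧
      lastOk w.getLast? core.getLast? = true ∧
      (w.getLast?, scanFrom none w, scanFrom none core, k) ∈ scanTable ∧
      costFrom none core + k ≤ costFrom none w := by
  induction w using List.reverseRecOn with
  | nil => exact ⟨[], 0, by simp [pending], by simp [pending], by simp [lastOk],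
      by simp [scanTable], by simp⟩
  | append_singleton w c ih =>
    obtain ⟨hw1, -, hw2⟩ := isReduced_append_iff.1 hw
    have hc : ∀ y ∈ w.getLast?, y.1 = c.1 → y.2 = c.2 := fun y hy => hw2 y hy c (by simp)
    obtain ⟨core, k, h1, h2, h3, h4, h5⟩ := ih hw1
    obtain ⟨⟨l, q, p, k'⟩, ht, rfl, rfl, rfl, ht4⟩ := scanTable_step _ h4 c hc
    obtain ⟨h6, h7⟩ := lastOk_step _ _ c h3 hc
    simp only at ht4
    refine ⟨core ++ image0 w.getLast? c, k', ?_, ?_, ?_, ?_, ?_⟩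
    · rw [subWord_append, mk_append, h1, subWord_singleton, List.getLast?_concat, ← mk_append,
        List.append_assoc, List.append_assoc, mk_append, mk_append core,
        FreeGroup.reduce.exact (mk_image0 _ c hc)]
    · rw [List.getLast?_concat]
      rcases List.eq_nil_or_concat core with rfl | ⟨core, d, rfl⟩
      · simpa using h7
      · rw [List.concat_eq_append] at h2 h7 ⊢
        rw [List.getLast?_concat] at h7
        rw [List.append_assoc, List.append_assoc, ← List.append_assoc]
        -- The two reduced words overlap in the last letter `d` of the old image.
        refine FreeGroup.IsReduced.append_overlap ?_ ?_ (by simp)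
        · exact (isReduced_append_iff.1 h2).1
        · simpa using h7
    · rw [List.getLast?_concat, List.getLast?_append]
      exact h6
    · rw [List.getLast?_concat, scanFrom_append, scanFrom_append]
      exact ht
    · rw [costFrom_append, costFrom_append]
      simp only [costFrom_cons, costFrom_nil]
      omega

/-- How the `i`-th automorphism of `Σ` acts on the sign of words all of whose letters have the
same sign. -/
def signAct (i : Fin 3) (s : Bool) : Bool := if i = 1 then !s else s

theorem sub_sign (i : Fin 3) (c d : Letter) (h : d ∈ sub i c) : d.2 = signAct i c.2 := by
  revert h
  revert i c d
  decide

theorem subWord_sign (i : Fin 3) (s : Bool) (w : F2Word) (h : ∀ c ∈ w, c.2 = s) :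
    ∀ d ∈ subWord i w, d.2 = signAct i s := by
  intro d hd
  obtain ⟨c, hc, hd⟩ := List.mem_flatMap.1 hd
  rw [sub_sign i c d hd, h c hc]

/-! ### The weight of a group element under the letters of `Σ` -/

/-- The state reached by scanning the reduced form of `g`. -/
def finalScan (g : F2) : Scan := scanFrom none g.toWord

/-- The scanning weight of the reduced form of `g`. -/
def weight (g : F2) : ℕ := scanWeight g.toWord

/-- The action of letter permutations on states. -/
def scanMap (i : Fin 3) : Scan → Scan
  | none => none
  | some (Sum.inl s) => some (Sum.inl (signAct i s))
  | some (Sum.inr c) => some (Sum.inr ((sub i c).headI))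

@[simp] theorem scanMap_none (i : Fin 3) : scanMap i none = none := rfl

theorem scanMap_step : ∀ i : Fin 3, i ≠ 0 → ∀ (q : Scan) (c : Letter),
    scanStep (scanMap i q) (sub i c).headI = scanMap i (scanStep q c) ∧
      scanCost (scanMap i q) (sub i c).headI = scanCost q c ∧
      scanExtra (scanMap i q) = scanExtra q ∧ sub i c = [(sub i c).headI] := by
  decide

theorem scan_subWord (i : Fin 3) (hi : i ≠ 0) (q : Scan) (w : F2Word) :
    scanFrom (scanMap i q) (subWord i w) = scanMap i (scanFrom q w) ∧
      costFrom (scanMap i q) (subWord i w) = costFrom q w := by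
  induction w generalizing q with
  | nil => simp
  | cons c w ih =>
    obtain ⟨h1, h2, -, h4⟩ := scanMap_step i hi q c
    have h5 : subWord i (c :: w) = (sub i c).headI :: subWord i w := by
      rw [← List.singleton_append, subWord_append, subWord_singleton]
      conv_lhs => rw [h4]
      rfl
    rw [h5, scanFrom_cons, scanFrom_cons, costFrom_cons, costFrom_cons, h1, h2]
    exact ⟨(ih _).1, by rw [(ih _).2]⟩

theorem isReduced_subWord (i : Fin 3) (hi : i ≠ 0) (w : F2Word) (hw : FreeGroup.IsReduced w) :
    FreeGroup.IsReduced (subWord i w) := by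
  have h : subWord i w = w.map fun c => (sub i c).headI := by
    rw [subWord, ← List.flatMap_singleton' (w.map _), List.flatMap_map]
    exact List.flatMap_congr fun c _ => (scanMap_step i hi none c).2.2.2
  rw [h]
  refine List.isChain_map_of_isChain _ ?_ hw
  clear h hw
  revert i
  decide

theorem toWord_sigma (i : Fin 3) (hi : i ≠ 0) (g : F2) :
    (F2.sigma i g).toWord = subWord i g.toWord :=
  toWord_eq_of_isReduced (isReduced_subWord i hi _ FreeGroup.isReduced_toWord)
    (by rw [mk_subWord, FreeGroup.mk_toWord])

theorem exists_toWord_sigma_zero (g : F2) : ∃ t ∈ scanTable, finalScan g = t.2.1 ∧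
    finalScan (F2.sigma 0 g) = scanFrom t.2.2.1 (pending t.1) ∧
    weight (F2.sigma 0 g) + t.2.2.2 ≤ costFrom none g.toWord +
      (costFrom t.2.2.1 (pending t.1) + scanExtra (scanFrom t.2.2.1 (pending t.1))) := by
  obtain ⟨core, k, h1, h2, -, h4, h5⟩ := exists_image0 g.toWord FreeGroup.isReduced_toWord
  have h : (F2.sigma 0 g).toWord = core ++ pending g.toWord.getLast? :=
    toWord_eq_of_isReduced h2 (by rw [← h1, mk_subWord, FreeGroup.mk_toWord])
  refine ⟨_, h4, rfl, ?_, ?_⟩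
  · rw [finalScan, h, scanFrom_append]
  · rw [weight, h, scanWeight, costFrom_append, scanFrom_append]
    simp only
    omega

/-- Letter permutations preserve the weight. Under `a ↦ a, b ↦ b * a` the length may grow, but the
table shows that the cost stays under control. The term `scanExtra` is needed: a final block `b`
that is not the first costs 1, its image `b * a` costs 2. -/
theorem weight_sigma_le (i : Fin 3) (g : F2) : weight (F2.sigma i g) ≤ weight g := by
  by_cases hi : i = 0
  · subst hi
    obtain ⟨t, ht, h1, -, h3⟩ := exists_toWord_sigma_zero g
    have h4 := scanTable_final t ht
    have h5 : weight g = costFrom none g.toWord + scanExtra t.2.1 := by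
      rw [weight, scanWeight, ← h1, finalScan]
    omega
  · obtain ⟨h1, h2⟩ := scan_subWord i hi none g.toWord
    rw [scanMap_none] at h1 h2
    rw [weight, weight, toWord_sigma i hi, scanWeight, scanWeight, h1, h2,
      (scanMap_step i hi _ (0, true)).2.2.1]

theorem finalScan_sigma {i : Fin 3} {g : F2} {s : Bool} (h : finalScan g = some (Sum.inl s)) :
    finalScan (F2.sigma i g) = some (Sum.inl (signAct i s)) := by
  by_cases hi : i = 0
  · subst hi
    obtain ⟨t, ht, h1, h2, -⟩ := exists_toWord_sigma_zero g
    rw [h2]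
    exact scanTable_free t ht s (h1 ▸ h)
  · rw [finalScan, toWord_sigma i hi]
    have h1 := (scan_subWord i hi none g.toWord).1
    rw [scanMap_none] at h1
    rw [h1]
    rw [finalScan] at h
    rw [h]
    rfl

/-! ### Factors of constant sign protected from cancellation -/

/-- The block of sign `s` following a word with final state `q` is not affected by
cancellation. -/
def Guard (s : Bool) (q : Scan) : Prop := q = none ∨ q = some (Sum.inl s)

theorem finalScan_one : finalScan 1 = none := by simp [finalScan]

theorem scanStep_ne_none : ∀ (q : Scan) (c : Letter), scanStep q c ≠ none := by decide

theorem scanFrom_ne_none (q : Scan) (w : F2Word) (hw : w ≠ []) : scanFrom q w ≠ none := by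
  rcases List.eq_nil_or_concat w with rfl | ⟨w, c, rfl⟩
  · exact absurd rfl hw
  · rw [List.concat_eq_append, scanFrom_append]
    exact scanStep_ne_none _ _

theorem eq_one_of_finalScan {g : F2} (h : finalScan g = none) : g = 1 := by
  by_contra hg
  exact scanFrom_ne_none none g.toWord (by simpa using hg) h

theorem Guard.sigma {s : Bool} {g : F2} (h : Guard s (finalScan g)) (i : Fin 3) :
    Guard (signAct i s) (finalScan (F2.sigma i g)) := by
  rcases h with h | h
  · rw [eq_one_of_finalScan h, map_one]
    exact Or.inl finalScan_one
  · exact Or.inr (finalScan_sigma h)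

theorem scanStep_free : ∀ (q : Scan) (c : Letter) (s : Bool),
    scanStep q c = some (Sum.inl s) → c.2 = s := by decide

theorem Guard.getLast? {s : Bool} {w : F2Word} (h : Guard s (scanFrom none w)) :
    ∀ c ∈ w.getLast?, c.2 = s := by
  intro c hc
  rcases List.eq_nil_or_concat w with rfl | ⟨w, d, rfl⟩
  · simp at hc
  · simp only [List.concat_eq_append, List.getLast?_concat, Option.mem_def,
      Option.some.injEq] at hc h
    subst hc
    rcases h with h | h
    · exact absurd h (scanFrom_ne_none _ _ (by simp))
    · rw [scanFrom_append] at h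
      exact scanStep_free _ _ _ h

theorem head?_invRev (w : F2Word) (c : Letter) (h : c ∈ w.head?) :
    Letter.inv c ∈ (FreeGroup.invRev w).getLast? := by
  cases w with
  | nil => simp at h
  | cons d w =>
    simp only [List.head?_cons, Option.mem_def, Option.some.injEq] at h
    subst h
    simp [FreeGroup.invRev, Letter.inv]

theorem Guard.head? {s : Bool} {w : F2Word} (h : Guard (!s) (scanFrom none (FreeGroup.invRev w))) :
    ∀ c ∈ w.head?, c.2 = s := by
  intro c hc
  have h1 := h.getLast? _ (head?_invRev w c hc)
  simpa [Letter.inv] using h1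

/-- The guards force equal signs on both sides of each seam, so no letter meets its inverse, even
when `x` is empty. -/
theorem isReduced_of_guard {s : Bool} {A x B : F2Word} (hA : FreeGroup.IsReduced A)
    (hB : FreeGroup.IsReduced B) (hx : ∀ c ∈ x, c.2 = s) (hgA : Guard s (scanFrom none A))
    (hgB : Guard (!s) (scanFrom none (FreeGroup.invRev B))) :
    FreeGroup.IsReduced (A ++ x ++ B) := by
  have hx' : FreeGroup.IsReduced x := by
    refine List.Pairwise.isChain (List.pairwise_of_forall_mem_list ?_)
    intro c hc d hd _
    rw [hx c hc, hx d hd]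
  refine isReduced_append_iff.2 ⟨isReduced_append_iff.2 ⟨hA, hx', ?_⟩, hB, ?_⟩
  · intro c hc d hd _
    rw [hgA.getLast? c hc, hx d (List.mem_of_mem_head? hd)]
  · intro c hc d hd _
    rw [hgB.head? d hd]
    rw [List.getLast?_append, Option.mem_def, Option.or_eq_some_iff] at hc
    rcases hc with hc | ⟨-, hc⟩
    · exact hx c (List.mem_of_getLast? hc)
    · exact hgA.getLast? c hc

/-- The outer factors are reduced separately and remain guarded, so the middle factor is only
substituted; as the guards are reproduced, this can be iterated along a word over `Σ`. -/
theorem toWord_sigma_of_guard {s : Bool} {g : F2} {A x B : F2Word} (hg : g.toWord = A ++ x ++ B)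
    (hx : ∀ c ∈ x, c.2 = s) (hgA : Guard s (scanFrom none A))
    (hgB : Guard (!s) (scanFrom none (FreeGroup.invRev B))) (i : Fin 3) :
    (F2.sigma i g).toWord = (F2.sigma i (FreeGroup.mk A)).toWord ++ subWord i x ++
        (F2.sigma i (FreeGroup.mk B)).toWord ∧
      Guard (signAct i s) (scanFrom none (F2.sigma i (FreeGroup.mk A)).toWord) ∧
      Guard (!signAct i s)
        (scanFrom none (FreeGroup.invRev (F2.sigma i (FreeGroup.mk B)).toWord)) := by
  have hr : FreeGroup.IsReduced (A ++ x ++ B) := hg ▸ FreeGroup.isReduced_toWord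
  have hA : (FreeGroup.mk A).toWord = A := toWord_eq_of_isReduced
    (hr.infix ⟨[], x ++ B, by simp⟩) rfl
  have hB : (FreeGroup.mk B).toWord = B := toWord_eq_of_isReduced
    (hr.infix ⟨A ++ x, [], by simp⟩) rfl
  have h1 : Guard (signAct i s) (scanFrom none (F2.sigma i (FreeGroup.mk A)).toWord) :=
    Guard.sigma (by rwa [finalScan, hA]) i
  have h2 : Guard (!signAct i s)
      (scanFrom none (FreeGroup.invRev (F2.sigma i (FreeGroup.mk B)).toWord)) := by
    have h3 : Guard (!s) (finalScan (FreeGroup.mk B)⁻¹) := by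
      rwa [finalScan, FreeGroup.toWord_inv, hB]
    have h4 := h3.sigma i
    rw [finalScan, map_inv, FreeGroup.toWord_inv] at h4
    have h5 : signAct i (!s) = !signAct i s := by
      simp only [signAct]
      split_ifs <;> rfl
    rwa [h5] at h4
  refine ⟨toWord_eq_of_isReduced (isReduced_of_guard FreeGroup.isReduced_toWord
    FreeGroup.isReduced_toWord (subWord_sign i s x hx) h1 h2) ?_, h1, h2⟩
  rw [mk_append, mk_append, FreeGroup.mk_toWord, FreeGroup.mk_toWord, mk_subWord, ← map_mul,
    ← map_mul, ← mk_append, ← mk_append, ← hg, FreeGroup.mk_toWord]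

/-! ### Words as relations -/

section Relations

variable {V : Type}

/-- The relation described by a letter. -/
def letterRel (r : Fin 2 → V → V → Prop) (c : Letter) : V → V → Prop :=
  if c.2 then r c.1 else fun x y => r c.1 y x

/-- The relation described by a word. -/
def wordRel (r : Fin 2 → V → V → Prop) : F2Word → V → V → Prop
  | [] => fun x y => x = y
  | c :: w => fun x z => ∃ y, letterRel r c x y ∧ wordRel r w y z

theorem wordRel_append (r : Fin 2 → V → V → Prop) (v w : F2Word) (x z : V) :
    wordRel r (v ++ w) x z ↔ ∃ y, wordRel r v x y ∧ wordRel r w y z := by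
  induction v generalizing x with
  | nil => simp [wordRel]
  | cons c v ih =>
    simp only [List.cons_append, wordRel, ih]
    constructor
    · rintro ⟨y, h1, y', h2, h3⟩
      exact ⟨y', ⟨y, h1, h2⟩, h3⟩
    · rintro ⟨y', ⟨y, h1, h2⟩, h3⟩
      exact ⟨y, h1, y', h2, h3⟩

/-- The relations described by the images of the generators. -/
def subRel (i : Fin 3) (r : Fin 2 → V → V → Prop) : Fin 2 → V → V → Prop :=
  fun j => wordRel r (sub i (j, true))

theorem letterRel_subRel (i : Fin 3) (r : Fin 2 → V → V → Prop) (c : Letter) :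
    letterRel (subRel i r) c = wordRel r (sub i c) := by
  obtain ⟨j, s⟩ := c
  funext x y
  fin_cases i <;> fin_cases j <;> cases s <;>
    simp [letterRel, subRel, sub, wordRel, and_comm]

theorem wordRel_subRel (i : Fin 3) (r : Fin 2 → V → V → Prop) (w : F2Word) :
    wordRel (subRel i r) w = wordRel r (subWord i w) := by
  funext x z
  induction w generalizing x with
  | nil => rfl
  | cons c w ih =>
    rw [← List.singleton_append, subWord_append, subWord_singleton]
    simp only [List.singleton_append, wordRel, wordRel_append, ih, letterRel_subRel]

variable (V) in
/-- Two words are equivalent if they describe the same relation, for any two relations on `V`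
described by the generators. -/
def WordEquiv (v w : F2Word) : Prop := ∀ r : Fin 2 → V → V → Prop, wordRel r v = wordRel r w

/-- A substitution in the word amounts to a change of the relations interpreting the generators, and
the equivalence quantifies over all of them. -/
theorem WordEquiv.subWord {v w : F2Word} (h : WordEquiv V v w) (i : Fin 3) :
    WordEquiv V (subWord i v) (subWord i w) := fun r => by
  rw [← wordRel_subRel, ← wordRel_subRel, h]

theorem WordEquiv.append {v w v' w' : F2Word} (h : WordEquiv V v w) (h' : WordEquiv V v' w') :
    WordEquiv V (v ++ v') (w ++ w') := fun r => by
  funext x z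
  simp only [wordRel_append, h r, h' r]

variable (V) in
/-- `h` is obtained from `g` by exchanging a factor of the reduced form, all of whose letters
have the same sign, by an equivalent one. -/
def Exchange (g h : F2) : Prop :=
  ∃ (s : Bool) (A x y B : F2Word), g.toWord = A ++ x ++ B ∧ h.toWord = A ++ y ++ B ∧
    (∀ c ∈ x, c.2 = s) ∧ (∀ c ∈ y, c.2 = s) ∧ Guard s (scanFrom none A) ∧
    Guard (!s) (scanFrom none (FreeGroup.invRev B)) ∧ WordEquiv V x y

theorem Exchange.sigma {g h : F2} (H : Exchange V g h) (i : Fin 3) :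
    Exchange V (F2.sigma i g) (F2.sigma i h) := by
  obtain ⟨s, A, x, y, B, hg, hh, hx, hy, hA, hB, hxy⟩ := H
  obtain ⟨h1, h2, h3⟩ := toWord_sigma_of_guard hg hx hA hB i
  obtain ⟨h4, -, -⟩ := toWord_sigma_of_guard hh hy hA hB i
  exact ⟨_, _, _, _, _, h1, h4, subWord_sign i s x hx, subWord_sign i s y hy, h2, h3,
    hxy.subWord i⟩

end Relations

/-! ### Shortening words -/

/-- Pigeonhole on the prefixes: cut out what lies between two prefixes with the same value. The
result is a sublist, so signs of letters are inherited. -/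
theorem exists_shorter {α β : Type*} (f : List β → α)
    (hf : ∀ x y z, f x = f y → f (x ++ z) = f (y ++ z)) (s : Finset α) (hs : ∀ w, f w ∈ s)
    (w : List β) (hw : s.card ≤ w.length) :
    ∃ v, v.Sublist w ∧ f v = f w ∧ v.length < w.length := by
  have hcard : s.card < (Finset.range (w.length + 1)).card := by
    rw [Finset.card_range]
    omega
  obtain ⟨i, hi, j, hj, hij, h⟩ := Finset.exists_ne_map_eq_of_card_lt_of_maps_to hcard
    (f := fun i => f (w.take i)) (fun i _ => hs _)
  have key : ∀ i j : ℕ, i < j → j ≤ w.length → f (w.take i) = f (w.take j) →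
      ∃ v, v.Sublist w ∧ f v = f w ∧ v.length < w.length := by
    intro i j hij hj h
    refine ⟨w.take i ++ w.drop j, ?_, ?_, ?_⟩
    · conv_rhs => rw [← List.take_append_drop j w]
      exact List.Sublist.append (List.take_sublist_take_left hij.le) (List.Sublist.refl _)
    · rw [hf _ _ _ h, List.take_append_drop]
    · simp only [List.length_append, List.length_take, List.length_drop]
      omega
  simp only [Finset.mem_range] at hi hj
  rcases lt_or_gt_of_ne hij with hij | hij
  · exact key i j hij (by omega) h
  · exact key j i hij (by omega) h.symm

theorem exists_short {α β : Type*} (f : List β → α)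
    (hf : ∀ x y z, f x = f y → f (x ++ z) = f (y ++ z)) (s : Finset α) (hs : ∀ w, f w ∈ s)
    (w : List β) : ∃ v, f v = f w ∧ v.length < s.card := by
  induction hn : w.length using Nat.strong_induction_on generalizing w with
  | _ n ih =>
    by_cases h : w.length < s.card
    · exact ⟨w, rfl, h⟩
    · obtain ⟨v, -, h1, h2⟩ := exists_shorter f hf s hs w (by omega)
      obtain ⟨u, h3, h4⟩ := ih v.length (by omega) v rfl
      exact ⟨u, h3.trans h1, h4⟩

/-- Among `M + 1` consecutive factors of length `C`, one costs nothing. -/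
theorem exists_free_factor (C M : ℕ) (q : Scan) (w : F2Word) (h : costFrom q w ≤ M)
    (hw : (M + 1) * C ≤ w.length) :
    ∃ A x B, w = A ++ x ++ B ∧ x.length = C ∧ costFrom (scanFrom q A) x = 0 := by
  induction M generalizing q w with
  | zero =>
    have h1 : costFrom q (w.take C) + costFrom (scanFrom q (w.take C)) (w.drop C) = costFrom q w :=
      by rw [← costFrom_append, List.take_append_drop]
    exact ⟨[], w.take C, w.drop C, by simp, by simp; omega, by simp; omega⟩
  | succ M ih =>
    have h1 : costFrom q (w.take C) + costFrom (scanFrom q (w.take C)) (w.drop C) = costFrom q w :=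
      by rw [← costFrom_append, List.take_append_drop]
    have h2 : (M + 1 + 1) * C = (M + 1) * C + C := by ring
    by_cases h3 : costFrom q (w.take C) = 0
    · exact ⟨[], w.take C, w.drop C, by simp, by simp; omega, by simpa using h3⟩
    · obtain ⟨A, x, B, h4, h5, h6⟩ := ih (scanFrom q (w.take C)) (w.drop C) (by omega)
        (by rw [List.length_drop]; omega)
      refine ⟨w.take C ++ A, x, B, ?_, h5, by rwa [scanFrom_append]⟩
      rw [List.append_assoc, List.append_assoc, ← List.append_assoc A, ← h4,
        List.take_append_drop]

theorem scanCost_eq_zero : ∀ (q : Scan) (c : Letter), scanCost q c = 0 →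
    (q = none ∨ q = some (Sum.inl c.2)) ∧ scanStep q c = some (Sum.inl c.2) := by decide

theorem scan_of_guard {s : Bool} {q : Scan} {w : F2Word} (hw : w ≠ []) (hs : ∀ c ∈ w, c.2 = s)
    (hq : Guard s q) : costFrom q w = 0 ∧ scanFrom q w = some (Sum.inl s) := by
  induction w generalizing q with
  | nil => exact absurd rfl hw
  | cons c w ih =>
    have hc : c.2 = s := hs c (by simp)
    have h1 : scanStep q c = some (Sum.inl s) ∧ scanCost q c = 0 := by
      rcases hq with rfl | rfl <;> simp [scanStep, scanCost, hc]
    rw [costFrom_cons, scanFrom_cons, h1.1, h1.2]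
    by_cases hw' : w = []
    · subst hw'
      simp
    · have h2 := ih hw' (fun d hd => hs d (by simp [hd])) (Or.inr rfl)
      exact ⟨by omega, h2.2⟩

theorem guard_of_costFrom {q : Scan} {w : F2Word} (hw : w ≠ []) (h : costFrom q w = 0) :
    ∃ s, Guard s q ∧ ∀ c ∈ w, c.2 = s := by
  induction w generalizing q with
  | nil => exact absurd rfl hw
  | cons c w ih =>
    rw [costFrom_cons] at h
    obtain ⟨h1, h2⟩ := scanCost_eq_zero q c (by omega)
    refine ⟨c.2, h1, ?_⟩
    by_cases hw' : w = []
    · subst hw'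
      simp
    · obtain ⟨s, h3, h4⟩ := ih hw' (by omega : costFrom (scanStep q c) w = 0)
      rw [h2] at h3
      rcases h3 with h3 | h3
      · exact absurd h3 (by simp)
      · simp only [Option.some.injEq, Sum.inl.injEq] at h3
        intro d hd
        rcases List.mem_cons.1 hd with rfl | hd
        · rfl
        · rw [h4 d hd, h3]

/-- The number of functions from pairs of relations to relations on a set with `k` elements. -/
def relCount (k : ℕ) : ℕ := ((2 ^ k) ^ k) ^ (((2 ^ k) ^ k) ^ 2)

theorem invRev_append (v w : F2Word) :
    FreeGroup.invRev (v ++ w) = FreeGroup.invRev w ++ FreeGroup.invRev v := by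
  simp [FreeGroup.invRev]

theorem mem_invRev {w : F2Word} {c : Letter} (h : c ∈ FreeGroup.invRev w) :
    Letter.inv c ∈ w := by
  simp only [FreeGroup.invRev, List.mem_reverse, List.mem_map] at h
  obtain ⟨d, hd, rfl⟩ := h
  simpa [Letter.inv] using hd

section Bounded

variable {V : Type} [Fintype V]

theorem exists_wordEquiv_shorter (w : F2Word) (hw : relCount (Fintype.card V) ≤ w.length) :
    ∃ v, v.Sublist w ∧ WordEquiv V v w ∧ v.length < w.length := by
  classical
  have hcard : (Finset.univ : Finset ((Fin 2 → V → V → Prop) → V → V → Prop)).card =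
      relCount (Fintype.card V) := by
    simp [relCount]
  obtain ⟨v, h1, h2, h3⟩ := exists_shorter
    (fun (w : F2Word) (r : Fin 2 → V → V → Prop) => wordRel r w)
    (fun x y z h => funext (WordEquiv.append (fun r => congrFun h r) fun r => rfl)) Finset.univ
    (fun _ => Finset.mem_univ _) w (hcard ▸ hw)
  exact ⟨v, h1, fun r => congrFun h2 r, h3⟩

/-- A bound for the length of the reduced form of a shortest element which can be reached by
exchanges. -/
def repBound (M c : ℕ) : ℕ := (M + 1) * ((M + 1) * (c + 1))

/-- A factor free for the direct scan is extracted first, then inside it one free for the scan of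
the inverse; this gives the two factors `M + 1` of `repBound`. The inner factor has constant sign
and is guarded on both sides. -/
theorem exists_exchange_shorter (M : ℕ) (g : F2) (h1 : costFrom none g.toWord ≤ M)
    (h2 : costFrom none (FreeGroup.invRev g.toWord) ≤ M)
    (h3 : repBound M (relCount (Fintype.card V)) ≤ g.norm) :
    ∃ h, Exchange V g h ∧ h.norm < g.norm ∧ costFrom none h.toWord ≤ M ∧
      costFrom none (FreeGroup.invRev h.toWord) ≤ M := by
  set c := relCount (Fintype.card V)
  obtain ⟨A, x, B, hg, hx, hx0⟩ := exists_free_factor ((M + 1) * (c + 1)) M none g.toWord h1 h3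
  have h2' : costFrom (scanFrom none (FreeGroup.invRev B)) (FreeGroup.invRev x) ≤ M := by
    rw [hg, invRev_append, invRev_append, costFrom_append, costFrom_append] at h2
    omega
  obtain ⟨B', y, A', hx', hy, hy0⟩ := exists_free_factor (c + 1) M _ (FreeGroup.invRev x) h2'
    (by simp [hx])
  have hxe : x = FreeGroup.invRev A' ++ FreeGroup.invRev y ++ FreeGroup.invRev B' := by
    rw [← FreeGroup.invRev_invRev (L₁ := x), hx', invRev_append, invRev_append,
      List.append_assoc]
  have hg' : g.toWord = (A ++ FreeGroup.invRev A') ++ FreeGroup.invRev y ++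
      (FreeGroup.invRev B' ++ B) := by
    rw [hg, hxe]
    simp only [List.append_assoc]
  have hB' : FreeGroup.invRev (FreeGroup.invRev B' ++ B) = FreeGroup.invRev B ++ B' := by
    rw [invRev_append, FreeGroup.invRev_invRev]
  have hyne : y ≠ [] := by
    rintro rfl
    simp at hy
  have hy0' : costFrom (scanFrom none (A ++ FreeGroup.invRev A')) (FreeGroup.invRev y) = 0 := by
    rw [hxe, costFrom_append, costFrom_append, ← scanFrom_append] at hx0
    omega
  have hyne' : FreeGroup.invRev y ≠ [] := by simpa [FreeGroup.invRev] using hyne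
  obtain ⟨s, hs1, hs2⟩ := guard_of_costFrom hyne' hy0'
  obtain ⟨s', hs3, hs4⟩ := guard_of_costFrom hyne hy0
  rw [← scanFrom_append, ← hB'] at hs3
  -- The first letter is kept and only the tail is shortened: a nonempty replacement leaves the scan
  -- states after it, hence both costs, unchanged.
  obtain ⟨e, t, he⟩ := List.exists_cons_of_ne_nil hyne'
  have hss : s' = !s := by
    have h4 := hs4 _ (mem_invRev (c := e) (by rw [he]; simp))
    have h5 := hs2 e (by rw [he]; simp)
    rw [← h4, ← h5]
    rfl
  subst hss
  have ht : relCount (Fintype.card V) ≤ t.length := by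
    have h4 : (FreeGroup.invRev y).length = c + 1 := by simp [hy]
    rw [he, List.length_cons] at h4
    omega
  obtain ⟨t', ht1, ht2, ht3⟩ := exists_wordEquiv_shorter t ht
  have hz : ∀ d ∈ e :: t', d.2 = s := by
    intro d hd
    apply hs2
    rw [he]
    exact (List.Sublist.cons_cons e ht1).subset hd
  set A₁ := A ++ FreeGroup.invRev A'
  set B₁ := FreeGroup.invRev B' ++ B
  have hred : FreeGroup.IsReduced (A₁ ++ FreeGroup.invRev y ++ B₁) :=
    hg' ▸ FreeGroup.isReduced_toWord
  have hh : (FreeGroup.mk (A₁ ++ (e :: t') ++ B₁) : F2).toWord = A₁ ++ (e :: t') ++ B₁ :=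
    toWord_eq_of_isReduced (isReduced_of_guard (hred.infix ⟨[], FreeGroup.invRev y ++ B₁, by simp⟩)
      (hred.infix ⟨A₁ ++ FreeGroup.invRev y, [], by simp⟩) hz hs1 hs3) rfl
  have hcost : ∀ (s : Bool) (A B x z : F2Word), x ≠ [] → z ≠ [] → (∀ c ∈ x, c.2 = s) →
      (∀ c ∈ z, c.2 = s) → Guard s (scanFrom none A) →
      costFrom none (A ++ x ++ B) = costFrom none (A ++ z ++ B) := by
    intro s A B x z hx hz hxs hzs hA
    rw [costFrom_append, costFrom_append, costFrom_append, costFrom_append, scanFrom_append,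
      scanFrom_append, (scan_of_guard hx hxs hA).1, (scan_of_guard hx hxs hA).2,
      (scan_of_guard hz hzs hA).1, (scan_of_guard hz hzs hA).2]
  refine ⟨FreeGroup.mk (A₁ ++ (e :: t') ++ B₁), ⟨s, A₁, FreeGroup.invRev y, e :: t', B₁, hg', hh,
    hs2, hz, hs1, hs3, ?_⟩, ?_, ?_, ?_⟩
  · rw [he]
    exact WordEquiv.append (v := [e]) (w := [e]) (fun r => rfl) fun r => (ht2 r).symm
  · rw [FreeGroup.norm, FreeGroup.norm, hh, hg', he]
    simp only [List.length_append, List.length_cons]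
    omega
  · rw [hh, ← hcost s A₁ B₁ _ _ hyne' (by simp) hs2 hz hs1, ← hg']
    exact h1
  · rw [hh, invRev_append _ B₁, invRev_append A₁, ← List.append_assoc,
      ← hcost (!s) (FreeGroup.invRev B₁) (FreeGroup.invRev A₁) y _ hyne
        (by simp [FreeGroup.invRev]) hs4 ?_ hs3]
    · have h4 : FreeGroup.invRev g.toWord =
          FreeGroup.invRev B₁ ++ y ++ FreeGroup.invRev A₁ := by
        rw [hg', invRev_append _ B₁, invRev_append A₁, FreeGroup.invRev_invRev, List.append_assoc]
      rwa [← h4]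
    · intro d hd
      have h4 := hz _ (mem_invRev hd)
      simpa [Letter.inv, Bool.not_eq_eq_eq_not] using h4

theorem exists_bounded_exchange (M : ℕ) (g : F2) (h1 : costFrom none g.toWord ≤ M)
    (h2 : costFrom none (FreeGroup.invRev g.toWord) ≤ M) :
    ∃ h, Relation.ReflTransGen (Exchange V) g h ∧
      h.norm ≤ repBound M (relCount (Fintype.card V)) := by
  induction hn : g.norm using Nat.strong_induction_on generalizing g with
  | _ n ih =>
    by_cases h3 : repBound M (relCount (Fintype.card V)) ≤ g.norm
    · obtain ⟨h, h4, h5, h6, h7⟩ := exists_exchange_shorter (V := V) M g h1 h2 h3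
      obtain ⟨k, h8, h9⟩ := ih h.norm (by omega) h h6 h7 rfl
      exact ⟨k, Relation.ReflTransGen.head h4 h8, h9⟩
    · exact ⟨g, Relation.ReflTransGen.refl, by omega⟩

end Bounded

/-! ### Exchanges and fixed points -/

section Convex

variable {X : Type} [MulAction F2 X]

/-- A set is convex if the paths labelled by reduced words between two points of the set stay in
the set. -/
def PathConvex (S : Set X) : Prop :=
  ∀ x ∈ S, ∀ w : F2Word, FreeGroup.IsReduced w → (FreeGroup.mk w)⁻¹ • x ∈ S →
    ∀ p, p <+: w → (FreeGroup.mk p)⁻¹ • x ∈ S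

/-- The relations on a subset described by the action of the generators. -/
def actionRel (S : Set X) (j : Fin 2) (x y : S) : Prop := (FreeGroup.of j)⁻¹ • x.1 = y.1

theorem letterRel_actionRel (S : Set X) (c : Letter) (x y : S) :
    letterRel (actionRel S) c x y ↔ (FreeGroup.mk [c])⁻¹ • x.1 = y.1 := by
  obtain ⟨j, s⟩ := c
  cases s
  · have h : (FreeGroup.mk [(j, false)] : F2) = (FreeGroup.of j)⁻¹ := rfl
    rw [h, inv_inv]
    simp only [letterRel, Bool.false_eq_true, if_false, actionRel]
    rw [inv_smul_eq_iff, eq_comm]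
  · rfl

theorem mk_cons_inv_smul (c : Letter) (w : F2Word) (x : X) :
    (FreeGroup.mk (c :: w))⁻¹ • x = (FreeGroup.mk w)⁻¹ • (FreeGroup.mk [c])⁻¹ • x := by
  rw [mk_cons_eq, mul_inv_rev, mul_smul]

theorem wordRel_actionRel (S : Set X) (w : F2Word) (x y : S) :
    wordRel (actionRel S) w x y ↔
      (FreeGroup.mk w)⁻¹ • x.1 = y.1 ∧ ∀ p, p <+: w → (FreeGroup.mk p)⁻¹ • x.1 ∈ S := by
  induction w generalizing x with
  | nil =>
    have h : (FreeGroup.mk [] : F2) = 1 := rfl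
    simp only [wordRel, List.prefix_nil, forall_eq, h, inv_one, one_smul, x.2, and_true]
    exact Subtype.ext_iff
  | cons c w ih =>
    simp only [wordRel, letterRel_actionRel, ih]
    constructor
    · rintro ⟨z, h1, h2, h3⟩
      refine ⟨by rw [mk_cons_inv_smul, h1, h2], fun p hp => ?_⟩
      rcases List.prefix_cons_iff.1 hp with rfl | ⟨p, rfl, hp'⟩
      · simp [← FreeGroup.one_eq_mk]
      · rw [mk_cons_inv_smul, h1]
        exact h3 p hp'
    · rintro ⟨h1, h2⟩
      refine ⟨⟨_, h2 [c] (by simp)⟩, rfl, ?_, fun p hp => ?_⟩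
      · exact (mk_cons_inv_smul c w x.1).symm.trans h1
      · have h3 := h2 (c :: p) (List.prefix_cons_inj c |>.2 hp)
        rwa [mk_cons_inv_smul] at h3

theorem PathConvex.wordRel_iff {S : Set X} (hS : PathConvex S) {w : F2Word}
    (hw : FreeGroup.IsReduced w) (x y : S) :
    wordRel (actionRel S) w x y ↔ (FreeGroup.mk w)⁻¹ • x.1 = y.1 := by
  rw [wordRel_actionRel]
  exact ⟨And.left, fun h => ⟨h, hS x x.2 w hw (h ▸ y.2)⟩⟩

/-- By convexity the reduced word of `g` fixes `x` exactly when it relates `x` to itself inside `S`,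
and this depends only on its equivalence class. -/
theorem Exchange.smul_eq_iff {S : Set X} (hS : PathConvex S) {g h : F2} (H : Exchange S g h)
    (x : S) : g⁻¹ • x.1 = x.1 ↔ h⁻¹ • x.1 = x.1 := by
  have key : ∀ g : F2, g⁻¹ • x.1 = x.1 ↔ wordRel (actionRel S) g.toWord x x := by
    intro g
    rw [hS.wordRel_iff FreeGroup.isReduced_toWord, FreeGroup.mk_toWord]
  obtain ⟨s, A, v, w, B, hg, hh, -, -, -, -, hvw⟩ := H
  have h1 : WordEquiv S g.toWord h.toWord := by
    rw [hg, hh]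
    exact (WordEquiv.append (fun r => rfl) hvw).append fun r => rfl
  rw [key, key, h1]

end Convex

/-! ### Paths labelled by words -/

/-- Reduction removes backtracking only: every vertex visited by the reduced path is visited by the
original one. -/
theorem exists_prefix_of_red {v w p : F2Word} (h : FreeGroup.Red v w) (hp : p <+: w) :
    ∃ q, q <+: v ∧ (FreeGroup.mk q : F2) = FreeGroup.mk p := by
  induction h generalizing p with
  | refl => exact ⟨p, hp, rfl⟩
  | tail _ h ih =>
    cases h with
    | @not L₁ L₂ x b =>
      rcases List.prefix_or_prefix_of_prefix hp (List.prefix_append L₁ L₂) with h | ⟨r, rfl⟩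
      · exact ih (h.trans (List.prefix_append _ _))
      · obtain ⟨q, hq, hqp⟩ := ih (p := L₁ ++ (x, b) :: (x, !b) :: r) (by
          rw [List.prefix_append_right_inj] at hp ⊢
          rwa [List.prefix_cons_inj, List.prefix_cons_inj])
        exact ⟨q, hq, hqp.trans (Quot.sound FreeGroup.Red.Step.not)⟩

theorem exists_mul_toWord {v w : F2Word} (hv : FreeGroup.IsReduced v)
    (hw : FreeGroup.IsReduced w) :
    ∃ p q r, v = p ++ q ∧ w = FreeGroup.invRev q ++ r ∧ FreeGroup.IsReduced (p ++ r) := by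
  induction w generalizing v with
  | nil => exact ⟨v, [], [], by simp, by simp, by simpa using hv⟩
  | cons c w ih =>
    by_cases h : ∃ u, v = u ++ [Letter.inv c]
    · obtain ⟨u, rfl⟩ := h
      obtain ⟨p, q, r, rfl, rfl, h⟩ := ih (isReduced_append_iff.1 hv).1
        (hw.infix (List.suffix_cons _ _).isInfix)
      refine ⟨p, q ++ [Letter.inv c], r, by simp, ?_, h⟩
      rw [invRev_append]
      simp [FreeGroup.invRev, Letter.inv]
    · refine ⟨v, [], c :: w, by simp, by simp, isReduced_append_iff.2 ⟨hv, hw, ?_⟩⟩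
      intro x hx y hy hxy
      simp only [List.head?_cons, Option.mem_def, Option.some.injEq] at hy
      subst hy
      by_contra hne
      apply h
      rcases List.eq_nil_or_concat v with rfl | ⟨u, d, rfl⟩
      · simp at hx
      · simp only [List.concat_eq_append, List.getLast?_concat, Option.mem_def,
          Option.some.injEq] at hx
        subst hx
        refine ⟨u, ?_⟩
        rw [List.concat_eq_append]
        congr 2
        refine Prod.ext hxy ?_
        simpa [Letter.inv, Bool.eq_not] using hne

/-- A shorter factor cannot cancel all of `g`. -/
theorem head?_toWord_mul {g h : F2} (hgh : h.norm < g.norm) :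
    (g * h).toWord.head? = g.toWord.head? := by
  obtain ⟨p, q, r, h1, h2, h3⟩ := exists_mul_toWord (FreeGroup.isReduced_toWord (x := g))
    (FreeGroup.isReduced_toWord (x := h))
  have h4 : (g * h).toWord = p ++ r := by
    refine toWord_eq_of_isReduced h3 ?_
    rw [← FreeGroup.mk_toWord (x := g), ← FreeGroup.mk_toWord (x := h), h1, h2, mk_append,
      mk_append, mk_append, ← FreeGroup.inv_mk]
    group
  have h5 : p ≠ [] := by
    rintro rfl
    rw [FreeGroup.norm, FreeGroup.norm, h1, h2] at hgh
    simp at hgh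
  rw [h4, h1, List.head?_append_of_ne_nil _ h5, List.head?_append_of_ne_nil _ h5]

section Action

variable {X : Type} [MulAction F2 X]

/-- The path with label `w` from `x` stays in the set `S`. -/
def RunsIn (S : Set X) (x : X) (w : F2Word) : Prop :=
  ∀ p, p <+: w → (FreeGroup.mk p)⁻¹ • x ∈ S

theorem RunsIn.append {S : Set X} {x : X} {v w : F2Word} (hv : RunsIn S x v)
    (hw : RunsIn S ((FreeGroup.mk v)⁻¹ • x) w) : RunsIn S x (v ++ w) := by
  intro p hp
  rcases List.prefix_or_prefix_of_prefix hp (List.prefix_append v w) with h | ⟨r, rfl⟩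
  · exact hv p h
  · rw [mk_append, mul_inv_rev, mul_smul]
    exact hw r ((List.prefix_append_right_inj _).1 hp)

theorem RunsIn.invRev {S : Set X} {x : X} {w : F2Word} (hw : RunsIn S x w) :
    RunsIn S ((FreeGroup.mk w)⁻¹ • x) (FreeGroup.invRev w) := by
  rintro p ⟨q, hq⟩
  have h1 : FreeGroup.invRev q ++ FreeGroup.invRev p = w := by
    rw [← invRev_append, hq, FreeGroup.invRev_invRev]
  have h2 := hw (FreeGroup.invRev q) ⟨_, h1⟩
  rw [← h1, mk_append, ← FreeGroup.inv_mk (L := p), mul_inv_rev, inv_inv, mul_smul,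
    inv_smul_smul]
  exact h2

theorem RunsIn.of_mk_eq {S : Set X} {x : X} {v w : F2Word} (hv : RunsIn S x v)
    (hw : FreeGroup.IsReduced w) (h : (FreeGroup.mk v : F2) = FreeGroup.mk w) :
    RunsIn S x w := by
  intro p hp
  have h1 : FreeGroup.Red v w := by
    have h2 : FreeGroup.reduce v = w := by rw [FreeGroup.reduce.sound h, hw.reduce_eq]
    exact h2 ▸ FreeGroup.reduce.red
  obtain ⟨q, hq, hqp⟩ := exists_prefix_of_red h1 hp
  rw [← hqp]
  exact hv q hq

/-- A nontrivial cyclically reduced element only fixes points of a convex set which meets all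
orbits. -/
theorem PathConvex.mem_of_smul_eq {S : Set X} (hS : PathConvex S) {x : X}
    (hx : ∃ g : F2, g • x ∈ S) {w : F2} (hw : w ≠ 1) (hfix : w⁻¹ • x = x)
    (hcyc : ∀ c, c ∈ w.toWord.head? → c ∉ w⁻¹.toWord.head?) : x ∈ S := by
  classical
  by_contra hxS
  have hex : ∃ n, ∃ s : F2, s⁻¹ • x ∈ S ∧ s.norm = n := by
    obtain ⟨g, hg⟩ := hx
    exact ⟨_, g⁻¹, by simpa using hg, rfl⟩
  obtain ⟨s, hs, hn⟩ := Nat.find_spec hex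
  have hmin : ∀ t : F2, t⁻¹ • x ∈ S → s.norm ≤ t.norm := fun t ht =>
    hn ▸ Nat.find_min' hex ⟨t, ht, rfl⟩
  have hs1 : s.toWord ≠ [] := by
    intro h
    rw [FreeGroup.toWord_eq_nil_iff] at h
    subst h
    exact hxS (by simpa using hs)
  obtain ⟨e, t, het⟩ := List.exists_cons_of_ne_nil hs1
  -- Let `s` label a shortest path from `x` to `S`, with first letter `e`. If `w` does not begin
  -- with `e`, then `s⁻¹ * w` is reduced as written and `s⁻¹ * w * s` begins like `s⁻¹`. It labels a
  -- closed path at a point of `S`, so by convexity its first step stays in `S`, which yields a path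
  -- from `x` shorter than `s`.
  have key : ∀ w : F2, w ≠ 1 → w⁻¹ • x = x → e ∈ w.toWord.head? := by
    intro w hw hfix
    by_contra he
    have hw' : w.toWord ≠ [] := by simpa using hw
    obtain ⟨d, v, hdv⟩ := List.exists_cons_of_ne_nil hw'
    have hred : FreeGroup.IsReduced (s⁻¹.toWord ++ w.toWord) := by
      refine isReduced_append_iff.2 ⟨FreeGroup.isReduced_toWord, FreeGroup.isReduced_toWord, ?_⟩
      intro y hy z hz
      rw [hdv] at hz he
      simp only [List.head?_cons, Option.mem_def, Option.some.injEq] at hz he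
      subst hz
      rw [FreeGroup.toWord_inv, het] at hy
      simp only [FreeGroup.invRev, List.map_cons, List.reverse_cons, List.getLast?_concat,
        Option.mem_def, Option.some.injEq] at hy
      subst hy
      simp only
      intro h1
      by_contra h2
      exact he (Prod.ext h1.symm (by simpa [Bool.not_eq_eq_eq_not] using Ne.symm h2))
    have hprod : (s⁻¹ * w).toWord = s⁻¹.toWord ++ w.toWord :=
      toWord_eq_of_isReduced hred (by rw [mk_append, FreeGroup.mk_toWord, FreeGroup.mk_toWord])
    have hinv : s⁻¹.toWord ≠ [] := by
      rw [FreeGroup.toWord_inv]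
      simpa [FreeGroup.invRev] using hs1
    obtain ⟨f, r, hfr⟩ := List.exists_cons_of_ne_nil hinv
    have hhead : (s⁻¹ * w * s).toWord.head? = some f := by
      rw [head?_toWord_mul, hprod, hfr]
      · rfl
      · rw [FreeGroup.norm, FreeGroup.norm, hprod, List.length_append, FreeGroup.toWord_inv,
          FreeGroup.invRev_length, hdv, List.length_cons]
        omega
    have hpre : [f] <+: (s⁻¹ * w * s).toWord := by
      rcases hl : (s⁻¹ * w * s).toWord with _ | ⟨f', l⟩
      · rw [hl] at hhead
        simp at hhead
      · rw [hl] at hhead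
        simp only [List.head?_cons, Option.some.injEq] at hhead
        subst hhead
        exact ⟨l, rfl⟩
    have hfS := hS (s⁻¹ • x) hs _ FreeGroup.isReduced_toWord (by
      rw [FreeGroup.mk_toWord, mul_inv_rev, mul_inv_rev, inv_inv, mul_smul, mul_smul,
        smul_inv_smul, hfix]
      exact hs) [f] hpre
    have hsr : (FreeGroup.mk [f])⁻¹ * s⁻¹ = FreeGroup.mk r := by
      rw [← FreeGroup.mk_toWord (x := s⁻¹), hfr, mk_cons_eq f r, inv_mul_cancel_left]
    rw [← mul_smul, hsr, ← inv_inv (FreeGroup.mk r)] at hfS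
    have h1 := hmin _ hfS
    have h2 : (FreeGroup.mk r)⁻¹.norm ≤ r.length := by
      rw [FreeGroup.norm_inv_eq]
      exact FreeGroup.norm_mk_le
    have h3 : s.norm = r.length + 1 := by
      rw [← FreeGroup.norm_inv_eq, FreeGroup.norm, hfr, List.length_cons]
    omega
  exact hcyc e (key w hw hfix) (key w⁻¹ (by simpa using hw)
    (by rw [inv_inv]; exact (inv_smul_eq_iff.1 hfix).symm))

/-- Write `w = C D C⁻¹` with `D` cyclically reduced: `D` fixes `C⁻¹ • x`, which therefore lies in
`S`. -/
theorem PathConvex.exists_smul_mem {S : Set X} (hS : PathConvex S)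
    (hX : ∀ x : X, ∃ g : F2, g • x ∈ S) {x : X} {w : F2} (hw : w ≠ 1) (hfix : w⁻¹ • x = x) :
    ∃ t : F2, t.norm ≤ w.norm ∧ t⁻¹ • x ∈ S := by
  set C := FreeGroup.reduceCyclically.conjugator w.toWord
  set D := FreeGroup.reduceCyclically w.toWord
  have h1 : C ++ D ++ FreeGroup.invRev C = w.toWord :=
    FreeGroup.reduceCyclically.conj_conjugator_reduceCyclically _
  have h2 : FreeGroup.IsCyclicallyReduced D :=
    FreeGroup.reduceCyclically.isCyclicallyReduced FreeGroup.isReduced_toWord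
  have h3 : w = FreeGroup.mk C * FreeGroup.mk D * (FreeGroup.mk C)⁻¹ := by
    rw [← FreeGroup.mk_toWord (x := w), ← h1, mk_append, mk_append, FreeGroup.inv_mk]
  have h4 : (FreeGroup.mk D).toWord = D := toWord_eq_of_isReduced h2.isReduced rfl
  refine ⟨FreeGroup.mk C, ?_, hS.mem_of_smul_eq (hX _) (w := FreeGroup.mk D) ?_ ?_ ?_⟩
  · refine FreeGroup.norm_mk_le.trans ?_
    rw [FreeGroup.norm, ← h1]
    simp
  · intro h
    apply hw
    rw [h3, h]
    group
  · have h5 : (FreeGroup.mk D)⁻¹ = (FreeGroup.mk C)⁻¹ * w⁻¹ * FreeGroup.mk C := by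
      rw [h3]
      group
    rw [h5, mul_smul, mul_smul, smul_inv_smul, hfix]
  · intro c hc hc'
    rw [FreeGroup.toWord_inv, h4] at hc'
    rw [h4] at hc
    have h5 := head?_invRev _ _ hc'
    rw [FreeGroup.invRev_invRev] at h5
    have h6 := h2.2 _ h5 c hc
    simp [Letter.inv] at h6

end Action

/-! ### The core of the coset graph of a finitely generated subgroup -/

/-- The points of the space of cosets given by the prefixes of the words of a list. -/
def prefixPoints (H : Subgroup F2) (L : List F2Word) : Set (F2 ⧸ H) :=
  {x | ∃ p ∈ [] :: L.flatMap List.inits, x = ((FreeGroup.mk p)⁻¹ : F2)}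

/-- A bound for the number of prefixes of the words of a list. -/
def prefixCount (L : List F2Word) : ℕ := ([] :: L.flatMap List.inits).length

theorem prefixPoints_finite (H : Subgroup F2) (L : List F2Word) : (prefixPoints H L).Finite := by
  refine ((List.finite_toSet ([] :: L.flatMap List.inits)).image
    fun p => (((FreeGroup.mk p)⁻¹ : F2) : F2 ⧸ H)).subset ?_
  rintro x ⟨p, hp, rfl⟩
  exact ⟨p, hp, rfl⟩

theorem prefixPoints_ncard (H : Subgroup F2) (L : List F2Word) :
    (prefixPoints H L).ncard ≤ prefixCount L := by
  classical
  have h : prefixPoints H L ⊆ ((([] :: L.flatMap List.inits).toFinset).image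
      fun p => (((FreeGroup.mk p)⁻¹ : F2) : F2 ⧸ H) : Finset (F2 ⧸ H)) := by
    rintro x ⟨p, hp, rfl⟩
    simp only [Finset.coe_image, Set.mem_image, Finset.mem_coe, List.mem_toFinset]
    exact ⟨p, hp, rfl⟩
  refine (Set.ncard_le_ncard h (Finset.finite_toSet _)).trans ?_
  rw [Set.ncard_coe_finset]
  exact Finset.card_image_le.trans (List.toFinset_card_le _)

theorem one_mem_prefixPoints (H : Subgroup F2) (L : List F2Word) :
    ((1 : F2) : F2 ⧸ H) ∈ prefixPoints H L := ⟨[], by simp, by simp [← FreeGroup.one_eq_mk]⟩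

theorem runsIn_prefixPoints (H : Subgroup F2) (L : List F2Word) {p : F2Word}
    (hp : p ∈ [] :: L.flatMap List.inits) :
    RunsIn (prefixPoints H L) ((1 : F2) : F2 ⧸ H) p := by
  intro q hq
  refine ⟨q, ?_, by rw [MulAction.Quotient.smul_coe, smul_eq_mul, mul_one]⟩
  rcases List.mem_cons.1 hp with rfl | hp
  · simp [List.prefix_nil.1 hq]
  · obtain ⟨l, hl, hp⟩ := List.mem_flatMap.1 hp
    exact List.mem_cons_of_mem _
      (List.mem_flatMap.2 ⟨l, hl, (List.mem_inits _ _).2 (hq.trans ((List.mem_inits _ _).1 hp))⟩)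

theorem inv_smul_one_coset (H : Subgroup F2) (g : F2) :
    g⁻¹ • ((1 : F2) : F2 ⧸ H) = ((1 : F2) : F2 ⧸ H) ↔ g ∈ H := by
  rw [MulAction.Quotient.smul_coe, smul_eq_mul, mul_one, QuotientGroup.eq]
  simp

/-- The unreduced product of generators traces the petals based at the trivial coset, and these
consist of prefix points. -/
theorem exists_runsIn_of_mem (L : List F2Word) {h : F2} (hh : h ∈ generatedSubgroup L) :
    ∃ w : F2Word, FreeGroup.mk w = h ∧
      RunsIn (prefixPoints (generatedSubgroup L) L) ((1 : F2) : F2 ⧸ generatedSubgroup L) w := by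
  induction hh using Subgroup.closure_induction with
  | mem x hx =>
    obtain ⟨w, hw, rfl⟩ := hx
    exact ⟨w, rfl, runsIn_prefixPoints _ L
      (List.mem_cons_of_mem _ (List.mem_flatMap.2 ⟨w, hw, (List.mem_inits _ _).2 List.prefix_rfl⟩))⟩
  | one => exact ⟨[], FreeGroup.one_eq_mk.symm, runsIn_prefixPoints _ L (by simp)⟩
  | mul x y hx hy ihx ihy =>
    obtain ⟨v, rfl, hv⟩ := ihx
    obtain ⟨w, rfl, hw⟩ := ihy
    refine ⟨v ++ w, mk_append v w, hv.append ?_⟩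
    rwa [(inv_smul_one_coset (generatedSubgroup L) _).2 hx]
  | inv x hx ihx =>
    obtain ⟨v, rfl, hv⟩ := ihx
    refine ⟨FreeGroup.invRev v, FreeGroup.inv_mk.symm, ?_⟩
    have h := hv.invRev
    rwa [(inv_smul_one_coset (generatedSubgroup L) _).2 hx] at h

/-- A path `w` between the points given by prefixes `p` and `p'` yields the element `p w p'⁻¹` of
the subgroup. A loop `v` for it stays among the prefix points, hence so does `p⁻¹ v p'`, which
reduces to `w`; reduction visits no new point. -/
theorem pathConvex_prefixPoints (L : List F2Word) :
    PathConvex (prefixPoints (generatedSubgroup L) L) := by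
  rintro x ⟨p, hp, rfl⟩ w hw ⟨p', hp', hpw⟩
  have h1 : FreeGroup.mk p * FreeGroup.mk w * (FreeGroup.mk p')⁻¹ ∈ generatedSubgroup L := by
    rw [MulAction.Quotient.smul_coe, smul_eq_mul, QuotientGroup.eq] at hpw
    simpa [mul_assoc] using hpw
  obtain ⟨v, hv, hvS⟩ := exists_runsIn_of_mem L h1
  have hone : ∀ g : F2, g • ((1 : F2) : F2 ⧸ generatedSubgroup L) = (g : F2 ⧸ _) := fun g => by
    rw [MulAction.Quotient.smul_coe, smul_eq_mul, mul_one]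
  have hr := runsIn_prefixPoints (generatedSubgroup L) L hp
  have h2 := hr.invRev
  rw [hone] at h2
  refine RunsIn.of_mk_eq (v := FreeGroup.invRev p ++ (v ++ p')) (h2.append ?_) hw ?_
  · rw [← FreeGroup.inv_mk, inv_inv, ← hone, smul_inv_smul]
    refine hvS.append ?_
    rw [hv, (inv_smul_one_coset _ _).2 h1]
    exact runsIn_prefixPoints _ L hp'
  · rw [mk_append, mk_append, hv, ← FreeGroup.inv_mk]
    group

theorem exists_smul_mem_prefixPoints (H : Subgroup F2) (L : List F2Word) (x : F2 ⧸ H) :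
    ∃ g : F2, g • x ∈ prefixPoints H L := by
  obtain ⟨g, rfl⟩ := QuotientGroup.mk_surjective x
  refine ⟨g⁻¹, ?_⟩
  rw [MulAction.Quotient.smul_coe, smul_eq_mul, inv_mul_cancel]
  exact one_mem_prefixPoints H L

/-! ### Separation by finite permutation representations -/

/-- Marshall Hall's argument: the generator acts as a partial injection of a finite set, which
extends to a permutation. -/
theorem exists_perm_extension {X : Type} [MulAction F2 X] (S : Set X) [Finite S] (j : Fin 2) :
    ∃ σ : Equiv.Perm S, ∀ x : S, (FreeGroup.of j)⁻¹ • x.1 ∈ S →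
      (σ x).1 = (FreeGroup.of j)⁻¹ • x.1 := by
  classical
  have := Fintype.ofFinite S
  let e : {x : S // (FreeGroup.of j)⁻¹ • x.1 ∈ S} ≃ {y : S // FreeGroup.of j • y.1 ∈ S} :=
    { toFun := fun x => ⟨⟨(FreeGroup.of j)⁻¹ • x.1.1, x.2⟩, by
        rw [smul_inv_smul]
        exact x.1.2⟩
      invFun := fun y => ⟨⟨FreeGroup.of j • y.1.1, y.2⟩, by
        rw [inv_smul_smul]
        exact y.1.2⟩
      left_inv := fun x => Subtype.ext (Subtype.ext (smul_inv_smul _ _))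
      right_inv := fun y => Subtype.ext (Subtype.ext (inv_smul_smul _ _)) }
  refine ⟨e.extendSubtype, fun x hx => ?_⟩
  rw [Equiv.extendSubtype_apply_of_mem e x hx]
  rfl

theorem exists_perm_hom {X : Type} [MulAction F2 X] (S : Set X) [Finite S] :
    ∃ f : F2 →* Equiv.Perm S, ∀ (w : F2Word) (x : S), RunsIn S x.1 w →
      ((f (FreeGroup.mk w))⁻¹ x).1 = (FreeGroup.mk w)⁻¹ • x.1 := by
  choose σ hσ using exists_perm_extension S
  let f : F2 →* Equiv.Perm S := FreeGroup.lift fun j => (σ j)⁻¹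
  have hletter : ∀ (c : Letter) (x : S), (FreeGroup.mk [c])⁻¹ • x.1 ∈ S →
      ((f (FreeGroup.mk [c]))⁻¹ x).1 = (FreeGroup.mk [c])⁻¹ • x.1 := by
    rintro ⟨j, s⟩ x hx
    cases s
    · have h : (FreeGroup.mk [(j, false)] : F2) = (FreeGroup.of j)⁻¹ := rfl
      rw [h, inv_inv] at hx ⊢
      have h1 : σ j ⟨FreeGroup.of j • x.1, hx⟩ = x := Subtype.ext (by
        rw [hσ j ⟨_, hx⟩ (by rw [inv_smul_smul]; exact x.2), inv_smul_smul])
      have h2 : (f (FreeGroup.of j)⁻¹)⁻¹ = (σ j)⁻¹ := by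
        rw [map_inv, inv_inv]
        exact FreeGroup.lift_apply_of ..
      rw [h2]
      conv_lhs => rw [← h1]
      exact congrArg Subtype.val ((σ j).symm_apply_apply _)
    · have h2 : (f (FreeGroup.mk [(j, true)]))⁻¹ = σ j := by
        rw [inv_eq_iff_eq_inv]
        exact FreeGroup.lift_apply_of ..
      rw [h2]
      exact hσ j x hx
  refine ⟨f, fun w => ?_⟩
  induction w with
  | nil =>
    intro x _
    rw [← FreeGroup.one_eq_mk, map_one, inv_one, inv_one, one_smul]
    rfl
  | cons c w ih =>
    intro x hx
    have h1 : (FreeGroup.mk [c])⁻¹ • x.1 ∈ S := hx [c] (by simp)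
    rw [mk_cons_inv_smul, mk_cons_eq, map_mul, mul_inv_rev, Equiv.Perm.mul_apply]
    rw [← hletter c x h1]
    refine ih _ ?_
    intro p hp
    rw [hletter c x h1, ← mk_cons_inv_smul]
    exact hx _ ((List.prefix_cons_inj c).2 hp)

/-- Finitely generated subgroups of `F2` are separable. -/
theorem exists_separating_perm (L : List F2Word) (u : F2Word)
    (hu : FreeGroup.mk u ∉ generatedSubgroup L) :
    ∃ (S : Type) (_ : Finite S) (x : S) (f : F2 →* Equiv.Perm S),
      Nat.card S ≤ prefixCount (u :: L) ∧ (∀ h ∈ generatedSubgroup L, f h x = x) ∧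
      f (FreeGroup.mk u) x ≠ x := by
  set H := generatedSubgroup L
  -- The prefixes of `u` are included so that the path of `u` stays in the finite set and the
  -- permutations follow it faithfully.
  have : Finite (prefixPoints H (u :: L)) := prefixPoints_finite H _
  obtain ⟨f, hf⟩ := exists_perm_hom (prefixPoints H (u :: L))
  have hruns : ∀ w ∈ u :: L, RunsIn (prefixPoints H (u :: L)) ((1 : F2) : F2 ⧸ H) w :=
    fun w hw => runsIn_prefixPoints _ _ (List.mem_cons_of_mem _
      (List.mem_flatMap.2 ⟨w, hw, (List.mem_inits _ _).2 List.prefix_rfl⟩))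
  set x : prefixPoints H (u :: L) := ⟨((1 : F2) : F2 ⧸ H), one_mem_prefixPoints _ _⟩ with hx
  have hfix : ∀ w ∈ u :: L, f (FreeGroup.mk w) x = x ↔ FreeGroup.mk w ∈ H := by
    intro w hw
    rw [← inv_smul_one_coset H, ← hf w x (hruns w hw), eq_comm, ← Equiv.Perm.inv_eq_iff_eq,
      Subtype.ext_iff]
  refine ⟨prefixPoints H (u :: L), inferInstance, x, f, ?_, ?_, ?_⟩
  · exact prefixPoints_ncard H (u :: L)
  · have h1 : H ≤ (MulAction.stabilizer (Equiv.Perm (prefixPoints H (u :: L))) x).comap f := by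
      refine (Subgroup.closure_le _).2 ?_
      rintro g ⟨w, hw, rfl⟩
      exact (hfix w (List.mem_cons_of_mem _ hw)).2
        (Subgroup.subset_closure ⟨w, hw, rfl⟩)
    exact fun h hh => h1 hh
  · rw [Ne, hfix u (by simp)]
    exact hu

/-- Otherwise `g⁻¹ * y * g ∉ K` for some `y ∈ K`. A finite permutation representation separates it
from `K`; but there the image of `g K g⁻¹` has the same cardinality as that of `K`, so the inclusion
of images is an equality. -/
theorem map_conj_eq_of_le (L : List F2Word) (g : F2)
    (h : (generatedSubgroup L).map (MulAut.conj g).toMonoidHom ≤ generatedSubgroup L) :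
    (generatedSubgroup L).map (MulAut.conj g).toMonoidHom = generatedSubgroup L := by
  set K := generatedSubgroup L
  refine le_antisymm h fun y hy => ?_
  have hy' : FreeGroup.mk (g⁻¹ * y * g).toWord ∈ K := by
    by_contra hcon
    obtain ⟨S, _, x, f, -, hK, hne⟩ := exists_separating_perm L _ hcon
    rw [FreeGroup.mk_toWord] at hne
    have h1 : ((K.map (MulAut.conj g).toMonoidHom).map f : Set (Equiv.Perm S)) = K.map f := by
      refine Set.eq_of_subset_of_ncard_le (Subgroup.map_mono h) ?_ (Set.toFinite _)
      have h2 : (K.map (MulAut.conj g).toMonoidHom).map f =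
          (K.map f).map (MulAut.conj (f g)).toMonoidHom := by
        rw [Subgroup.map_map, Subgroup.map_map]
        congr 1
        ext z
        simp
      rw [h2, Subgroup.coe_map]
      exact (Set.ncard_image_of_injective _ (MulAut.conj (f g)).injective).ge
    have h3 : f y ∈ ((K.map (MulAut.conj g).toMonoidHom).map f : Set (Equiv.Perm S)) := by
      rw [h1]
      exact ⟨y, hy, rfl⟩
    obtain ⟨_, ⟨k, hk, rfl⟩, hz⟩ := h3
    apply hne
    have h4 : f (g⁻¹ * y * g) = f k := by
      rw [map_mul, map_mul, ← hz]
      simp [mul_assoc]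
    rw [h4]
    exact hK k hk
  rw [FreeGroup.mk_toWord] at hy'
  exact ⟨_, hy', by simp [mul_assoc]⟩

/-! ### A decision procedure for membership -/

/-- The lists of length `n` with entries less than `m`. -/
def listsOf (n m : ℕ) : List (List ℕ) :=
  n.rec [[]] fun _ T => T.flatMap fun t => (List.range m).map fun x => x :: t

theorem mem_listsOf {n m : ℕ} {t : List ℕ} :
    t ∈ listsOf n m ↔ t.length = n ∧ ∀ x ∈ t, x < m := by
  induction n generalizing t with
  | zero =>
    have h : listsOf 0 m = [[]] := rfl
    rw [h, List.mem_singleton, List.length_eq_zero_iff]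
    constructor
    · rintro rfl
      simp
    · exact And.left
  | succ n ih =>
    have h : listsOf (n + 1) m =
      (listsOf n m).flatMap fun t => (List.range m).map fun x => x :: t := rfl
    rw [h]
    simp only [List.mem_flatMap, List.mem_map, List.mem_range]
    constructor
    · rintro ⟨s, hs, x, hx, rfl⟩
      obtain ⟨h1, h2⟩ := ih.1 hs
      refine ⟨by simp [h1], fun y hy => ?_⟩
      rcases List.mem_cons.1 hy with rfl | hy
      · exact hx
      · exact h2 y hy
    · rintro ⟨h1, h2⟩
      obtain ⟨x, s, rfl⟩ := List.exists_cons_of_length_eq_add_one h1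
      exact ⟨s, ih.2 ⟨by simpa using h1, fun y hy => h2 y (by simp [hy])⟩, x, h2 x (by simp), rfl⟩

/-- The number of a letter. -/
def letterCode (c : Letter) : ℕ := 2 * c.1.val + c.2.toNat

/-- The image of `x` under the letter `c`, in the table `t` of an action on `k` points. -/
def tableStep (k : ℕ) (t : List ℕ) (x : ℕ) (c : Letter) : ℕ := t.getD (x + k * letterCode c) 0

/-- The image of `x` under a word, in the table `t` of an action on `k` points. -/
def tableRun (k : ℕ) (t : List ℕ) (w : F2Word) (x : ℕ) : ℕ := w.foldl (tableStep k t) x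

/-- The four letters. -/
def letters : List Letter := [(0, true), (0, false), (1, true), (1, false)]

theorem mem_letters : ∀ c : Letter, c ∈ letters := by decide

/-- The table `t` describes an action on `k` points. -/
def TableValid (k : ℕ) (t : List ℕ) : Prop :=
  ∀ x ∈ List.range k, ∀ c ∈ letters,
    tableStep k t x c < k ∧ tableStep k t (tableStep k t x c) (Letter.inv c) = x

/-- Every action on at most `n` points such that the words of `L` fix the first point is such
that `u` fixes the first point. -/
def MemTest (n : ℕ) (L : List F2Word) (u : F2Word) : Prop :=
  ∀ k ∈ List.range n, ∀ t ∈ listsOf (4 * (k + 1)) (k + 1), TableValid (k + 1) t →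
    (∀ l ∈ L, tableRun (k + 1) t l 0 = 0) → tableRun (k + 1) t u 0 = 0

theorem TableValid.exists_hom {k : ℕ} {t : List ℕ} (h : TableValid k t) :
    ∃ f : F2 →* Equiv.Perm (Fin k), ∀ (w : F2Word) (x : Fin k),
      (((f (FreeGroup.mk w))⁻¹ x : Fin k) : ℕ) = tableRun k t w x := by
  have h' : ∀ (x : Fin k) (c : Letter), tableStep k t x c < k ∧
      tableStep k t (tableStep k t x c) (Letter.inv c) = x := fun x c =>
    h x (List.mem_range.2 x.2) c (mem_letters c)
  let σ : Fin 2 → Equiv.Perm (Fin k) := fun j =>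
    { toFun := fun x => ⟨tableStep k t x (j, true), (h' x _).1⟩
      invFun := fun x => ⟨tableStep k t x (j, false), (h' x _).1⟩
      left_inv := fun x => Fin.ext (h' x (j, true)).2
      right_inv := fun x => Fin.ext (h' x (j, false)).2 }
  let f : F2 →* Equiv.Perm (Fin k) := FreeGroup.lift fun j => (σ j)⁻¹
  have hletter : ∀ (c : Letter) (x : Fin k),
      (((f (FreeGroup.mk [c]))⁻¹ x : Fin k) : ℕ) = tableStep k t x c := by
    rintro ⟨j, s⟩ x
    cases s
    · have h2 : (f (FreeGroup.mk [(j, false)]))⁻¹ = (σ j)⁻¹ := by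
        have h : (FreeGroup.mk [(j, false)] : F2) = (FreeGroup.of j)⁻¹ := rfl
        rw [h, map_inv, inv_inv]
        exact FreeGroup.lift_apply_of ..
      rw [h2]
      rfl
    · have h2 : (f (FreeGroup.mk [(j, true)]))⁻¹ = σ j := by
        rw [inv_eq_iff_eq_inv]
        exact FreeGroup.lift_apply_of ..
      rw [h2]
      rfl
  refine ⟨f, fun w => ?_⟩
  induction w with
  | nil =>
    intro x
    rw [← FreeGroup.one_eq_mk, map_one, inv_one]
    rfl
  | cons c w ih =>
    intro x
    rw [mk_cons_eq, map_mul, mul_inv_rev, Equiv.Perm.mul_apply, ih, hletter]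
    rfl

theorem exists_table {k : ℕ} (f : F2 →* Equiv.Perm (Fin k)) :
    ∃ t ∈ listsOf (4 * k) k, TableValid k t ∧ ∀ (w : F2Word) (x : Fin k),
      tableRun k t w x = ((f (FreeGroup.mk w))⁻¹ x : Fin k) := by
  rcases Nat.eq_zero_or_pos k with rfl | hk
  · exact ⟨[], by simp [listsOf], by simp [TableValid], fun w x => x.elim0⟩
  let dec : ℕ → Letter := fun n => (if n < 2 then 0 else 1, n % 2 = 1)
  have hdec : ∀ c : Letter, dec (letterCode c) = c := by decide
  have hcode : ∀ c : Letter, letterCode c < 4 := by decide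
  let t : List ℕ := (List.range (4 * k)).map fun n =>
    ((f (FreeGroup.mk [dec (n / k)]))⁻¹ ⟨n % k, Nat.mod_lt _ hk⟩ : Fin k)
  have hstep : ∀ (x : Fin k) (c : Letter),
      tableStep k t x c = ((f (FreeGroup.mk [c]))⁻¹ x : Fin k) := by
    intro x c
    have hlt : x + k * letterCode c < 4 * k := by
      have h1 : k * letterCode c ≤ k * 3 := Nat.mul_le_mul_left _ (by have := hcode c; omega)
      omega
    have hdiv : (x + k * letterCode c) / k = letterCode c := by
      rw [Nat.add_mul_div_left _ _ hk, Nat.div_eq_of_lt x.2, zero_add]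
    have hmod : (⟨(x + k * letterCode c) % k, Nat.mod_lt _ hk⟩ : Fin k) = x :=
      Fin.ext ((Nat.add_mul_mod_self_left ..).trans (Nat.mod_eq_of_lt x.2))
    rw [tableStep, List.getD_eq_getElem?_getD, List.getElem?_map, List.getElem?_range hlt]
    simp only [Option.map_some, Option.getD_some]
    rw [hmod, hdiv, hdec]
  refine ⟨t, mem_listsOf.2 ⟨by simp [t], ?_⟩, ?_, ?_⟩
  · intro y hy
    obtain ⟨n, -, rfl⟩ := List.mem_map.1 hy
    exact Fin.is_lt _
  · intro x hx c _
    have h1 := hstep ⟨x, List.mem_range.1 hx⟩ c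
    simp only at h1
    rw [h1]
    refine ⟨Fin.is_lt _, ?_⟩
    have h2 := hstep ((f (FreeGroup.mk [c]))⁻¹ ⟨x, List.mem_range.1 hx⟩) (Letter.inv c)
    rw [h2]
    have h3 : (FreeGroup.mk [Letter.inv c] : F2) = (FreeGroup.mk [c])⁻¹ := by
      rw [FreeGroup.inv_mk]
      rfl
    rw [h3, map_inv, inv_inv]
    exact congrArg Fin.val ((f (FreeGroup.mk [c])).apply_symm_apply _)
  · intro w
    induction w with
    | nil =>
      intro x
      rw [← FreeGroup.one_eq_mk, map_one, inv_one]
      rfl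
    | cons c w ih =>
      intro x
      rw [mk_cons_eq, map_mul, mul_inv_rev, Equiv.Perm.mul_apply, ← ih, ← hstep]
      rfl

/-- If `u` lies outside the subgroup, the separating action has at most `prefixCount (u :: L)`
points and occurs among the tables tested. -/
theorem memTest_iff {n : ℕ} {L : List F2Word} {u : F2Word} (hn : prefixCount (u :: L) ≤ n) :
    MemTest n L u ↔ FreeGroup.mk u ∈ generatedSubgroup L := by
  constructor
  · intro h
    by_contra hu
    obtain ⟨S, _, x, f, hS, hL, hne⟩ := exists_separating_perm L u hu
    have hpos : 0 < Nat.card S := Nat.card_pos_iff.2 ⟨⟨x⟩, inferInstance⟩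
    obtain ⟨k, hk⟩ := Nat.exists_eq_succ_of_ne_zero hpos.ne'
    obtain ⟨e⟩ : Nonempty (S ≃ Fin (k + 1)) := ⟨Finite.equivFinOfCardEq hk⟩
    -- The points are renumbered so that the distinguished one is 0, the only one tested.
    let e' : S ≃ Fin (k + 1) := e.trans (Equiv.swap (e x) 0)
    have he' : e' x = 0 := by simp [e']
    let f' : F2 →* Equiv.Perm (Fin (k + 1)) := e'.permCongrHom.toMonoidHom.comp f
    have hf' : ∀ g : F2, (f' g)⁻¹ 0 = 0 ↔ f g x = x := by
      intro g
      rw [Equiv.Perm.inv_eq_iff_eq, eq_comm]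
      have h1 : f' g 0 = e' (f g (e'.symm 0)) := rfl
      rw [h1, ← he', e'.symm_apply_apply, e'.injective.eq_iff]
    obtain ⟨t, ht, hv, hrun⟩ := exists_table f'
    have hrun0 : ∀ w : F2Word, tableRun (k + 1) t w 0 = 0 ↔ f (FreeGroup.mk w) x = x := by
      intro w
      have h1 := hrun w 0
      rw [Fin.val_zero] at h1
      rw [h1, ← hf', Fin.ext_iff, Fin.val_zero]
    refine hne ((hrun0 u).1 (h k (List.mem_range.2 ?_) t ht hv ?_))
    · omega
    · intro l hl
      exact (hrun0 l).2 (hL _ (Subgroup.subset_closure ⟨l, hl, rfl⟩))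
  · intro hu k _ t _ hv hL
    obtain ⟨f, hf⟩ := hv.exists_hom
    have h1 : generatedSubgroup L ≤
        (MulAction.stabilizer (Equiv.Perm (Fin (k + 1))) (0 : Fin (k + 1))).comap f := by
      rw [generatedSubgroup, Subgroup.closure_le]
      rintro g ⟨w, hw, rfl⟩
      have h2 := hf w 0
      rw [Fin.val_zero, hL w hw] at h2
      have h3 : (f (FreeGroup.mk w))⁻¹ 0 = 0 := Fin.ext h2
      exact ((Equiv.Perm.inv_eq_iff_eq).1 h3).symm
    have h4 : f (FreeGroup.mk u) 0 = 0 := h1 hu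
    have h5 := hf u 0
    rw [Fin.val_zero] at h5
    rw [← h5, Equiv.Perm.inv_eq_iff_eq.2 h4.symm, Fin.val_zero]

/-! ### Languages of bounded index -/

/-- The language described by `P` is a union of classes of a right congruence with at most `N`
classes. -/
def IndexLE {β : Type} (P : List β → Prop) (N : ℕ) : Prop :=
  ∃ (α : Type) (f : List β → α) (s : Finset α), (∀ x y z, f x = f y → f (x ++ z) = f (y ++ z)) ∧
    (∀ w, f w ∈ s) ∧ s.card ≤ N ∧ ∀ x y, f x = f y → (P x ↔ P y)

theorem IndexLE.of_residuals {β : Type} {P : List β → Prop} {N : ℕ} (T : Finset (Set (List β)))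
    (hT : ∀ v, {z | P (v ++ z)} ∈ T) (hN : T.card ≤ N) : IndexLE P N := by
  refine ⟨Set (List β), fun v => {z | P (v ++ z)}, T, ?_, hT, hN, ?_⟩
  · intro x y z h
    ext t
    have h1 := Set.ext_iff.1 h (z ++ t)
    simpa using h1
  · intro x y h
    have h1 := Set.ext_iff.1 h []
    simpa using h1

theorem IndexLE.congr {β : Type} {P Q : List β → Prop} {N : ℕ} (h : IndexLE P N)
    (hPQ : ∀ w, P w ↔ Q w) : IndexLE Q N := by
  have h1 : P = Q := funext fun w => propext (hPQ w)
  exact h1 ▸ h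

theorem IndexLE.and {β : Type} {P Q : List β → Prop} {M N : ℕ} (hP : IndexLE P M)
    (hQ : IndexLE Q N) : IndexLE (fun w => P w ∧ Q w) (M * N) := by
  obtain ⟨α, f, s, hf1, hf2, hf3, hf4⟩ := hP
  obtain ⟨γ, g, t, hg1, hg2, hg3, hg4⟩ := hQ
  refine ⟨α × γ, fun w => (f w, g w), s ×ˢ t, ?_, fun w => Finset.mem_product.2 ⟨hf2 w, hg2 w⟩,
    ?_, ?_⟩
  · intro x y z h
    simp only [Prod.mk.injEq] at h ⊢
    exact ⟨hf1 x y z h.1, hg1 x y z h.2⟩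
  · rw [Finset.card_product]
    exact Nat.mul_le_mul hf3 hg3
  · intro x y h
    simp only [Prod.mk.injEq] at h
    exact and_congr (hf4 x y h.1) (hg4 x y h.2)

theorem IndexLE.true {β : Type} : IndexLE (fun _ : List β => True) 1 :=
  ⟨Unit, fun _ => (), {()}, by simp, by simp, by simp, by simp⟩

theorem IndexLE.forall_mem {β ι : Type} {P : ι → List β → Prop} {N : ℕ} (l : List ι)
    (h : ∀ i ∈ l, IndexLE (P i) N) : IndexLE (fun w => ∀ i ∈ l, P i w) (N ^ l.length) := by
  induction l with
  | nil => simpa using IndexLE.true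
  | cons i l ih =>
    have h1 := (h i (by simp)).and (ih fun j hj => h j (by simp [hj]))
    rw [List.length_cons, pow_succ, mul_comm]
    exact h1.congr fun w => by simp

theorem IndexLE.comap {β γ : Type} {P : List β → Prop} {N : ℕ} (h : IndexLE P N) (τ : γ → β) :
    IndexLE (fun w => P (w.map τ)) N := by
  obtain ⟨α, f, s, hf1, hf2, hf3, hf4⟩ := h
  refine ⟨α, fun w => f (w.map τ), s, ?_, fun w => hf2 _, hf3, fun x y h => hf4 _ _ h⟩
  intro x y z h
  simp only [List.map_append]
  exact hf1 _ _ _ h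

/-- After reading `w`, remember the set of classes of those `v` with `P (v ++ w.reverse)`: a subset
construction, hence the power of 2. -/
theorem IndexLE.reverse {β : Type} {P : List β → Prop} {N : ℕ} (h : IndexLE P N) :
    IndexLE (fun w => P w.reverse) (2 ^ N) := by
  classical
  obtain ⟨α, f, s, hf1, hf2, hf3, hf4⟩ := h
  refine ⟨Finset α, fun w => s.filter fun a => ∃ v, f v = a ∧ P (v ++ w.reverse), s.powerset, ?_,
    fun w => Finset.mem_powerset.2 (Finset.filter_subset _ _), ?_, ?_⟩
  · have key : ∀ x y z : List β,
        (s.filter fun a => ∃ v, f v = a ∧ P (v ++ x.reverse)) =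
          (s.filter fun a => ∃ v, f v = a ∧ P (v ++ y.reverse)) →
        ∀ a, (∃ v, f v = a ∧ P (v ++ (x ++ z).reverse)) →
          ∃ v, f v = a ∧ P (v ++ (y ++ z).reverse) := by
      rintro x y z h a ⟨v, rfl, hv⟩
      rw [List.reverse_append, ← List.append_assoc] at hv
      have h1 : f (v ++ z.reverse) ∈ s.filter fun a => ∃ v, f v = a ∧ P (v ++ x.reverse) :=
        Finset.mem_filter.2 ⟨hf2 _, _, rfl, hv⟩
      rw [h] at h1
      obtain ⟨-, u, hu, hPu⟩ := Finset.mem_filter.1 h1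
      refine ⟨v, rfl, ?_⟩
      rw [List.reverse_append, ← List.append_assoc]
      exact (hf4 _ _ (hf1 _ _ _ hu)).1 hPu
    intro x y z h
    exact Finset.filter_congr fun a _ => ⟨key x y z h a, key y x z h.symm a⟩
  · rw [Finset.card_powerset]
    exact Nat.pow_le_pow_right (by norm_num) hf3
  · have key : ∀ x y : List β,
        (s.filter fun a => ∃ v, f v = a ∧ P (v ++ x.reverse)) =
          (s.filter fun a => ∃ v, f v = a ∧ P (v ++ y.reverse)) → P x.reverse → P y.reverse := by
      intro x y h hx
      have h1 : f [] ∈ s.filter fun a => ∃ v, f v = a ∧ P (v ++ x.reverse) :=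
        Finset.mem_filter.2 ⟨hf2 _, [], rfl, hx⟩
      rw [h] at h1
      obtain ⟨-, u, hu, hPu⟩ := Finset.mem_filter.1 h1
      exact (hf4 (u ++ y.reverse) ([] ++ y.reverse) (hf1 _ _ _ hu)).1 hPu
    exact fun x y h => ⟨key x y h, key y x h.symm⟩

/-! ### The action of words over `Σ` -/

/-- The automorphism obtained by applying the letters of a word one after the other. -/
def act (w : List (Fin 3)) : MulAut F2 := (w.reverse.map F2.sigma).prod

theorem act_nil : act [] = 1 := rfl

theorem act_append (v w : List (Fin 3)) : act (v ++ w) = act w * act v := by simp [act]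

theorem act_concat (v : List (Fin 3)) (i : Fin 3) (g : F2) :
    act (v ++ [i]) g = F2.sigma i (act v g) := by
  rw [act_append]
  simp [act]

theorem act_append_apply (v w : List (Fin 3)) (g : F2) : act (v ++ w) g = act w (act v g) := by
  rw [act_append, MulAut.mul_apply]

theorem weight_act_le (w : List (Fin 3)) (g : F2) : weight (act w g) ≤ weight g := by
  induction w using List.reverseRecOn with
  | nil => simp [act_nil]
  | append_singleton w i ih =>
    rw [act_concat]
    exact (weight_sigma_le i _).trans ih

theorem weight_le_norm (g : F2) : weight g ≤ g.norm + 1 := scanWeight_le_length _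

theorem costFrom_act_le (w : List (Fin 3)) (g : F2) :
    costFrom none (act w g).toWord ≤ g.norm + 1 ∧
      costFrom none (FreeGroup.invRev (act w g).toWord) ≤ g.norm + 1 := by
  have h1 : ∀ g : F2, costFrom none (act w g).toWord ≤ g.norm + 1 := fun g =>
    (Nat.le_add_right _ _).trans ((weight_act_le w g).trans (weight_le_norm g))
  refine ⟨h1 g, ?_⟩
  have h2 := h1 g⁻¹
  rwa [map_inv, FreeGroup.toWord_inv, FreeGroup.norm_inv_eq] at h2

theorem exchange_act {V : Type} {g h : F2} (H : Relation.ReflTransGen (Exchange V) g h)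
    (w : List (Fin 3)) : Relation.ReflTransGen (Exchange V) (act w g) (act w h) := by
  induction w using List.reverseRecOn with
  | nil => simpa [act_nil] using H
  | append_singleton w i ih =>
    rw [act_concat, act_concat]
    clear H
    generalize act w h = k at ih ⊢
    induction ih with
    | refl => exact Relation.ReflTransGen.refl
    | tail _ h ih => exact ih.tail (h.sigma i)

theorem smul_eq_iff_of_exchange {X : Type} [MulAction F2 X] {S : Set X} (hS : PathConvex S)
    {g h : F2} (H : Relation.ReflTransGen (Exchange S) g h) {x : X} (hx : x ∈ S) :
    g⁻¹ • x = x ↔ h⁻¹ • x = x := by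
  induction H with
  | refl => rfl
  | tail _ h ih => exact ih.trans (h.smul_eq_iff hS ⟨x, hx⟩)

/-- The element given by a word of length at most `B`. -/
def decodeWord {B : ℕ} (c : Fin B → Option Letter) : F2 :=
  FreeGroup.mk ((List.ofFn c).filterMap id)

theorem exists_decodeWord {B : ℕ} (g : F2) (hg : g.norm ≤ B) :
    ∃ c : Fin B → Option Letter, decodeWord c = g := by
  refine ⟨fun i => g.toWord[i.1]?, ?_⟩
  rw [decodeWord]
  conv_rhs => rw [← FreeGroup.mk_toWord (x := g)]
  congr 1
  generalize hw : g.toWord = w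
  rw [FreeGroup.norm, hw] at hg
  clear hw
  induction B generalizing w with
  | zero => simp [List.length_eq_zero_iff.1 (Nat.le_zero.1 hg)]
  | succ B ih =>
    cases w with
    | nil => simp [List.ofFn_const]
    | cons c w =>
      rw [List.ofFn_succ]
      have h1 := ih w (by simpa using hg)
      simpa using h1

/-- The residual of `v` is determined by `b` and the bounded tuple. Each entry is coded by `B`
symbols, a letter or a blank, hence the 5. -/
theorem IndexLE.of_tuples {P : List (Fin 3) → Prop} {m B : ℕ} (Q : Bool → (Fin m → F2) → Prop)
    (h : ∀ v, ∃ b, ∃ h : Fin m → F2, (∀ i, (h i).norm ≤ B) ∧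
      ∀ z, P (v ++ z) ↔ Q b fun i => act z (h i)) : IndexLE P (2 * (5 ^ B) ^ m) := by
  classical
  refine IndexLE.of_residuals ((Finset.univ : Finset (Bool × (Fin m → Fin B → Option Letter))).image
    fun p => {z | Q p.1 fun i => act z (decodeWord (p.2 i))}) ?_ ?_
  · intro v
    obtain ⟨b, g, hg, H⟩ := h v
    choose c hc using fun i => exists_decodeWord (g i) (hg i)
    refine Finset.mem_image.2 ⟨(b, c), Finset.mem_univ _, ?_⟩
    ext z
    simp only [Set.mem_ofPred_eq, hc, H]
  · refine Finset.card_image_le.trans ?_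
    simp

/-- A bound for the index of the languages which describe the images of a tuple of elements
contained in a subgroup. -/
def tupleBound (k n m : ℕ) : ℕ := 2 * (5 ^ repBound (36 * (4 * n + 1) + 1) (relCount k)) ^ m

theorem relCount_mono {j k : ℕ} (h : j ≤ k) : relCount j ≤ relCount k := by
  have h1 : (2 ^ j) ^ j ≤ (2 ^ k) ^ k :=
    (Nat.pow_le_pow_left (Nat.pow_le_pow_right (by norm_num) h) j).trans
      (Nat.pow_le_pow_right (by positivity) h)
  exact (Nat.pow_le_pow_left h1 _).trans
    (Nat.pow_le_pow_right (by positivity) (Nat.pow_le_pow_left h1 2))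

theorem repBound_mono (M : ℕ) {c d : ℕ} (h : c ≤ d) : repBound M c ≤ repBound M d :=
  Nat.mul_le_mul_left _ (Nat.mul_le_mul_left _ (by omega))

/-- The cost of `act v g` and of its inverse is bounded in terms of `g` alone, so exchanges shorten
it to a length independent of `v`; they commute with the further word `z`. -/
theorem exists_bounded_rep (L : List F2Word) (M : ℕ) (g : F2) (hg : g.norm + 1 ≤ M)
    (v : List (Fin 3)) :
    ∃ h : F2, h.norm ≤ repBound M (relCount (prefixCount L)) ∧
      ∀ (z : List (Fin 3)), ∀ x ∈ prefixPoints (generatedSubgroup L) L,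
        (act (v ++ z) g)⁻¹ • x = x ↔ (act z h)⁻¹ • x = x := by
  have : Finite (prefixPoints (generatedSubgroup L) L) := prefixPoints_finite _ _
  have := Fintype.ofFinite (prefixPoints (generatedSubgroup L) L)
  obtain ⟨h1, h2⟩ := costFrom_act_le v g
  obtain ⟨h, h3, h4⟩ := exists_bounded_exchange (V := prefixPoints (generatedSubgroup L) L) M _
    (h1.trans hg) (h2.trans hg)
  refine ⟨h, h4.trans (repBound_mono M (relCount_mono ?_)), fun z x hx => ?_⟩
  · rw [← Nat.card_eq_fintype_card]
    exact prefixPoints_ncard _ L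
  · rw [act_append_apply]
    exact smul_eq_iff_of_exchange (pathConvex_prefixPoints L) (exchange_act h3 z) hx

/-- The bound is larger than this case requires; it is shared with `indexLE_conj`. -/
theorem indexLE_mem (L : List F2Word) {m : ℕ} (n : ℕ) (g : Fin m → F2)
    (hg : ∀ i, (g i).norm ≤ n) :
    IndexLE (fun w => ∀ i, act w (g i) ∈ generatedSubgroup L) (tupleBound (prefixCount L) n m) := by
  refine IndexLE.of_tuples (fun _ g => ∀ i, g i ∈ generatedSubgroup L) fun v => ?_
  choose h h1 h2 using fun i => exists_bounded_rep L (36 * (4 * n + 1) + 1) (g i)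
    (by have := hg i; omega) v
  refine ⟨true, h, h1, fun z => forall_congr' fun i => ?_⟩
  rw [← inv_smul_one_coset, h2 i z _ (one_mem_prefixPoints _ L), inv_smul_one_coset]

/-! ### Stable elements -/

/-- A cyclically reduced element whose images under all the words over `Σ` are cyclically
reduced. -/
def Stable (w : F2) : Prop :=
  ∃ s, finalScan w = some (Sum.inl s) ∧ finalScan w⁻¹ = some (Sum.inl (!s))

theorem Stable.act {w : F2} (h : Stable w) (v : List (Fin 3)) : Stable (act v w) := by
  induction v using List.reverseRecOn with
  | nil => simpa [act_nil] using h
  | append_singleton v i ih =>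
    obtain ⟨s, h1, h2⟩ := ih
    rw [act_concat]
    refine ⟨signAct i s, finalScan_sigma h1, ?_⟩
    rw [← map_inv, finalScan_sigma h2]
    simp only [signAct]
    split_ifs <;> rfl

theorem Stable.ne_one {w : F2} (h : Stable w) : w ≠ 1 := by
  rintro rfl
  obtain ⟨s, h1, -⟩ := h
  rw [finalScan_one] at h1
  exact absurd h1 (by simp)

theorem Stable.head? {w : F2} (h : Stable w) :
    ∀ c, c ∈ w.toWord.head? → c ∉ w⁻¹.toWord.head? := by
  obtain ⟨s, h1, h2⟩ := h
  intro c hc hc'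
  have h3 : c.2 = s := Guard.head? (Or.inr (by rwa [← FreeGroup.toWord_inv])) c hc
  have h4 : c.2 = !s := Guard.head? (Or.inr (by
    rw [← FreeGroup.toWord_inv, inv_inv, Bool.not_not]
    exact h1)) c hc'
  rw [h3] at h4
  exact absurd h4 (by simp)

theorem isCyclicallyReduced_of_head? {w : F2}
    (h : ∀ c, c ∈ w.toWord.head? → c ∉ w⁻¹.toWord.head?) :
    FreeGroup.IsCyclicallyReduced w.toWord := by
  refine ⟨FreeGroup.isReduced_toWord, fun x hx y hy hxy => ?_⟩
  by_contra hne
  refine h y hy ?_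
  rw [FreeGroup.toWord_inv]
  have h1 : y = Letter.inv x := Prod.ext hxy.symm (by
    simpa [Letter.inv, Bool.eq_not] using Ne.symm hne)
  rw [h1]
  rcases List.eq_nil_or_concat w.toWord with h2 | ⟨u, d, h2⟩
  · rw [h2] at hx
    simp at hx
  · rw [h2] at hx ⊢
    simp only [List.concat_eq_append, List.getLast?_concat, Option.mem_def,
      Option.some.injEq] at hx
    subst hx
    simp [FreeGroup.invRev, Letter.inv]

/-! ### Elements not conjugate to a stable element -/

/-- The scan from the start of a word and the scan from a later state. -/
def ScanSim (p q : Scan) : Prop :=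
  p = none ∨ p = q ∨ ∃ c : Letter, p = some (Sum.inl c.2) ∧ q = some (Sum.inr c)

instance (p q : Scan) : Decidable (ScanSim p q) := by unfold ScanSim; infer_instance

theorem scanSim_step : ∀ (p q : Scan) (c : Letter), ScanSim p q →
    ScanSim (scanStep p c) (scanStep q c) := by decide

/-- Forgetting what precedes a word can only make its letters freer, as its first block becomes an
initial one; `ScanSim` is the invariant expressing this. -/
theorem Guard.suffix {s : Bool} {q : Scan} {w : F2Word} (h : Guard s (scanFrom q w)) :
    Guard s (scanFrom none w) := by
  have h1 : ∀ (p q : Scan), ScanSim p q → ScanSim (scanFrom p w) (scanFrom q w) := by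
    clear h
    induction w with
    | nil => exact fun p q h => h
    | cons c w ih => exact fun p q h => ih _ _ (scanSim_step p q c h)
  rcases h1 none q (Or.inl rfl) with h2 | h2 | ⟨c, h2, h3⟩
  · exact Or.inl h2
  · rwa [h2]
  · rcases h with h | h <;> rw [h] at h3 <;> exact absurd h3 (by simp)

theorem length_le_cost {q q' : Scan} {D : F2Word}
    (h : ∀ t c t', D = t ++ c :: t' →
      1 ≤ scanCost (scanFrom q t) c + scanCost (scanFrom q' (FreeGroup.invRev t')) (Letter.inv c)) :
    D.length ≤ costFrom q D + costFrom q' (FreeGroup.invRev D) := by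
  induction D generalizing q with
  | nil => simp
  | cons d D ih =>
    have h1 := h [] d D rfl
    have h2 := ih (q := scanStep q d) fun t c t' ht => h (d :: t) c t' (by rw [ht]; rfl)
    have h3 : FreeGroup.invRev (d :: D) = FreeGroup.invRev D ++ [Letter.inv d] := by
      simp [FreeGroup.invRev, Letter.inv]
    rw [h3, costFrom_append]
    simp only [List.length_cons, costFrom_cons, costFrom_nil, scanFrom_nil] at h1 ⊢
    omega

/-- `h` is conjugate to a stable element. -/
def ConjStable (g : F2) : Prop := ∃ t : F2, Stable (t⁻¹ * g * t)

theorem toWord_sq (g : F2) : (g * g).toWord =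
    FreeGroup.reduceCyclically.conjugator g.toWord ++ FreeGroup.reduceCyclically g.toWord ++
      (FreeGroup.reduceCyclically g.toWord ++
        FreeGroup.invRev (FreeGroup.reduceCyclically.conjugator g.toWord)) := by
  rw [← sq, FreeGroup.toWord_pow,
    FreeGroup.reduceCyclically.reduce_flatten_replicate_succ FreeGroup.isReduced_toWord]
  simp

/-- Write `g = C D C⁻¹` with `D` cyclically reduced. If some letter of `D` were free in the second
period of both `g * g` and its inverse, the rotation of `D` starting at it would be stable. So every
letter of `D` is charged by at least one of the two scans. -/
theorem length_reduceCyclically_le {g : F2} (hg : ¬ ConjStable g) :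
    (FreeGroup.reduceCyclically g.toWord).length ≤ weight (g * g) + weight (g * g)⁻¹ := by
  set C := FreeGroup.reduceCyclically.conjugator g.toWord
  set D := FreeGroup.reduceCyclically g.toWord
  have h1 : (g * g).toWord = C ++ D ++ (D ++ FreeGroup.invRev C) := toWord_sq g
  have h2 : (g * g)⁻¹.toWord =
      C ++ FreeGroup.invRev D ++ (FreeGroup.invRev D ++ FreeGroup.invRev C) := by
    rw [FreeGroup.toWord_inv, h1]
    simp only [invRev_append, FreeGroup.invRev_invRev, List.append_assoc]
  have hD : FreeGroup.IsCyclicallyReduced D :=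
    FreeGroup.reduceCyclically.isCyclicallyReduced FreeGroup.isReduced_toWord
  have hgD : g = FreeGroup.mk C * FreeGroup.mk D * (FreeGroup.mk C)⁻¹ := by
    rw [FreeGroup.inv_mk, ← mk_append, ← mk_append,
      FreeGroup.reduceCyclically.conj_conjugator_reduceCyclically, FreeGroup.mk_toWord]
  have key : D.length ≤ costFrom (scanFrom none (C ++ D)) D +
      costFrom (scanFrom none (C ++ FreeGroup.invRev D)) (FreeGroup.invRev D) := by
    refine length_le_cost fun t c t' ht => ?_
    by_contra hlt
    apply hg
    obtain ⟨hL, -⟩ := scanCost_eq_zero _ _ (by omega :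
      scanCost (scanFrom (scanFrom none (C ++ D)) t) c = 0)
    obtain ⟨hR, -⟩ := scanCost_eq_zero _ _ (by omega : scanCost (scanFrom (scanFrom none
      (C ++ FreeGroup.invRev D)) (FreeGroup.invRev t')) (Letter.inv c) = 0)
    have hL' : Guard c.2 (scanFrom none (c :: t' ++ t)) := by
      refine Guard.suffix (q := scanFrom none (C ++ t)) ?_
      rw [← scanFrom_append]
      rw [← scanFrom_append] at hL
      have h3 : C ++ t ++ (c :: t' ++ t) = C ++ D ++ t := by
        rw [ht]
        simp
      rw [h3]
      exact hL
    have hR' : Guard (!c.2) (scanFrom none (FreeGroup.invRev t ++ FreeGroup.invRev t')) := by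
      refine Guard.suffix (q := scanFrom none (C ++ FreeGroup.invRev t' ++ [Letter.inv c])) ?_
      rw [← scanFrom_append]
      rw [← scanFrom_append] at hR
      have h3 : C ++ FreeGroup.invRev t' ++ [Letter.inv c] ++
          (FreeGroup.invRev t ++ FreeGroup.invRev t') =
          C ++ FreeGroup.invRev D ++ FreeGroup.invRev t' := by
        rw [ht]
        simp [FreeGroup.invRev, Letter.inv]
      rw [h3]
      exact hR
    have hred : FreeGroup.IsReduced (c :: t' ++ t) := by
      have h3 := (hD.flatten_replicate 2).isReduced
      refine h3.infix ⟨t, c :: t', ?_⟩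
      simp [ht]
    have hrot : (FreeGroup.mk C * FreeGroup.mk t)⁻¹ * g * (FreeGroup.mk C * FreeGroup.mk t) =
        FreeGroup.mk (c :: t' ++ t) := by
      rw [hgD, ht, mk_append t, mk_append (c :: t')]
      group
    refine ⟨FreeGroup.mk C * FreeGroup.mk t, ?_⟩
    rw [hrot]
    have hw : (FreeGroup.mk (c :: t' ++ t) : F2).toWord = c :: t' ++ t :=
      toWord_eq_of_isReduced hred rfl
    refine ⟨c.2, ?_, ?_⟩
    · rw [finalScan, hw]
      exact hL'.resolve_left (scanFrom_ne_none _ _ (by simp))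
    · rw [finalScan, FreeGroup.toWord_inv, hw]
      have h3 : FreeGroup.invRev (c :: t' ++ t) =
          FreeGroup.invRev t ++ FreeGroup.invRev t' ++ [Letter.inv c] := by
        simp [FreeGroup.invRev, Letter.inv]
      rw [h3, scanFrom_append]
      exact (scan_of_guard (by simp) (by simp [Letter.inv]) hR').2
  have h3 : costFrom (scanFrom none (C ++ D)) D ≤ weight (g * g) := by
    rw [weight, scanWeight, h1, costFrom_append _ (C ++ D), costFrom_append _ D]
    omega
  have h4 : costFrom (scanFrom none (C ++ FreeGroup.invRev D)) (FreeGroup.invRev D) ≤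
      weight (g * g)⁻¹ := by
    rw [weight, scanWeight, h2, costFrom_append _ (C ++ FreeGroup.invRev D),
      costFrom_append _ (FreeGroup.invRev D)]
    omega
  omega

/-! ### Translation lengths -/

/-- The translation length of `g` is at most `K`. -/
def TransLE (K : ℕ) (g : F2) : Prop := ∃ C, ∀ n, (g ^ n).norm ≤ C + n * K

theorem TransLE.conj {K : ℕ} {g : F2} (h : TransLE K g) (t : F2) : TransLE K (t⁻¹ * g * t) := by
  obtain ⟨C, hC⟩ := h
  refine ⟨t.norm + C + t.norm, fun n => ?_⟩
  have h1 : (t⁻¹ * g * t) ^ n = t⁻¹ * g ^ n * t := by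
    have h2 := conj_pow (i := n) (a := t⁻¹) (b := g)
    rwa [inv_inv] at h2
  rw [h1]
  have h2 := FreeGroup.norm_mul_le (t⁻¹ * g ^ n) t
  have h3 := FreeGroup.norm_mul_le t⁻¹ (g ^ n)
  rw [FreeGroup.norm_inv_eq] at h3
  have h4 := hC n
  omega

theorem TransLE.norm_le {K : ℕ} {g : F2} (h : TransLE K g)
    (hg : FreeGroup.IsCyclicallyReduced g.toWord) : g.norm ≤ K := by
  obtain ⟨C, hC⟩ := h
  by_contra hlt
  -- An excess of at least 1 per period beats the constant `C` after `C + 1` periods.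
  have h1 := hC (C + 1)
  have h2 : (g ^ (C + 1)).norm = (C + 1) * g.norm := by
    rw [FreeGroup.norm, FreeGroup.toWord_pow,
      (hg.flatten_replicate (C + 1)).isReduced.reduce_eq]
    simp [FreeGroup.norm]
  have h3 : (C + 1) * (K + 1) ≤ (C + 1) * g.norm := Nat.mul_le_mul_left _ (by omega)
  have h4 : (C + 1) * (K + 1) = (C + 1) * K + (C + 1) := by ring
  omega

theorem transLE_length (g : F2) :
    TransLE (FreeGroup.reduceCyclically g.toWord).length g := by
  refine ⟨2 * (FreeGroup.reduceCyclically.conjugator g.toWord).length, fun n => ?_⟩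
  cases n with
  | zero => simp
  | succ n =>
    rw [FreeGroup.norm, FreeGroup.toWord_pow,
      FreeGroup.reduceCyclically.reduce_flatten_replicate_succ FreeGroup.isReduced_toWord]
    simp
    omega

theorem TransLE.mono {K M : ℕ} {g : F2} (h : TransLE K g) (hKM : K ≤ M) : TransLE M g := by
  obtain ⟨C, hC⟩ := h
  exact ⟨C, fun n => (hC n).trans (by have := Nat.mul_le_mul_left n hKM; omega)⟩

theorem conjStable_of_not_transLE {K : ℕ} {g : F2}
    (hK : weight (g * g) + weight (g * g)⁻¹ ≤ K) (h : ¬ TransLE K g) : ConjStable g := by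
  by_contra hg
  exact h ((transLE_length g).mono ((length_reduceCyclically_le hg).trans hK))

theorem norm_inv_mul_le_of_head? {g : F2} {c : Letter} (h : c ∈ g.toWord.head?) :
    ((FreeGroup.mk [c])⁻¹ * g).norm + 1 ≤ g.norm := by
  rcases hw : g.toWord with _ | ⟨d, w⟩
  · rw [hw] at h
    simp at h
  · rw [hw] at h
    simp only [List.head?_cons, Option.mem_def, Option.some.injEq] at h
    subst h
    have h1 : (FreeGroup.mk [d])⁻¹ * g = FreeGroup.mk w := by
      rw [← FreeGroup.mk_toWord (x := g), hw, mk_cons_eq d w, inv_mul_cancel_left]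
    have h2 : g.norm = w.length + 1 := by rw [FreeGroup.norm, hw, List.length_cons]
    rw [h1, h2, Nat.add_le_add_iff_right]
    exact FreeGroup.norm_mk_le

theorem norm_letter (c : Letter) : (FreeGroup.mk [c] : F2).norm = 1 := rfl

theorem norm_conj_letter_le {g : F2} {c : Letter} (h : c ∈ g.toWord.head?) :
    ((FreeGroup.mk [c])⁻¹ * g * FreeGroup.mk [c]).norm ≤ g.norm := by
  have h1 := norm_inv_mul_le_of_head? h
  have h2 := FreeGroup.norm_mul_le ((FreeGroup.mk [c])⁻¹ * g) (FreeGroup.mk [c])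
  rw [norm_letter] at h2
  omega

theorem norm_conj_letter_le' {g : F2} {c : Letter} (h : c ∈ g⁻¹.toWord.head?) :
    ((FreeGroup.mk [c])⁻¹ * g * FreeGroup.mk [c]).norm ≤ g.norm := by
  have h1 := norm_conj_letter_le h
  rw [FreeGroup.norm_inv_eq, ← FreeGroup.norm_inv_eq] at h1
  simpa [mul_assoc] using h1

/-- Since `g` begins with `c` and ends with `c⁻¹`, while `h` does neither, nothing cancels at the
junctions of `g h` and of `h g`. -/
theorem mul_cyclicallyReduced {g h : F2} {c : Letter} (hc : c ∈ g.toWord.head?)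
    (hc' : c ∈ g⁻¹.toWord.head?) (hh : c ∉ h.toWord.head?) (hh' : c ∉ h⁻¹.toWord.head?)
    (hne : h ≠ 1) : FreeGroup.IsCyclicallyReduced (g * h).toWord ∧
      (g * h).norm = g.norm + h.norm := by
  have key : ∀ {g h : F2}, c ∈ g⁻¹.toWord.head? → c ∉ h.toWord.head? →
      (g * h).toWord = g.toWord ++ h.toWord := by
    intro g h hc' hh
    refine toWord_eq_of_isReduced (isReduced_append_iff.2
      ⟨FreeGroup.isReduced_toWord, FreeGroup.isReduced_toWord, ?_⟩)
      (by rw [mk_append, FreeGroup.mk_toWord, FreeGroup.mk_toWord])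
    intro x hx y hy hxy
    by_contra hne
    have h1 := head?_invRev _ _ hc'
    rw [FreeGroup.toWord_inv, FreeGroup.invRev_invRev] at h1
    have h2 : x = Letter.inv c := Option.mem_unique hx h1
    have h3 : y = c := by
      subst h2
      refine Prod.ext hxy.symm ?_
      simpa [Letter.inv, Bool.eq_not, eq_comm] using hne
    exact hh (h3 ▸ hy)
  have h1 := key hc' hh
  have h2 : (g * h)⁻¹.toWord = h⁻¹.toWord ++ g⁻¹.toWord := by
    rw [FreeGroup.toWord_inv, h1, invRev_append, FreeGroup.toWord_inv, FreeGroup.toWord_inv]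
  have hgne : g.toWord ≠ [] := by
    intro h0
    rw [h0] at hc
    simp at hc
  have hhne : h⁻¹.toWord ≠ [] := by
    rwa [Ne, FreeGroup.toWord_eq_nil_iff, inv_eq_one]
  refine ⟨isCyclicallyReduced_of_head? ?_, by simp [FreeGroup.norm, h1]⟩
  intro d hd hd'
  rw [h1, List.head?_append_of_ne_nil _ hgne] at hd
  rw [h2, List.head?_append_of_ne_nil _ hhne] at hd'
  have h3 : d = c := Option.mem_unique hd hc
  exact hh' (h3 ▸ hd')

/-- A tuple of elements whose translation lengths, and those of the products of two of them, are
bounded is conjugate to a tuple of bounded elements. -/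
theorem exists_conj_norm_le {m K : ℕ} (g : Fin m → F2) (h1 : ∀ i, TransLE K (g i))
    (h2 : ∀ i j, TransLE K (g i * g j)) :
    ∃ t : F2, ∀ i, (t⁻¹ * g i * t).norm ≤ K := by
  classical
  -- Conjugate so that the total length is minimal.
  have hex : ∃ n, ∃ t : F2, ∑ i, (t⁻¹ * g i * t).norm = n := ⟨_, 1, rfl⟩
  obtain ⟨t, ht⟩ := Nat.find_spec hex
  have hmin : ∀ s : F2, ∑ i, (t⁻¹ * g i * t).norm ≤ ∑ i, (s⁻¹ * g i * s).norm := fun s =>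
    ht ▸ Nat.find_min' hex ⟨s, rfl⟩
  refine ⟨t, fun i => ?_⟩
  by_contra hlt
  have hnc : ¬ FreeGroup.IsCyclicallyReduced (t⁻¹ * g i * t).toWord := fun h =>
    hlt (((h1 i).conj t).norm_le h)
  have hc : ∃ c, c ∈ (t⁻¹ * g i * t).toWord.head? ∧ c ∈ (t⁻¹ * g i * t)⁻¹.toWord.head? := by
    by_contra hcon
    push Not at hcon
    exact hnc (isCyclicallyReduced_of_head? hcon)
  obtain ⟨c, hc, hc'⟩ := hc
  have hconj : ∀ j, (t * FreeGroup.mk [c])⁻¹ * g j * (t * FreeGroup.mk [c]) =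
      (FreeGroup.mk [c])⁻¹ * (t⁻¹ * g j * t) * FreeGroup.mk [c] := fun j => by group
  have hi : ((FreeGroup.mk [c])⁻¹ * (t⁻¹ * g i * t) * FreeGroup.mk [c]).norm <
      (t⁻¹ * g i * t).norm := by
    have h3 : c ∈ ((FreeGroup.mk [c])⁻¹ * (t⁻¹ * g i * t))⁻¹.toWord.head? := by
      rw [mul_inv_rev, inv_inv, Option.mem_def, head?_toWord_mul]
      · exact hc'
      · rw [norm_letter, FreeGroup.norm_inv_eq]
        by_contra h4
        apply hnc
        have h5 : (t⁻¹ * g i * t).toWord = [c] := by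
          rcases hw : (t⁻¹ * g i * t).toWord with _ | ⟨d, w⟩
          · rw [hw] at hc
            simp at hc
          · rw [FreeGroup.norm, hw, List.length_cons] at h4
            rw [hw] at hc
            simp only [List.head?_cons, Option.mem_def, Option.some.injEq] at hc
            rw [hc, List.length_eq_zero_iff.1 (by omega : w.length = 0)]
        rw [h5]
        exact FreeGroup.IsCyclicallyReduced.singleton
    have h4 := norm_inv_mul_le_of_head? hc
    have h5 := norm_inv_mul_le_of_head? h3
    rw [FreeGroup.norm_inv_eq, ← FreeGroup.norm_inv_eq, mul_inv_rev, inv_inv, inv_inv] at h5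
    omega
  -- Conjugation by `c` shortens the `i`-th element, so by minimality it must lengthen another one.
  have hj : ∃ j, (t⁻¹ * g j * t).norm <
      ((FreeGroup.mk [c])⁻¹ * (t⁻¹ * g j * t) * FreeGroup.mk [c]).norm := by
    by_contra hcon
    push Not at hcon
    have h3 := hmin (t * FreeGroup.mk [c])
    simp only [hconj] at h3
    exact absurd h3 (not_le.2 (Finset.sum_lt_sum (fun j _ => hcon j) ⟨i, Finset.mem_univ _, hi⟩))
  obtain ⟨j, hj⟩ := hj
  -- The lengthened element neither begins with `c` nor ends with `c⁻¹`, so its product with the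
  -- `i`-th one is cyclically reduced and longer than `K`, against the bound for products.
  have h3 : c ∉ (t⁻¹ * g j * t).toWord.head? := fun h => absurd (norm_conj_letter_le h) (by omega)
  have h4 : c ∉ (t⁻¹ * g j * t)⁻¹.toWord.head? := fun h =>
    absurd (norm_conj_letter_le' h) (by omega)
  have h5 : t⁻¹ * g j * t ≠ 1 := by
    intro h
    rw [h, mul_one, inv_mul_cancel] at hj
    exact absurd hj (lt_irrefl _)
  obtain ⟨h6, h7⟩ := mul_cyclicallyReduced hc hc' h3 h4 h5
  have h8 : (t⁻¹ * g i * t) * (t⁻¹ * g j * t) = t⁻¹ * (g i * g j) * t := by group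
  rw [h8] at h6 h7
  have h9 := ((h2 i j).conj t).norm_le h6
  omega

/-! ### Conjugate cyclically reduced words -/

theorem isCyclicallyReduced_iff_append_self {w : F2Word} :
    FreeGroup.IsCyclicallyReduced w ↔ FreeGroup.IsReduced (w ++ w) := by
  rw [isReduced_append_iff]
  exact ⟨fun h => ⟨h.1, h.1, h.2⟩, fun h => ⟨h.1, h.2.2⟩⟩

theorem isCyclicallyReduced_rotate {v w : F2Word} (h : FreeGroup.IsCyclicallyReduced (v ++ w)) :
    FreeGroup.IsCyclicallyReduced (w ++ v) := by
  rw [isCyclicallyReduced_iff_append_self]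
  refine (h.flatten_replicate 3).isReduced.infix ⟨v, w, ?_⟩
  simp [List.replicate_succ]

/-- Induction on the length of the conjugator: when its first letter cancels at an end of `D`, this
rotates `D` by one letter and shortens `t`. -/
theorem isRotated_of_conj {t : F2} {D : F2Word} (hD : FreeGroup.IsCyclicallyReduced D)
    (hne : D ≠ []) (h : FreeGroup.IsCyclicallyReduced (t⁻¹ * FreeGroup.mk D * t).toWord) :
    D.IsRotated (t⁻¹ * FreeGroup.mk D * t).toWord := by
  induction hn : t.norm using Nat.strong_induction_on generalizing t D with
  | _ n ih =>
    rcases ht : t.toWord with _ | ⟨s, r⟩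
    · rw [FreeGroup.toWord_eq_nil_iff] at ht
      subst ht
      rw [inv_one, one_mul, mul_one, toWord_eq_of_isReduced hD.isReduced rfl]
    · have htr : t = FreeGroup.mk [s] * FreeGroup.mk r := by
        rw [← mk_cons_eq, ← ht, FreeGroup.mk_toWord]
      have hr : (FreeGroup.mk r : F2).norm < n := by
        rw [← hn, FreeGroup.norm.eq_def t, ht, List.length_cons]
        exact Nat.lt_succ_of_le FreeGroup.norm_mk_le
      have hs : (FreeGroup.mk [Letter.inv s] : F2) = (FreeGroup.mk [s])⁻¹ := by
        rw [FreeGroup.inv_mk]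
        rfl
      by_cases h1 : ∃ D', D = s :: D'
      · obtain ⟨D', rfl⟩ := h1
        have h2 : t⁻¹ * FreeGroup.mk (s :: D') * t =
            (FreeGroup.mk r)⁻¹ * FreeGroup.mk (D' ++ [s]) * FreeGroup.mk r := by
          rw [htr, mk_cons_eq s D', mk_append D' [s]]
          group
        rw [h2] at h ⊢
        exact (List.isRotated_concat s D').symm.trans
          (ih _ hr (isCyclicallyReduced_rotate (v := [s]) hD) (by simp) h rfl)
      by_cases h1' : ∃ D', D = D' ++ [Letter.inv s]
      · obtain ⟨D', rfl⟩ := h1'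
        have h2 : t⁻¹ * FreeGroup.mk (D' ++ [Letter.inv s]) * t =
            (FreeGroup.mk r)⁻¹ * FreeGroup.mk (Letter.inv s :: D') * FreeGroup.mk r := by
          rw [htr, mk_cons_eq (Letter.inv s) D', mk_append D' [Letter.inv s], hs]
          group
        rw [h2] at h ⊢
        exact (List.isRotated_concat _ D').trans
          (ih _ hr (isCyclicallyReduced_rotate (w := [Letter.inv s]) hD) (by simp) h rfl)
      have hred : FreeGroup.IsReduced (FreeGroup.invRev t.toWord ++ D ++ t.toWord) := by
        rw [List.append_assoc]
        refine isReduced_append_iff.2 ⟨?_, isReduced_append_iff.2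
          ⟨hD.isReduced, FreeGroup.isReduced_toWord, ?_⟩, ?_⟩
        · rw [← FreeGroup.toWord_inv]
          exact FreeGroup.isReduced_toWord
        · intro x hx y hy hxy
          rw [ht] at hy
          simp only [List.head?_cons, Option.mem_def, Option.some.injEq] at hy
          subst hy
          by_contra hcon
          rcases List.eq_nil_or_concat D with rfl | ⟨D', d, rfl⟩
          · exact hne rfl
          · simp only [List.concat_eq_append, List.getLast?_concat, Option.mem_def,
              Option.some.injEq] at hx
            subst hx
            refine h1' ⟨D', ?_⟩
            rw [List.concat_eq_append]
            congr 2
            exact Prod.ext hxy (by simpa [Letter.inv, Bool.eq_not] using hcon)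
        · intro x hx y hy hxy
          have h2 : Letter.inv s ∈ (FreeGroup.invRev t.toWord).getLast? :=
            head?_invRev _ _ (by rw [ht]; rfl)
          have h3 : x = Letter.inv s := Option.mem_unique hx h2
          subst h3
          rw [List.head?_append_of_ne_nil _ hne] at hy
          obtain ⟨d, D', rfl⟩ := List.exists_cons_of_ne_nil hne
          simp only [List.head?_cons, Option.mem_def, Option.some.injEq] at hy
          subst hy
          by_contra hcon
          refine h1 ⟨D', ?_⟩
          congr 1
          exact Prod.ext hxy.symm (by simpa [Letter.inv, Bool.eq_not, eq_comm] using hcon)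
      -- Without cancellation at either end, `t⁻¹ D t` is reduced as written and visibly not
      -- cyclically reduced.
      exfalso
      rw [toWord_eq_of_isReduced hred (by rw [mk_append, mk_append, ← FreeGroup.inv_mk,
        FreeGroup.mk_toWord]), isCyclicallyReduced_iff_append_self] at h
      have h2 : FreeGroup.IsReduced (t.toWord ++ FreeGroup.invRev t.toWord) :=
        h.infix ⟨FreeGroup.invRev t.toWord ++ D, D ++ t.toWord, by simp⟩
      have h3 : (1 : F2).toWord = t.toWord ++ FreeGroup.invRev t.toWord :=
        toWord_eq_of_isReduced h2 (by
          rw [mk_append, ← FreeGroup.inv_mk, FreeGroup.mk_toWord, mul_inv_cancel])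
      rw [ht] at h3
      simp at h3

theorem Stable.isCyclicallyReduced {w : F2} (h : Stable w) :
    FreeGroup.IsCyclicallyReduced w.toWord := isCyclicallyReduced_of_head? h.head?

/-- A stable conjugate is cyclically reduced, hence a rotation of the cyclic reduction `D` of `g = C
D C⁻¹`; it is reached by conjugating with `C` times a prefix of `D`. -/
theorem ConjStable.exists_norm_le {g : F2} (h : ConjStable g) :
    ∃ t : F2, t.norm ≤ 2 * g.norm ∧ Stable (t⁻¹ * g * t) := by
  obtain ⟨u, hu⟩ := h
  set C := FreeGroup.reduceCyclically.conjugator g.toWord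
  set D := FreeGroup.reduceCyclically g.toWord
  have hw : C ++ D ++ FreeGroup.invRev C = g.toWord :=
    FreeGroup.reduceCyclically.conj_conjugator_reduceCyclically _
  have hD : FreeGroup.IsCyclicallyReduced D :=
    FreeGroup.reduceCyclically.isCyclicallyReduced FreeGroup.isReduced_toWord
  have hgD : g = FreeGroup.mk C * FreeGroup.mk D * (FreeGroup.mk C)⁻¹ := by
    rw [FreeGroup.inv_mk, ← mk_append, ← mk_append, hw, FreeGroup.mk_toWord]
  have hne : D ≠ [] := by
    intro h0
    apply hu.ne_one
    rw [hgD, h0, ← FreeGroup.one_eq_mk]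
    group
  have h1 : u⁻¹ * g * u =
      ((FreeGroup.mk C)⁻¹ * u)⁻¹ * FreeGroup.mk D * ((FreeGroup.mk C)⁻¹ * u) := by
    rw [hgD]
    group
  have hrot := isRotated_of_conj (t := (FreeGroup.mk C)⁻¹ * u) hD hne
    (by rw [← h1]; exact hu.isCyclicallyReduced)
  rw [← h1] at hrot
  obtain ⟨n, hn, hrot⟩ := List.isRotated_iff_mod.1 hrot
  rw [List.rotate_eq_drop_append_take hn] at hrot
  have h2 : (FreeGroup.mk C * FreeGroup.mk (D.take n))⁻¹ * g *
      (FreeGroup.mk C * FreeGroup.mk (D.take n)) = u⁻¹ * g * u := by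
    rw [← FreeGroup.mk_toWord (x := u⁻¹ * g * u), ← hrot, mk_append]
    have h3 : (FreeGroup.mk D : F2) = FreeGroup.mk (D.take n) * FreeGroup.mk (D.drop n) := by
      rw [← mk_append, List.take_append_drop]
    conv_lhs => rw [hgD, h3]
    group
  refine ⟨FreeGroup.mk C * FreeGroup.mk (D.take n), ?_, by rwa [h2]⟩
  have h3 : g.norm = C.length + D.length + C.length := by
    rw [FreeGroup.norm, ← hw]
    simp only [List.length_append, FreeGroup.invRev_length]
  have h4 := FreeGroup.norm_mul_le (FreeGroup.mk C) (FreeGroup.mk (D.take n))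
  have h5 := FreeGroup.norm_mk_le (L₁ := C)
  have h6 := FreeGroup.norm_mk_le (L₁ := D.take n)
  rw [List.length_take] at h6
  omega

theorem norm_sigma_le (i : Fin 3) (g : F2) : (F2.sigma i g).norm ≤ 2 * g.norm := by
  have h1 : F2.sigma i g = FreeGroup.mk (subWord i g.toWord) := by
    rw [mk_subWord, FreeGroup.mk_toWord]
  rw [h1]
  refine FreeGroup.norm_mk_le.trans ?_
  rw [FreeGroup.norm]
  generalize g.toWord = w
  clear h1
  have h2 : ∀ c : Letter, (sub i c).length ≤ 2 := by
    revert i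
    decide
  induction w with
  | nil => simp
  | cons c w ih =>
    have h3 := h2 c
    rw [← List.singleton_append, subWord_append, subWord_singleton]
    simp only [List.length_append, List.length_cons, List.length_nil]
    omega

/-! ### Conjugates of tuples -/

section Tuples

variable {m : ℕ}

/-- The members of a tuple and their products. -/
def member (g : Fin m → F2) : Fin m ⊕ Fin m × Fin m → F2
  | Sum.inl i => g i
  | Sum.inr p => g p.1 * g p.2

theorem member_map (f : MulAut F2) (g : Fin m → F2) (e : Fin m ⊕ Fin m × Fin m) :
    member (fun i => f (g i)) e = f (member g e) := by
  rcases e with i | p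
  · rfl
  · exact (map_mul f _ _).symm

theorem member_conj (t : F2) (g : Fin m → F2) (e : Fin m ⊕ Fin m × Fin m) :
    member (fun i => t⁻¹ * g i * t) e = t⁻¹ * member g e * t := by
  rcases e with i | p
  · rfl
  · simp only [member]
    group

theorem member_norm_le {n : ℕ} {g : Fin m → F2} (h : ∀ i, (g i).norm ≤ n)
    (e : Fin m ⊕ Fin m × Fin m) : (member g e).norm ≤ 2 * n := by
  rcases e with i | p
  · have := h i
    simp only [member]
    omega
  · have h1 := h p.1
    have h2 := h p.2
    have h3 := FreeGroup.norm_mul_le (g p.1) (g p.2)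
    simp only [member]
    omega

theorem member_smul {X : Type} [MulAction F2 X] {g : Fin m → F2} {x : X}
    (h : ∀ i, (g i)⁻¹ • x = x) (e : Fin m ⊕ Fin m × Fin m) : (member g e)⁻¹ • x = x := by
  rcases e with i | p
  · exact h i
  · simp only [member]
    rw [mul_inv_rev, mul_smul, h, h]

theorem norm_conj_le (t g : F2) : (t⁻¹ * g * t).norm ≤ g.norm + 2 * t.norm := by
  have h1 := FreeGroup.norm_mul_le (t⁻¹ * g) t
  have h2 := FreeGroup.norm_mul_le t⁻¹ g
  rw [FreeGroup.norm_inv_eq] at h2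
  omega

/-- Conjugating the tuple merely translates its fixed points, so existence over all of `X` is
unaffected. -/
theorem exists_fixed_conj_iff {X : Type} [MulAction F2 X] (f : MulAut F2) (t : F2)
    (g : Fin m → F2) :
    (∃ x : X, ∀ i, (f (t⁻¹ * g i * t))⁻¹ • x = x) ↔ ∃ x : X, ∀ i, (f (g i))⁻¹ • x = x := by
  constructor
  · rintro ⟨x, hx⟩
    refine ⟨f t • x, fun i => ?_⟩
    have h1 := hx i
    rw [map_mul, map_mul, map_inv, mul_inv_rev, mul_inv_rev, inv_inv, mul_smul, mul_smul,
      inv_smul_eq_iff] at h1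
    exact h1
  · rintro ⟨x, hx⟩
    refine ⟨(f t)⁻¹ • x, fun i => ?_⟩
    rw [map_mul, map_mul, map_inv, mul_inv_rev, mul_inv_rev, inv_inv, mul_smul, mul_smul,
      smul_inv_smul, hx]

/-- Either the tuple of images is conjugate to a bounded tuple, or this holds for a prefix of the
word, at which a member of the tuple is conjugate to a stable element. -/
theorem exists_bounded_or_stable {n : ℕ} (g : Fin m → F2) (hg : ∀ i, (g i).norm ≤ n)
    (v : List (Fin 3)) :
    (∃ t : F2, ∀ i, (t⁻¹ * act v (g i) * t).norm ≤ 2 * (4 * n + 1)) ∨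
      ∃ v₁ v₂, v = v₁ ++ v₂ ∧ (∃ e, ConjStable (act v₁ (member g e))) ∧
        ∃ t : F2, ∀ i, (t⁻¹ * act v₁ (g i) * t).norm ≤ 4 * (4 * n + 1) := by
  -- Members and products have norm at most `2 * n`, their squares at most `4 * n`; so the images of
  -- a square and of its inverse each have weight at most `4 * n + 1`, and the sum bounds the
  -- translation length.
  have key : ∀ v, (∀ e, ¬ ConjStable (act v (member g e))) →
      ∃ t : F2, ∀ i, (t⁻¹ * act v (g i) * t).norm ≤ 2 * (4 * n + 1) := by
    intro v hv
    have h1 : ∀ e, TransLE (2 * (4 * n + 1)) (act v (member g e)) := by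
      intro e
      by_contra hcon
      refine hv e (conjStable_of_not_transLE ?_ hcon)
      have h2 : ∀ x : F2, x.norm ≤ 2 * (2 * n) → weight (act v x) ≤ 4 * n + 1 := fun x hx =>
        (weight_act_le v x).trans ((weight_le_norm x).trans (by omega))
      have h3 := member_norm_le hg e
      have h4 := FreeGroup.norm_mul_le (member g e) (member g e)
      have h5 := h2 (member g e * member g e) (by omega)
      have h6 := h2 (member g e * member g e)⁻¹ (by rw [FreeGroup.norm_inv_eq]; omega)
      rw [map_inv] at h6
      rw [map_mul] at h5 h6
      omega
    refine exists_conj_norm_le _ (fun i => h1 (Sum.inl i)) fun i j => ?_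
    have h2 := h1 (Sum.inr (i, j))
    rwa [← member_map] at h2
  induction v using List.reverseRecOn with
  | nil =>
    refine Or.inl ⟨1, fun i => ?_⟩
    have := hg i
    simp only [act_nil, MulAut.one_apply, inv_one, one_mul, mul_one]
    omega
  | append_singleton v c ih =>
    rcases ih with ⟨t, ht⟩ | ⟨v₁, v₂, rfl, h1, h2⟩
    · by_cases hst : ∃ e, ConjStable (act (v ++ [c]) (member g e))
      -- The tuple was still bounded one letter earlier, and a letter at most doubles norms.
      · refine Or.inr ⟨v ++ [c], [], by simp, hst, F2.sigma c t, fun i => ?_⟩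
        have h1 := norm_sigma_le c (t⁻¹ * act v (g i) * t)
        rw [map_mul, map_mul, map_inv, ← act_concat] at h1
        have h2 := ht i
        omega
      · exact Or.inl (key _ (by simpa using hst))
    · exact Or.inr ⟨v₁, v₂ ++ [c], by simp, h1, h2⟩

/-- The Boolean of `IndexLE.of_tuples` records whether the fixed coset is sought everywhere, for a
tuple conjugate to a bounded one, or only in the core, once a stable element has appeared. Only in
the second case are the entries replaced by exchanges. -/
theorem indexLE_conj (L : List F2Word) (n : ℕ) (g : Fin m → F2) (hg : ∀ i, (g i).norm ≤ n) :
    IndexLE (fun w => ∃ x : F2 ⧸ generatedSubgroup L, ∀ i, (act w (g i))⁻¹ • x = x)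
      (tupleBound (prefixCount L) n m) := by
  set H := generatedSubgroup L
  refine IndexLE.of_tuples (fun b g => if b = true then
    ∃ x : F2 ⧸ H, ∀ i, (g i)⁻¹ • x = x
    else ∃ x ∈ prefixPoints H L, ∀ i, (g i)⁻¹ • x = x) fun v => ?_
  rcases exists_bounded_or_stable g hg v with ⟨t, ht⟩ | ⟨v₁, v₂, rfl, ⟨e, he⟩, t, ht⟩
  · refine ⟨true, fun i => t⁻¹ * act v (g i) * t, fun i => (ht i).trans ?_, fun z => ?_⟩
    · have h1 : (36 * (4 * n + 1) + 1 + 1) * 1 ≤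
          repBound (36 * (4 * n + 1) + 1) (relCount (prefixCount L)) :=
        Nat.mul_le_mul_left _ (Nat.mul_pos (by omega) (by omega))
      omega
    · simp only [if_true]
      rw [exists_fixed_conj_iff (act z) t fun i => act v (g i)]
      simp only [act_append_apply]
  · have h1 : ConjStable (member (fun i => t⁻¹ * act v₁ (g i) * t) e) := by
      obtain ⟨s, hs⟩ := he
      refine ⟨t⁻¹ * s, ?_⟩
      rw [member_conj, member_map]
      have h2 : (t⁻¹ * s)⁻¹ * (t⁻¹ * act v₁ (member g e) * t) * (t⁻¹ * s) =
          s⁻¹ * act v₁ (member g e) * s := by group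
      rwa [h2]
    obtain ⟨s, hs1, hs2⟩ := h1.exists_norm_le
    rw [← member_conj] at hs2
    set h : Fin m → F2 := fun i => s⁻¹ * (t⁻¹ * act v₁ (g i) * t) * s with hh
    -- With `d = 4 * n + 1`: entries have norm at most `4 * d`, members and products `8 * d`, so `s`
    -- has norm at most `16 * d`, and conjugating by `s` gives `4 * d + 2 * 16 * d = 36 * d`.
    have hnorm : ∀ i, (h i).norm + 1 ≤ 36 * (4 * n + 1) + 1 := by
      intro i
      have h2 := norm_conj_le s (t⁻¹ * act v₁ (g i) * t)
      have h3 := member_norm_le ht e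
      have h4 := ht i
      simp only [hh]
      omega
    choose r hr1 hr2 using fun i => exists_bounded_rep L _ (h i) (hnorm i) v₂
    refine ⟨false, r, hr1, fun z => ?_⟩
    simp only [Bool.false_eq_true, if_false]
    have h2 : (∃ x : F2 ⧸ H, ∀ i, (act (v₁ ++ v₂ ++ z) (g i))⁻¹ • x = x) ↔
        ∃ x : F2 ⧸ H, ∀ i, (act (v₂ ++ z) (h i))⁻¹ • x = x := by
      rw [exists_fixed_conj_iff (act (v₂ ++ z)) s, exists_fixed_conj_iff (act (v₂ ++ z)) t]
      simp only [act_append_apply]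
    rw [h2]
    constructor
    · rintro ⟨x, hx⟩
      have hst := hs2.act (v₂ ++ z)
      -- The image of the stable element stays cyclically reduced and nontrivial, so its fixed
      -- points lie in the core.
      have hxV : x ∈ prefixPoints H L := by
        refine (pathConvex_prefixPoints L).mem_of_smul_eq (exists_smul_mem_prefixPoints _ _ _)
          hst.ne_one ?_ hst.head?
        rw [← member_map]
        exact member_smul hx e
      exact ⟨x, hxV, fun i => (hr2 i z x hxV).1 (hx i)⟩
    · rintro ⟨x, hxV, hx⟩
      exact ⟨x, fun i => (hr2 i z x hxV).2 (hx i)⟩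

end Tuples

/-! ### Inclusion problems for images of subgroups -/

/-- The image of a word under the letters of a word over `Σ`, applied one after the other. -/
def foldWord (w : List (Fin 3)) (u : F2Word) : F2Word := w.foldl (fun u i => subWord i u) u

theorem mk_foldWord (w : List (Fin 3)) (u : F2Word) :
    FreeGroup.mk (foldWord w u) = act w (FreeGroup.mk u) := by
  induction w using List.reverseRecOn with
  | nil => simp [foldWord, act_nil]
  | append_singleton w i ih =>
    rw [act_concat, ← ih, ← mk_subWord]
    simp [foldWord]

/-- The words of `U` represent elements of the subgroup generated by `L`. -/
def Contains (L U : List F2Word) : Prop := ∀ u ∈ U, FreeGroup.mk u ∈ generatedSubgroup L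

/-- Some conjugate of the tuple given by `U` is contained in the subgroup generated by `L`. -/
def ContainsConj (L U : List F2Word) : Prop :=
  ∃ g : F2, ∀ u ∈ U, MulAut.conj g (FreeGroup.mk u) ∈ generatedSubgroup L

theorem generatedSubgroup_le_iff {U : List F2Word} {H : Subgroup F2} :
    generatedSubgroup U ≤ H ↔ ∀ u ∈ U, FreeGroup.mk u ∈ H := by
  rw [generatedSubgroup, Subgroup.closure_le]
  constructor
  · exact fun h u hu => h ⟨u, hu, rfl⟩
  · rintro h g ⟨u, hu, rfl⟩
    exact h u hu

theorem map_generatedSubgroup (U : List F2Word) (f : F2 →* F2) (F : F2Word → F2Word)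
    (hF : ∀ u, FreeGroup.mk (F u) = f (FreeGroup.mk u)) :
    (generatedSubgroup U).map f = generatedSubgroup (U.map F) := by
  rw [generatedSubgroup, MonoidHom.map_closure, generatedSubgroup]
  congr 1
  ext g
  constructor
  · rintro ⟨_, ⟨u, hu, rfl⟩, rfl⟩
    exact ⟨F u, List.mem_map_of_mem hu, (hF u).symm⟩
  · rintro ⟨w, hw, rfl⟩
    obtain ⟨u, hu, rfl⟩ := List.mem_map.1 hw
    exact ⟨_, ⟨u, hu, rfl⟩, (hF u).symm⟩

theorem norm_mk_get_le (U : List F2Word) (i : Fin U.length) :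
    (FreeGroup.mk (U.get i) : F2).norm ≤ U.flatten.length :=
  FreeGroup.norm_mk_le.trans
    (List.Sublist.length_le (List.sublist_flatten_of_mem (List.get_mem U i)))

/-- A bound for the index of the languages describing `Contains` and `ContainsConj`. -/
def listBound (L U : List F2Word) : ℕ := tupleBound (prefixCount L) U.flatten.length U.length

theorem indexLE_contains (L U : List F2Word) :
    IndexLE (fun w => Contains L (U.map (foldWord w))) (listBound L U) := by
  refine (indexLE_mem L _ (fun i => FreeGroup.mk (U.get i)) (norm_mk_get_le U)).congr fun w => ?_
  simp only [Contains, List.forall_mem_map, mk_foldWord]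
  exact (List.forall_mem_iff_get (p := fun u => act w (FreeGroup.mk u) ∈ generatedSubgroup L)).symm

theorem smul_coset_eq_iff (H : Subgroup F2) (g u : F2) :
    u⁻¹ • ((g : F2) : F2 ⧸ H) = (g : F2 ⧸ H) ↔ MulAut.conj g⁻¹ u ∈ H := by
  rw [MulAction.Quotient.smul_coe, smul_eq_mul, QuotientGroup.eq, MulAut.conj_apply]
  simp [mul_assoc]

theorem containsConj_iff (L U : List F2Word) : ContainsConj L U ↔
    ∃ x : F2 ⧸ generatedSubgroup L, ∀ u ∈ U, (FreeGroup.mk u)⁻¹ • x = x := by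
  constructor
  · rintro ⟨g, hg⟩
    refine ⟨((g⁻¹ : F2) : F2 ⧸ generatedSubgroup L), fun u hu => ?_⟩
    rw [smul_coset_eq_iff, inv_inv]
    exact hg u hu
  · rintro ⟨x, hx⟩
    obtain ⟨g, rfl⟩ := QuotientGroup.mk_surjective x
    exact ⟨g⁻¹, fun u hu => (smul_coset_eq_iff _ _ _).1 (hx u hu)⟩

theorem indexLE_containsConj (L U : List F2Word) :
    IndexLE (fun w => ContainsConj L (U.map (foldWord w))) (listBound L U) := by
  refine (indexLE_conj L _ (fun i => FreeGroup.mk (U.get i)) (norm_mk_get_le U)).congr fun w => ?_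
  rw [containsConj_iff]
  refine exists_congr fun x => ?_
  simp only [List.forall_mem_map, mk_foldWord]
  exact (List.forall_mem_iff_get (p := fun u => (act w (FreeGroup.mk u))⁻¹ • x = x)).symm

/-! ### From images under `μ` to letters applied from left to right -/

/-- The automorphism `a ↦ a⁻¹, b ↦ b`. -/
def flipAut : MulAut F2 :=
  MonoidHom.toMulEquiv (F2.endo F2.a⁻¹ F2.b) (F2.endo F2.a⁻¹ F2.b)
    (F2.hom_ext (by simp) (by simp)) (F2.hom_ext (by simp) (by simp))

/-- The image of a word under `a ↦ a⁻¹, b ↦ b`. -/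
def flipWord (u : F2Word) : F2Word := u.map fun c => (c.1, if c.1 = 0 then !c.2 else c.2)

theorem mk_flipWord (u : F2Word) : FreeGroup.mk (flipWord u) = flipAut (FreeGroup.mk u) := by
  induction u with
  | nil => simp [flipWord, ← FreeGroup.one_eq_mk]
  | cons c u ih =>
    have hc : (FreeGroup.mk [(c.1, if c.1 = 0 then !c.2 else c.2)] : F2) =
        flipAut (FreeGroup.mk [c]) := by
      have ha : FreeGroup.mk [((0 : Fin 2), true)] = F2.a := rfl
      have hb : FreeGroup.mk [((1 : Fin 2), true)] = F2.b := rfl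
      have hA : FreeGroup.mk [((0 : Fin 2), false)] = F2.a⁻¹ := rfl
      have hB : FreeGroup.mk [((1 : Fin 2), false)] = F2.b⁻¹ := rfl
      obtain ⟨x, s⟩ := c
      fin_cases x <;> cases s <;> simp [flipAut, ha, hb, hA, hB]
    rw [mk_cons_eq, map_mul, ← ih, ← hc, ← mk_append]
    rfl

/-- The action of inversion, conjugated by `flipAut`, on the alphabet `Σ`. -/
def flipLetter : Fin 3 → Fin 3 := ![0, 2, 1]

/-- Conjugation by the flip turns the inverse of `phi0` into `phi0` and exchanges the involutions
`phi1` and `phi2`. -/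
theorem sigma_flip_sigma (i : Fin 3) (g : F2) :
    F2.sigma (flipLetter i) (flipAut (F2.sigma i g)) = flipAut g := by
  have h : (F2.sigma (flipLetter i)).toMonoidHom.comp
      (flipAut.toMonoidHom.comp (F2.sigma i).toMonoidHom) = flipAut.toMonoidHom := by
    fin_cases i <;>
      exact F2.hom_ext
        (by simp [F2.sigma, flipLetter, flipAut, F2.phi0, F2.phi1, F2.phi2])
        (by simp [F2.sigma, flipLetter, flipAut, F2.phi0, F2.phi1, F2.phi2])
  exact DFunLike.congr_fun h g

theorem value_cons (i : Fin 3) (w : List (Fin 3)) :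
    (F2.value (i :: w) : MulAut F2) = F2.sigma i * F2.value w := by
  simp [F2.value, F2.letter]

theorem act_reverse (w : List (Fin 3)) : act w.reverse = F2.value w := by
  induction w with
  | nil => simp [act_nil, F2.value]
  | cons i w ih =>
    rw [value_cons, ← ih, List.reverse_cons, act_append]
    simp [act]

theorem act_flip_value (w : List (Fin 3)) (g : F2) :
    act (w.map flipLetter) (flipAut ((F2.value w : MulAut F2) g)) = flipAut g := by
  induction w generalizing g with
  | nil => simp [act_nil, F2.value]
  | cons i w ih =>
    rw [List.map_cons, ← List.singleton_append, act_append_apply, value_cons, MulAut.mul_apply]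
    have h : act [flipLetter i] = F2.sigma (flipLetter i) := by simp [act]
    rw [h, sigma_flip_sigma, ih]

/-- Inverting a composition reverses the order, so `μ⁻¹` undoes the first letter first: the word is
read from left to right, as a right congruence requires. -/
theorem mem_map_value_iff (L : List F2Word) (w : List (Fin 3)) (g : F2) :
    g ∈ (generatedSubgroup L).map (F2.value w : MulAut F2).toMonoidHom ↔
      act (w.map flipLetter) (flipAut g) ∈ generatedSubgroup (L.map flipWord) := by
  rw [← map_generatedSubgroup L flipAut.toMonoidHom flipWord mk_flipWord]
  constructor
  · rintro ⟨h, hh, rfl⟩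
    exact ⟨h, hh, (act_flip_value w h).symm⟩
  · rintro ⟨h, hh, heq⟩
    refine ⟨h, hh, ?_⟩
    have h1 := (act_flip_value w h).trans heq
    exact flipAut.injective ((act (w.map flipLetter)).injective h1)

theorem generatedSubgroup_le_map_value_iff (L U : List F2Word) (w : List (Fin 3)) :
    generatedSubgroup U ≤ (generatedSubgroup L).map (F2.value w : MulAut F2).toMonoidHom ↔
      Contains (L.map flipWord) ((U.map flipWord).map (foldWord (w.map flipLetter))) := by
  rw [generatedSubgroup_le_iff]
  simp only [Contains, List.forall_mem_map, mk_foldWord, mk_flipWord, mem_map_value_iff]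

theorem exists_conj_mem_map_value_iff (L U : List F2Word) (w : List (Fin 3)) :
    (∃ g : F2, ∀ u ∈ U, MulAut.conj g (FreeGroup.mk u) ∈
      (generatedSubgroup L).map (F2.value w : MulAut F2).toMonoidHom) ↔
      ContainsConj (L.map flipWord) ((U.map flipWord).map (foldWord (w.map flipLetter))) := by
  simp only [ContainsConj, List.forall_mem_map, mk_foldWord, mk_flipWord, mem_map_value_iff]
  constructor
  · rintro ⟨g, hg⟩
    refine ⟨act (w.map flipLetter) (flipAut g), fun u hu => ?_⟩
    simpa using hg u hu
  · rintro ⟨g, hg⟩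
    refine ⟨flipAut.symm ((act (w.map flipLetter)).symm g), fun u hu => ?_⟩
    simpa using hg u hu

theorem map_conj_generatedSubgroup_le_iff {U : List F2Word} {H : Subgroup F2} {g : F2} :
    (generatedSubgroup U).map (MulAut.conj g).toMonoidHom ≤ H ↔
      ∀ u ∈ U, MulAut.conj g (FreeGroup.mk u) ∈ H := by
  rw [Subgroup.map_le_iff_le_comap, generatedSubgroup_le_iff]
  rfl

theorem map_value_generatedSubgroup (L : List F2Word) (w : List (Fin 3)) :
    (generatedSubgroup L).map (F2.value w : MulAut F2).toMonoidHom =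
      generatedSubgroup (L.map (foldWord w.reverse)) :=
  map_generatedSubgroup L _ _ fun u => by
    rw [mk_foldWord, act_reverse]
    rfl

/-- The inclusion of `μ(H)` in `K` applies `μ` itself, last letter first, whence the reversed word.
-/
theorem eq_map_value_iff (L U : List F2Word) (w : List (Fin 3)) :
    generatedSubgroup U = (generatedSubgroup L).map (F2.value w : MulAut F2).toMonoidHom ↔
      Contains (L.map flipWord) ((U.map flipWord).map (foldWord (w.map flipLetter))) ∧
        Contains U (L.map (foldWord w.reverse)) := by
  rw [le_antisymm_iff, generatedSubgroup_le_map_value_iff, map_value_generatedSubgroup,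
    generatedSubgroup_le_iff]
  rfl

theorem map_conj_mul (H : Subgroup F2) (g h : F2) :
    (H.map (MulAut.conj g).toMonoidHom).map (MulAut.conj h).toMonoidHom =
      H.map (MulAut.conj (h * g)).toMonoidHom := by
  rw [Subgroup.map_map, map_mul]
  rfl

/-- Composing the two inclusions puts a conjugate of the finitely generated subgroup inside itself;
by `map_conj_eq_of_le` that is an equality, so both inclusions are. -/
theorem exists_map_conj_eq_iff (U : List F2Word) (H : Subgroup F2) :
    (∃ g : F2, (generatedSubgroup U).map (MulAut.conj g).toMonoidHom = H) ↔
      (∃ g : F2, (generatedSubgroup U).map (MulAut.conj g).toMonoidHom ≤ H) ∧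
        ∃ g : F2, H.map (MulAut.conj g).toMonoidHom ≤ generatedSubgroup U := by
  constructor
  · rintro ⟨g, rfl⟩
    refine ⟨⟨g, le_rfl⟩, g⁻¹, ?_⟩
    rw [map_conj_mul, inv_mul_cancel, map_one]
    exact (Subgroup.map_id _).le
  · rintro ⟨⟨g, hg⟩, h, hh⟩
    have h1 := Subgroup.map_mono (f := (MulAut.conj h).toMonoidHom) hg
    rw [map_conj_mul] at h1
    have h2 := map_conj_eq_of_le U (h * g) (h1.trans hh)
    refine ⟨g, le_antisymm hg ?_⟩
    rw [← Subgroup.map_le_map_iff_of_injective (f := (MulAut.conj h).toMonoidHom)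
      (MulAut.conj h).injective]
    refine hh.trans (h2.ge.trans ?_)
    rw [map_conj_mul]

theorem exists_map_conj_eq_map_value_iff (L U : List F2Word) (w : List (Fin 3)) :
    (∃ g : F2, (generatedSubgroup U).map (MulAut.conj g).toMonoidHom =
      (generatedSubgroup L).map (F2.value w : MulAut F2).toMonoidHom) ↔
      ContainsConj (L.map flipWord) ((U.map flipWord).map (foldWord (w.map flipLetter))) ∧
        ContainsConj U (L.map (foldWord w.reverse)) := by
  rw [exists_map_conj_eq_iff, ← exists_conj_mem_map_value_iff, map_value_generatedSubgroup]
  simp only [map_conj_generatedSubgroup_le_iff]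
  rfl

/-! ### Deciding conjugation into a subgroup -/

/-- The words of length at most `n` with letters in a list. -/
def wordsLE {α : Type} (l : List α) (n : ℕ) : List (List α) :=
  n.rec [[]] fun _ T => [] :: T.flatMap fun t => l.map fun x => x :: t

theorem mem_wordsLE {α : Type} {l : List α} (hl : ∀ x, x ∈ l) {n : ℕ} {t : List α} :
    t ∈ wordsLE l n ↔ t.length ≤ n := by
  induction n generalizing t with
  | zero =>
    have h : wordsLE l 0 = [[]] := rfl
    rw [h, List.mem_singleton, Nat.le_zero, List.length_eq_zero_iff]
  | succ n ih =>
    have h : wordsLE l (n + 1) =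
      [] :: (wordsLE l n).flatMap fun t => l.map fun x => x :: t := rfl
    rw [h]
    cases t with
    | nil => simp
    | cons x t => simp [ih, hl]

/-- The test of `MemTest`, with a sufficiently large bound. -/
def MemDec (L : List F2Word) (u : F2Word) : Prop := MemTest (prefixCount (u :: L)) L u

theorem memDec_iff {L : List F2Word} {u : F2Word} :
    MemDec L u ↔ FreeGroup.mk u ∈ generatedSubgroup L := memTest_iff le_rfl

/-- A nontrivial `u` of the list fixing a coset forces it to be at distance at most the length of
`u` from the core; a prefix of a generator then leads to the trivial coset. If all `u` are trivial,
any conjugator works. -/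
theorem containsConj_iff_exists_wordsLE (L U : List F2Word) : ContainsConj L U ↔
    ∃ g ∈ wordsLE letters (L.flatten.length + U.flatten.length),
      ∀ u ∈ U, MemDec L (g ++ u ++ FreeGroup.invRev g) := by
  have key : ∀ g u : F2Word, MemDec L (g ++ u ++ FreeGroup.invRev g) ↔
      MulAut.conj (FreeGroup.mk g) (FreeGroup.mk u) ∈ generatedSubgroup L := by
    intro g u
    rw [memDec_iff, MulAut.conj_apply, mk_append, mk_append, FreeGroup.inv_mk]
  simp only [key]
  constructor
  · intro h
    by_cases h1 : ∃ u ∈ U, (FreeGroup.mk u : F2) ≠ 1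
    · obtain ⟨u, hu, hne⟩ := h1
      obtain ⟨x, hx⟩ := (containsConj_iff L U).1 h
      obtain ⟨t, ht, p, hp, hpt⟩ := (pathConvex_prefixPoints L).exists_smul_mem
        (exists_smul_mem_prefixPoints _ L) hne (hx u hu)
      have hx' : x = ((t * (FreeGroup.mk p)⁻¹ : F2) : F2 ⧸ generatedSubgroup L) := by
        rw [inv_smul_eq_iff, MulAction.Quotient.smul_coe, smul_eq_mul] at hpt
        exact hpt
      refine ⟨p ++ FreeGroup.invRev t.toWord, (mem_wordsLE mem_letters).2 ?_, fun v hv => ?_⟩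
      · have h2 : p.length ≤ L.flatten.length := by
          rcases List.mem_cons.1 hp with rfl | hp
          · simp
          · obtain ⟨l, hl, hp⟩ := List.mem_flatMap.1 hp
            exact ((List.mem_inits _ _).1 hp).length_le.trans
              (List.Sublist.length_le (List.sublist_flatten_of_mem hl))
        have h3 : u.length ≤ U.flatten.length :=
          List.Sublist.length_le (List.sublist_flatten_of_mem hu)
        have h4 := FreeGroup.norm_mk_le (L₁ := u)
        rw [List.length_append, FreeGroup.invRev_length]
        rw [FreeGroup.norm] at ht
        omega
      · have h2 := hx v hv
        rw [hx', smul_coset_eq_iff] at h2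
        rw [mk_append, ← FreeGroup.inv_mk, FreeGroup.mk_toWord]
        simpa using h2
    · push Not at h1
      refine ⟨[], (mem_wordsLE mem_letters).2 (by simp), fun u hu => ?_⟩
      rw [h1 u hu, map_one]
      exact one_mem _
  · rintro ⟨g, -, hg⟩
    exact ⟨FreeGroup.mk g, hg⟩

/-! ### Primitive recursive predicates -/

section Primrec

variable {α β γ : Type} [Primcodable α] [Primcodable β] [Primcodable γ]

theorem PrimrecPred.forall_mem_list_apply {f : α → List β} {p : α → β → Prop} (hf : Primrec f)
    (hp : PrimrecPred fun q : α × β => p q.1 q.2) : PrimrecPred fun a => ∀ b ∈ f a, p a b := by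
  have h : PrimrecRel fun (b : β) (a : α) => p a b :=
    hp.comp (Primrec.pair Primrec.snd Primrec.fst)
  exact h.forall_mem_list.comp hf Primrec.id

theorem PrimrecPred.exists_mem_list_apply {f : α → List β} {p : α → β → Prop} (hf : Primrec f)
    (hp : PrimrecPred fun q : α × β => p q.1 q.2) : PrimrecPred fun a => ∃ b ∈ f a, p a b := by
  have h : PrimrecRel fun (b : β) (a : α) => p a b :=
    hp.comp (Primrec.pair Primrec.snd Primrec.fst)
  exact h.exists_mem_list.comp hf Primrec.id

theorem PrimrecPred.imp {p q : α → Prop} (hp : PrimrecPred p) (hq : PrimrecPred q) :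
    PrimrecPred fun a => p a → q a :=
  (hp.not.or hq).of_eq fun _ => imp_iff_not_or.symm

theorem PrimrecPred.iff {p q : α → Prop} (hp : PrimrecPred p) (hq : PrimrecPred q) :
    PrimrecPred fun a => p a ↔ q a :=
  ((hp.imp hq).and (hq.imp hp)).of_eq fun _ => iff_iff_implies_and_implies.symm

theorem Primrec.filter_apply {f : α → List β} {p : α → β → Prop}
    [∀ a, DecidablePred (p a)] (hf : Primrec f)
    (hp : PrimrecPred fun q : α × β => p q.1 q.2) :
    Primrec fun a => (f a).filter fun b => p a b := by
  have h1 : Primrec fun a => (f a).flatMap fun b => if p a b then [b] else [] :=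
    Primrec.list_flatMap hf (Primrec.ite hp
      (Primrec.list_cons.comp Primrec.snd (Primrec.const [])) (Primrec.const []))
  refine h1.of_eq fun a => ?_
  generalize f a = l
  induction l with
  | nil => rfl
  | cons b l ih =>
    rw [List.flatMap_cons, ih, List.filter_cons]
    by_cases h : p a b <;> simp [h]

theorem Primrec.nat_pow : Primrec₂ fun m n : ℕ => m ^ n := Primrec₂.unpaired'.1 Nat.Primrec.pow

theorem Primrec.add {f g : α → ℕ} (hf : Primrec f) (hg : Primrec g) :
    Primrec fun a => f a + g a := Primrec.nat_add.comp hf hg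

theorem Primrec.mul {f g : α → ℕ} (hf : Primrec f) (hg : Primrec g) :
    Primrec fun a => f a * g a := Primrec.nat_mul.comp hf hg

theorem Primrec.pow {f g : α → ℕ} (hf : Primrec f) (hg : Primrec g) :
    Primrec fun a => f a ^ g a := Primrec.nat_pow.comp hf hg

theorem Primrec.append {f g : α → List β} (hf : Primrec f) (hg : Primrec g) :
    Primrec fun a => f a ++ g a := Primrec.list_append.comp hf hg

theorem Primrec.listsOf : Primrec₂ listsOf := by
  have h : Primrec₂ fun (m n : ℕ) => (n.rec [[]] fun _ T => T.flatMap fun t =>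
      (List.range m).map fun x => x :: t : List (List ℕ)) := by
    refine Primrec.nat_rec (f := fun _ : ℕ => [[]]) (g := fun (m : ℕ) (p : ℕ × List (List ℕ)) =>
      p.2.flatMap fun t => (List.range m).map fun x => x :: t) (Primrec.const [[]]) ?_
    refine Primrec.list_flatMap (Primrec.snd.comp Primrec.snd) ?_
    refine Primrec.list_map (Primrec.list_range.comp (Primrec.fst.comp Primrec.fst)) ?_
    exact Primrec.list_cons.comp Primrec.snd (Primrec.snd.comp Primrec.fst)
  exact h.swap

theorem Primrec.wordsLE (l : List α) : Primrec (wordsLE l) := by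
  refine Primrec.nat_rec₁ (f := fun (_ : ℕ) (T : List (List α)) =>
    [] :: T.flatMap fun t => l.map fun x => x :: t) _ ?_
  refine Primrec.list_cons.comp (Primrec.const []) ?_
  refine Primrec.list_flatMap Primrec.snd ?_
  refine Primrec.list_map (Primrec.const l) ?_
  exact Primrec.list_cons.comp Primrec.snd (Primrec.snd.comp Primrec.fst)

theorem Primrec.tableStep {k : α → ℕ} {t : α → List ℕ} {x : α → ℕ} {c : α → Letter}
    (hk : Primrec k) (ht : Primrec t) (hx : Primrec x) (hc : Primrec c) :
    Primrec fun a => tableStep (k a) (t a) (x a) (c a) :=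
  (Primrec.list_getD 0).comp ht
    (hx.add (hk.mul ((Primrec.dom_finite letterCode).comp hc)))

theorem Primrec.tableRun {k : α → ℕ} {t : α → List ℕ} {w : α → F2Word} {x : α → ℕ}
    (hk : Primrec k) (ht : Primrec t) (hw : Primrec w) (hx : Primrec x) :
    Primrec fun a => tableRun (k a) (t a) (w a) (x a) :=
  Primrec.list_foldl (h := fun a p => _root_.tableStep (k a) (t a) p.1 p.2) hw hx
    (Primrec.tableStep (hk.comp Primrec.fst) (ht.comp Primrec.fst)
    (Primrec.fst.comp Primrec.snd) (Primrec.snd.comp Primrec.snd))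

theorem PrimrecPred.tableValid {k : α → ℕ} {t : α → List ℕ} (hk : Primrec k) (ht : Primrec t) :
    PrimrecPred fun a => TableValid (k a) (t a) := by
  refine PrimrecPred.forall_mem_list_apply (Primrec.list_range.comp hk) ?_
  refine PrimrecPred.forall_mem_list_apply (Primrec.const letters) ?_
  have hk' : Primrec fun q : (α × ℕ) × Letter => k q.1.1 :=
    hk.comp (Primrec.fst.comp Primrec.fst)
  have ht' : Primrec fun q : (α × ℕ) × Letter => t q.1.1 :=
    ht.comp (Primrec.fst.comp Primrec.fst)
  have hx : Primrec fun q : (α × ℕ) × Letter => q.1.2 := Primrec.snd.comp Primrec.fst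
  have h1 := Primrec.tableStep hk' ht' hx Primrec.snd
  refine (Primrec.nat_lt.comp h1 hk').and ?_
  exact Primrec.eq.comp (Primrec.tableStep hk' ht' h1
    ((Primrec.dom_finite Letter.inv).comp Primrec.snd)) hx

theorem PrimrecPred.memTest {n : α → ℕ} {L : α → List F2Word} {u : α → F2Word} (hn : Primrec n)
    (hL : Primrec L) (hu : Primrec u) : PrimrecPred fun a => MemTest (n a) (L a) (u a) := by
  refine PrimrecPred.forall_mem_list_apply (Primrec.list_range.comp hn) ?_
  refine PrimrecPred.forall_mem_list_apply
    (f := fun q : α × ℕ => _root_.listsOf (4 * (q.2 + 1)) (q.2 + 1))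
    (Primrec.listsOf.comp ((Primrec.const 4).mul (Primrec.snd.add (Primrec.const 1)))
      (Primrec.snd.add (Primrec.const 1))) ?_
  have hk : Primrec fun q : (α × ℕ) × List ℕ => q.1.2 + 1 :=
    (Primrec.snd.comp Primrec.fst).add (Primrec.const 1)
  refine (PrimrecPred.tableValid hk Primrec.snd).imp (PrimrecPred.imp ?_ ?_)
  · refine PrimrecPred.forall_mem_list_apply (hL.comp (Primrec.fst.comp Primrec.fst)) ?_
    exact Primrec.eq.comp (Primrec.tableRun (hk.comp Primrec.fst)
      (Primrec.snd.comp Primrec.fst) Primrec.snd (Primrec.const 0)) (Primrec.const 0)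
  · exact Primrec.eq.comp (Primrec.tableRun hk Primrec.snd
      (hu.comp (Primrec.fst.comp Primrec.fst)) (Primrec.const 0)) (Primrec.const 0)

theorem prefixCount_eq (L : List F2Word) : prefixCount L = 1 + L.length + L.flatten.length := by
  rw [prefixCount, List.length_cons]
  induction L with
  | nil => rfl
  | cons u L ih =>
    simp only [List.flatMap_cons, List.length_append, List.length_inits, List.length_cons,
      List.flatten_cons] at ih ⊢
    omega

theorem Primrec.prefixCount : Primrec prefixCount :=
  (((Primrec.const 1).add Primrec.list_length).add
    (Primrec.list_length.comp Primrec.list_flatten)).of_eq fun L => (prefixCount_eq L).symm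

theorem PrimrecPred.memDec {L : α → List F2Word} {u : α → F2Word} (hL : Primrec L)
    (hu : Primrec u) : PrimrecPred fun a => MemDec (L a) (u a) :=
  PrimrecPred.memTest (Primrec.prefixCount.comp (Primrec.list_cons.comp hu hL)) hL hu

theorem PrimrecPred.contains {L U : α → List F2Word} (hL : Primrec L) (hU : Primrec U) :
    PrimrecPred fun a => Contains (L a) (U a) :=
  (PrimrecPred.forall_mem_list_apply (p := fun a u => MemDec (L a) u) hU
    (PrimrecPred.memDec (hL.comp Primrec.fst) Primrec.snd)).of_eq
    fun _ => forall₂_congr fun _ _ => memDec_iff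

theorem Primrec.invRev : Primrec (FreeGroup.invRev : F2Word → F2Word) :=
  Primrec.list_reverse.comp (Primrec.list_map Primrec.id
    ((Primrec.dom_finite fun c : Letter => (c.1, !c.2)).comp Primrec.snd))

theorem PrimrecPred.containsConj {L U : α → List F2Word} (hL : Primrec L) (hU : Primrec U) :
    PrimrecPred fun a => ContainsConj (L a) (U a) := by
  have h : PrimrecPred fun a =>
      ∃ g ∈ _root_.wordsLE letters ((L a).flatten.length + (U a).flatten.length),
        ∀ u ∈ U a, MemDec (L a) (g ++ u ++ FreeGroup.invRev g) := by
    refine PrimrecPred.exists_mem_list_apply ((Primrec.wordsLE letters).comp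
      ((Primrec.list_length.comp (Primrec.list_flatten.comp hL)).add
        (Primrec.list_length.comp (Primrec.list_flatten.comp hU)))) ?_
    refine PrimrecPred.forall_mem_list_apply (hU.comp Primrec.fst) ?_
    refine PrimrecPred.memDec (hL.comp (Primrec.fst.comp Primrec.fst)) ?_
    exact ((Primrec.snd.comp Primrec.fst).append Primrec.snd).append
      (Primrec.invRev.comp (Primrec.snd.comp Primrec.fst))
  exact h.of_eq fun a => (containsConj_iff_exists_wordsLE _ _).symm

theorem Primrec.foldWord : Primrec₂ foldWord := by
  refine Primrec.list_foldl (f := fun p : List (Fin 3) × F2Word => p.1) (g := fun p => p.2)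
    (h := fun _ q => subWord q.2 q.1) Primrec.fst Primrec.snd ?_
  refine Primrec.list_flatMap (Primrec.fst.comp Primrec.snd) ?_
  exact (Primrec.dom_finite fun p : Fin 3 × Letter => sub p.1 p.2).comp
    (Primrec.pair (Primrec.snd.comp (Primrec.snd.comp Primrec.fst)) Primrec.snd)

theorem Primrec.map_foldWord {w : α → List (Fin 3)} {U : α → List F2Word} (hw : Primrec w)
    (hU : Primrec U) : Primrec fun a => (U a).map (_root_.foldWord (w a)) :=
  Primrec.list_map hU (Primrec.foldWord.comp (hw.comp Primrec.fst) Primrec.snd)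

theorem Primrec.flipWord : Primrec flipWord :=
  Primrec.list_map Primrec.id ((Primrec.dom_finite fun c : Letter =>
    (c.1, if c.1 = 0 then !c.2 else c.2)).comp Primrec.snd)

theorem Primrec.map_flipWord {U : α → List F2Word} (hU : Primrec U) :
    Primrec fun a => (U a).map _root_.flipWord :=
  Primrec.list_map hU (Primrec.flipWord.comp Primrec.snd)

theorem Primrec.map_flipLetter {w : α → List (Fin 3)} (hw : Primrec w) :
    Primrec fun a => (w a).map flipLetter :=
  Primrec.list_map hw ((Primrec.dom_finite flipLetter).comp Primrec.snd)

theorem Primrec.relCount : Primrec relCount := by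
  have h : Primrec fun k : ℕ => (2 ^ k) ^ k := ((Primrec.const 2).pow Primrec.id).pow Primrec.id
  exact h.pow (h.pow (Primrec.const 2))

theorem Primrec.tupleBound {k n m : α → ℕ} (hk : Primrec k) (hn : Primrec n) (hm : Primrec m) :
    Primrec fun a => tupleBound (k a) (n a) (m a) := by
  have h1 : Primrec fun a => 36 * (4 * n a + 1) + 1 :=
    ((Primrec.const 36).mul (((Primrec.const 4).mul hn).add (Primrec.const 1))).add
      (Primrec.const 1)
  have h2 := h1.add (Primrec.const 1)
  have h3 : Primrec fun a => repBound (36 * (4 * n a + 1) + 1) (_root_.relCount (k a)) :=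
    h2.mul (h2.mul ((Primrec.relCount.comp hk).add (Primrec.const 1)))
  exact (Primrec.const 2).mul (((Primrec.const 5).pow h3).pow hm)

theorem Primrec.listBound {L U : α → List F2Word} (hL : Primrec L) (hU : Primrec U) :
    Primrec fun a => listBound (L a) (U a) :=
  Primrec.tupleBound (Primrec.prefixCount.comp hL)
    (Primrec.list_length.comp (Primrec.list_flatten.comp hU)) (Primrec.list_length.comp hU)

end Primrec

/-! ### Walks in finite automata -/

/-- The word is the label of a walk between two states. -/
inductive Walk (E : List (ℕ × Fin 3 × ℕ)) : ℕ → List (Fin 3) → ℕ → Prop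
  | nil (p : ℕ) : Walk E p [] p
  | cons {p c q w r} : (p, c, q) ∈ E → Walk E q w r → Walk E p (c :: w) r

theorem walk_nil_iff {E : List (ℕ × Fin 3 × ℕ)} {p q : ℕ} : Walk E p [] q ↔ p = q := by
  constructor
  · intro h
    cases h
    rfl
  · rintro rfl
    exact Walk.nil p

theorem walk_cons_iff {E : List (ℕ × Fin 3 × ℕ)} {p r : ℕ} {c : Fin 3} {w : List (Fin 3)} :
    Walk E p (c :: w) r ↔ ∃ q, (p, c, q) ∈ E ∧ Walk E q w r := by
  constructor
  · intro h
    cases h with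
    | cons h1 h2 => exact ⟨_, h1, h2⟩
  · rintro ⟨q, h1, h2⟩
    exact Walk.cons h1 h2

theorem walk_append_iff {E : List (ℕ × Fin 3 × ℕ)} {p r : ℕ} {v w : List (Fin 3)} :
    Walk E p (v ++ w) r ↔ ∃ q, Walk E p v q ∧ Walk E q w r := by
  induction v generalizing p with
  | nil => simp [walk_nil_iff]
  | cons c v ih =>
    simp only [List.cons_append, walk_cons_iff, ih]
    constructor
    · rintro ⟨q, h1, s, h2, h3⟩
      exact ⟨s, ⟨q, h1, h2⟩, h3⟩
    · rintro ⟨s, ⟨q, h1, h2⟩, h3⟩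
      exact ⟨q, h1, s, h2, h3⟩

theorem Walk.mono {E F : List (ℕ × Fin 3 × ℕ)} (h : E ⊆ F) {p q : ℕ} {w : List (Fin 3)}
    (hw : Walk E p w q) : Walk F p w q := by
  induction hw with
  | nil p => exact Walk.nil p
  | cons h1 _ ih => exact Walk.cons (h h1) ih

theorem Walk.mem_targets {E : List (ℕ × Fin 3 × ℕ)} {p q : ℕ} {w : List (Fin 3)}
    (h : Walk E p w q) : q ∈ p :: E.map fun e => e.2.2 := by
  induction h with
  | nil p => simp
  | cons h1 _ ih =>
    rcases List.mem_cons.1 ih with rfl | ih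
    · exact List.mem_cons_of_mem _ (List.mem_map.2 ⟨_, h1, rfl⟩)
    · exact List.mem_cons_of_mem _ ih

namespace SigmaAutomaton

theorem mem_language_iff (A : SigmaAutomaton) (w : List (Fin 3)) :
    w ∈ A.language ↔ ∃ q ∈ A.2.1, Walk A.2.2 A.1 w q := by
  have key : ∀ (M : NFA (Fin 3) ℕ), (∀ p i q, q ∈ M.step p i ↔ (p, i, q) ∈ A.2.2) →
      ∀ (w : List (Fin 3)) (S : Set ℕ) (q : ℕ),
        q ∈ M.evalFrom S w ↔ ∃ p ∈ S, Walk A.2.2 p w q := by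
    intro M hM w
    induction w with
    | nil => simp [walk_nil_iff]
    | cons c w ih =>
      intro S q
      rw [NFA.evalFrom_cons, ih]
      simp only [NFA.mem_stepSet, walk_cons_iff, hM]
      constructor
      · rintro ⟨r, ⟨p, hp, h1⟩, h2⟩
        exact ⟨p, hp, r, h1, h2⟩
      · rintro ⟨p, hp, r, h1, h2⟩
        exact ⟨r, ⟨p, hp, h1⟩, h2⟩
  rw [language, NFA.mem_accepts]
  refine exists_congr fun q => and_congr Iff.rfl ?_
  rw [key _ fun _ _ _ => Iff.rfl]
  exact exists_eq_left

/-- The states which can be reached by the word `w` from the states of a list. -/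
def reach (E : List (ℕ × Fin 3 × ℕ)) (S : List ℕ) (w : List (Fin 3)) : List ℕ :=
  w.foldl (fun S c => (E.filter fun e => e.2.1 = c ∧ e.1 ∈ S).map fun e => e.2.2) S

theorem mem_reach_iff (E : List (ℕ × Fin 3 × ℕ)) (S : List ℕ) (w : List (Fin 3)) (q : ℕ) :
    q ∈ reach E S w ↔ ∃ p ∈ S, Walk E p w q := by
  induction w generalizing S with
  | nil => simp [reach, walk_nil_iff]
  | cons c w ih =>
    have h : reach E S (c :: w) =
      reach E ((E.filter fun e => e.2.1 = c ∧ e.1 ∈ S).map fun e => e.2.2) w := rfl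
    rw [h, ih]
    simp only [walk_cons_iff, List.mem_map, List.mem_filter, decide_eq_true_eq]
    constructor
    · rintro ⟨_, ⟨⟨p, c', r⟩, ⟨h1, rfl, h2⟩, rfl⟩, h3⟩
      exact ⟨p, h2, r, h1, h3⟩
    · rintro ⟨p, h2, r, h1, h3⟩
      exact ⟨r, ⟨(p, c, r), ⟨h1, rfl, h2⟩, rfl⟩, h3⟩

theorem primrecPred_mem {α β : Type} [Primcodable α] [Primcodable β] {f : α → β}
    {g : α → List β} (hf : Primrec f) (hg : Primrec g) : PrimrecPred fun a => f a ∈ g a :=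
  (PrimrecPred.exists_mem_list_apply (p := fun a b => f a = b) hg
    (Primrec.eq.comp (hf.comp Primrec.fst) Primrec.snd)).of_eq fun a => by simp

theorem primrec_reach {α : Type} [Primcodable α] {E : α → List (ℕ × Fin 3 × ℕ)}
    {S : α → List ℕ} {w : α → List (Fin 3)} (hE : Primrec E) (hS : Primrec S) (hw : Primrec w) :
    Primrec fun a => reach (E a) (S a) (w a) := by
  refine Primrec.list_foldl (h := fun a p =>
    ((E a).filter fun e => e.2.1 = p.2 ∧ e.1 ∈ p.1).map fun e => e.2.2) hw hS ?_
  refine Primrec.list_map (Primrec.filter_apply (hE.comp Primrec.fst) ?_)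
    (Primrec.snd.comp (Primrec.snd.comp Primrec.snd))
  refine (Primrec.eq.comp (Primrec.fst.comp (Primrec.snd.comp Primrec.snd))
    (Primrec.snd.comp (Primrec.snd.comp Primrec.fst))).and ?_
  exact primrecPred_mem (Primrec.fst.comp Primrec.snd)
    (Primrec.fst.comp (Primrec.snd.comp Primrec.fst))

theorem primrecPred_mem_language : PrimrecPred fun p : SigmaAutomaton × List (Fin 3) =>
    p.2 ∈ p.1.language := by
  have h : PrimrecPred fun p : SigmaAutomaton × List (Fin 3) =>
      ∃ q ∈ p.1.2.1, q ∈ reach p.1.2.2 [p.1.1] p.2 := by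
    have h1 : Primrec fun p : SigmaAutomaton × List (Fin 3) => [p.1.1] :=
      Primrec.list_cons.comp (Primrec.fst.comp Primrec.fst) (Primrec.const [])
    have h2 : Primrec fun p : SigmaAutomaton × List (Fin 3) => p.1.2.2 :=
      Primrec.snd.comp (Primrec.snd.comp Primrec.fst)
    have h3 := (primrec_reach h2 h1 Primrec.snd).comp
      (Primrec.fst : Primrec (Prod.fst : (SigmaAutomaton × List (Fin 3)) × ℕ → _))
    exact PrimrecPred.exists_mem_list_apply
      (Primrec.fst.comp (Primrec.snd.comp Primrec.fst)) (primrecPred_mem Primrec.snd h3)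
  refine h.of_eq fun p => ?_
  rw [mem_language_iff]
  simp only [mem_reach_iff, List.mem_singleton, exists_eq_left]

/-! ### Rationality of the image of the language -/

theorem value_append (v w : List (Fin 3)) : F2.value (v ++ w) = F2.value v * F2.value w := by
  simp [F2.value]

theorem exists_value_eq (μ : F2.SigmaStar) : ∃ w, F2.value w = μ := by
  obtain ⟨μ, hμ⟩ := μ
  induction hμ using Submonoid.closure_induction with
  | mem x hx =>
    obtain ⟨i, rfl⟩ := hx
    exact ⟨[i], by simp [F2.value, F2.letter]⟩
  | one => exact ⟨[], rfl⟩
  | mul x y hx hy ihx ihy =>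
    obtain ⟨v, hv⟩ := ihx
    obtain ⟨w, hw⟩ := ihy
    exact ⟨v ++ w, by rw [value_append, hv, hw]; rfl⟩

/-- The values of the labels of the walks between two states. -/
def walkValues (E : List (ℕ × Fin 3 × ℕ)) (p q : ℕ) : Set F2.SigmaStar :=
  F2.value '' {w | Walk E p w q}

theorem mul_mem_walkValues {E : List (ℕ × Fin 3 × ℕ)} {p q r : ℕ} {μ ν : F2.SigmaStar}
    (hμ : μ ∈ walkValues E p q) (hν : ν ∈ walkValues E q r) : μ * ν ∈ walkValues E p r := by
  obtain ⟨v, hv, rfl⟩ := hμ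
  obtain ⟨w, hw, rfl⟩ := hν
  exact ⟨v ++ w, walk_append_iff.2 ⟨q, hv, hw⟩, value_append v w⟩

theorem one_mem_walkValues (E : List (ℕ × Fin 3 × ℕ)) (p : ℕ) : 1 ∈ walkValues E p p :=
  ⟨[], Walk.nil p, rfl⟩

theorem letter_mem_walkValues {E : List (ℕ × Fin 3 × ℕ)} {p q : ℕ} {c : Fin 3}
    (h : (p, c, q) ∈ E) : F2.letter c ∈ walkValues E p q :=
  ⟨[c], Walk.cons h (Walk.nil q), by simp [F2.value]⟩

theorem walkValues_mono {E F : List (ℕ × Fin 3 × ℕ)} (h : E ⊆ F) (p q : ℕ) :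
    walkValues E p q ⊆ walkValues F p q :=
  Set.image_mono fun _ hw => Walk.mono h hw

/-- A walk is split at its passages through the added edge. This is Kleene's recursion with edges,
not states, added one at a time. -/
theorem walkValues_cons (E : List (ℕ × Fin 3 × ℕ)) (x y p q : ℕ) (c : Fin 3) :
    walkValues ((x, c, y) :: E) p q = walkValues E p q ∪
      walkValues E p x * (({F2.letter c} : Set F2.SigmaStar) *
        (Submonoid.closure (walkValues E y x * {F2.letter c}) : Set F2.SigmaStar)) *
          walkValues E y q := by
  apply Set.Subset.antisymm
  · rintro _ ⟨w, hw, rfl⟩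
    induction (hw : Walk _ _ _ _) with
    | nil p => exact Or.inl (one_mem_walkValues E p)
    | @cons p c' p' w q h1 h2 ih =>
      have h3 : F2.value (c' :: w) = F2.letter c' * F2.value w := by simp [F2.value]
      rw [h3]
      rcases List.mem_cons.1 h1 with h1 | h1
      · simp only [Prod.mk.injEq] at h1
        obtain ⟨rfl, rfl, rfl⟩ := h1
        right
        rcases ih with ih | ⟨_, ⟨α, hα, _, ⟨_, rfl, s, hs, rfl⟩, rfl⟩, v, hv, heq⟩
        · refine ⟨F2.letter c', ⟨1, one_mem_walkValues E _, F2.letter c',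
            ⟨_, rfl, 1, one_mem _, mul_one _⟩, one_mul _⟩, _, ih, rfl⟩
        · refine ⟨_, ⟨1, one_mem_walkValues E _, _, ⟨_, rfl, (α * F2.letter c') * s,
            mul_mem (Submonoid.subset_closure ⟨α, hα, _, rfl, rfl⟩) hs, rfl⟩, rfl⟩, v, hv, ?_⟩
          rw [← heq]
          simp only [mul_assoc, one_mul]
      · have h4 := letter_mem_walkValues h1
        rcases ih with ih | ⟨_, ⟨α, hα, t, ht, rfl⟩, v, hv, heq⟩
        · exact Or.inl (mul_mem_walkValues h4 ih)
        · refine Or.inr ⟨_, ⟨_, mul_mem_walkValues h4 hα, t, ht, rfl⟩, v, hv, ?_⟩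
          rw [← heq]
          simp only [mul_assoc]
  · have hsub : E ⊆ (x, c, y) :: E := List.subset_cons_self _ _
    have hc : F2.letter c ∈ walkValues ((x, c, y) :: E) x y :=
      letter_mem_walkValues List.mem_cons_self
    rintro _ (h | ⟨_, ⟨α, hα, _, ⟨_, rfl, s, hs, rfl⟩, rfl⟩, v, hv, rfl⟩)
    · exact walkValues_mono hsub p q h
    · refine mul_mem_walkValues (mul_mem_walkValues (walkValues_mono hsub _ _ hα)
        (mul_mem_walkValues hc ?_)) (walkValues_mono hsub _ _ hv)
      induction (hs : s ∈ Submonoid.closure _) using Submonoid.closure_induction with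
      | mem s hs =>
        obtain ⟨β, hβ, _, rfl, rfl⟩ := hs
        exact mul_mem_walkValues (walkValues_mono hsub _ _ hβ) hc
      | one => exact one_mem_walkValues _ y
      | mul s t _ _ ihs iht => exact mul_mem_walkValues ihs iht

theorem isRational_walkValues (E : List (ℕ × Fin 3 × ℕ)) (p q : ℕ) :
    IsRational (walkValues E p q) := by
  induction E generalizing p q with
  | nil =>
    refine IsRational.of_finite ((Set.finite_singleton 1).subset ?_)
    rintro _ ⟨w, hw, rfl⟩
    cases (hw : Walk _ _ _ _) with
    | nil => rfl
    | cons h _ => simp at h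
  | cons e E ih =>
    obtain ⟨x, c, y⟩ := e
    rw [walkValues_cons]
    have hc : IsRational ({F2.letter c} : Set F2.SigmaStar) :=
      IsRational.of_finite (Set.finite_singleton _)
    exact (ih p q).union (((ih p x).mul (hc.mul (((ih y x).mul hc).star))).mul (ih y q))

theorem isRational_rationalSubset (A : SigmaAutomaton) : IsRational A.rationalSubset := by
  have key : ∀ T : List ℕ, IsRational {μ | ∃ q ∈ T, μ ∈ walkValues A.2.2 A.1 q} := by
    intro T
    induction T with
    | nil => exact IsRational.of_finite (by simp)
    | cons q T ih =>
      have h : {μ | ∃ r ∈ q :: T, μ ∈ walkValues A.2.2 A.1 r} =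
          walkValues A.2.2 A.1 q ∪ {μ | ∃ r ∈ T, μ ∈ walkValues A.2.2 A.1 r} := by
        ext μ
        simp
      rw [h]
      exact (isRational_walkValues _ _ _).union ih
  have h : A.rationalSubset = {μ | ∃ q ∈ A.2.1, μ ∈ walkValues A.2.2 A.1 q} := by
    ext μ
    constructor
    · rintro ⟨w, hw, rfl⟩
      obtain ⟨q, hq, hw⟩ := (mem_language_iff A w).1 hw
      exact ⟨q, hq, w, hw, rfl⟩
    · rintro ⟨q, hq, w, hw, rfl⟩
      exact ⟨w, (mem_language_iff A w).2 ⟨q, hq, hw⟩, rfl⟩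
  rw [h]
  exact key _

end SigmaAutomaton

/-! ### Automata for languages of bounded index -/

theorem IndexLE.exists_append_iff {P : List (Fin 3) → Prop} {N : ℕ} (h : IndexLE P N)
    (w : List (Fin 3)) : ∃ v, v.length ≤ N ∧ ∀ z, P (w ++ z) ↔ P (v ++ z) := by
  obtain ⟨α, f, s, h1, h2, h3, h4⟩ := h
  obtain ⟨v, hv, hl⟩ := exists_short f h1 s h2 w
  exact ⟨v, by omega, fun z => h4 _ _ (h1 _ _ _ hv.symm)⟩

/-- The pair of classes reached from `v` and `w` takes at most `N * N` values, each attained by a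
short continuation. -/
theorem IndexLE.forall_append_iff {P : List (Fin 3) → Prop} {N : ℕ} (h : IndexLE P N)
    {v w : List (Fin 3)} (hvw : ∀ z : List (Fin 3), z.length ≤ N * N → (P (v ++ z) ↔ P (w ++ z)))
    (z : List (Fin 3)) : P (v ++ z) ↔ P (w ++ z) := by
  obtain ⟨α, f, s, h1, h2, h3, h4⟩ := h
  obtain ⟨y, hy, hl⟩ := exists_short (fun z => (f (v ++ z), f (w ++ z))) (by
    intro x y z h
    simp only [Prod.mk.injEq, ← List.append_assoc] at h ⊢
    exact ⟨h1 _ _ _ h.1, h1 _ _ _ h.2⟩) (s ×ˢ s)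
    (fun z => Finset.mem_product.2 ⟨h2 _, h2 _⟩) z
  rw [Finset.card_product] at hl
  simp only [Prod.mk.injEq] at hy
  rw [← h4 _ _ hy.1, ← h4 _ _ hy.2]
  exact hvw y (hl.le.trans (Nat.mul_le_mul h3 h3))

/-- Shorten `w` with respect to the pair formed by its set of reachable states and its class; the
states are the initial one and the targets of edges, at most `A.2.2.length + 1`. -/
theorem IndexLE.exists_mem_language {P : List (Fin 3) → Prop} {N : ℕ} (h : IndexLE P N)
    {A : SigmaAutomaton} {w : List (Fin 3)} (hw : w ∈ A.language) (hP : P w) :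
    ∃ v : List (Fin 3), v.length ≤ 2 ^ (A.2.2.length + 1) * N ∧ v ∈ A.language ∧ P v := by
  classical
  obtain ⟨α, f, s, h1, h2, h3, h4⟩ := h
  set T : Finset ℕ := (A.1 :: A.2.2.map fun e => e.2.2).toFinset
  have hT : ∀ {w q}, Walk A.2.2 A.1 w q → q ∈ T := fun h => List.mem_toFinset.2 h.mem_targets
  have key : ∀ {x y}, (T.filter (Walk A.2.2 A.1 x ·)) = T.filter (Walk A.2.2 A.1 y ·) →
      ∀ {q}, Walk A.2.2 A.1 x q → Walk A.2.2 A.1 y q := by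
    intro x y hxy q hq
    have h5 : q ∈ T.filter (Walk A.2.2 A.1 x ·) := Finset.mem_filter.2 ⟨hT hq, hq⟩
    rw [hxy] at h5
    exact (Finset.mem_filter.1 h5).2
  obtain ⟨v, hv, hl⟩ := exists_short (fun w => (T.filter (Walk A.2.2 A.1 w ·), f w)) (by
    intro x y z h
    simp only [Prod.mk.injEq] at h ⊢
    refine ⟨Finset.filter_congr fun q _ => ?_, h1 _ _ _ h.2⟩
    rw [walk_append_iff, walk_append_iff]
    exact exists_congr fun r => and_congr ⟨key h.1, key h.1.symm⟩ Iff.rfl) (T.powerset ×ˢ s)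
    (fun w => Finset.mem_product.2 ⟨Finset.mem_powerset.2 (Finset.filter_subset _ _), h2 w⟩) w
  simp only [Prod.mk.injEq] at hv
  refine ⟨v, hl.le.trans ?_, ?_, (h4 _ _ hv.2).2 hP⟩
  · rw [Finset.card_product, Finset.card_powerset]
    refine Nat.mul_le_mul (Nat.pow_le_pow_right (by norm_num) ?_) h3
    exact (List.toFinset_card_le _).trans (by simp)
  · obtain ⟨q, hq, hw⟩ := (A.mem_language_iff w).1 hw
    exact (A.mem_language_iff v).2 ⟨q, hq, key hv.1.symm hw⟩

/-- The letters of the alphabet `Σ`. -/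
def sigmaLetters : List (Fin 3) := [0, 1, 2]

theorem mem_sigmaLetters : ∀ c : Fin 3, c ∈ sigmaLetters := by decide

/-- The words over `Σ` of length at most `n`. -/
def sigmaWords (n : ℕ) : List (List (Fin 3)) := wordsLE sigmaLetters n

theorem mem_sigmaWords {n : ℕ} {w : List (Fin 3)} : w ∈ sigmaWords n ↔ w.length ≤ n :=
  mem_wordsLE mem_sigmaLetters

open Classical in
/-- An automaton for a language of index at most `N`. -/
noncomputable def indexAutomaton (P : List (Fin 3) → Prop) (N : ℕ) : SigmaAutomaton :=
  (Encodable.encode ([] : List (Fin 3)),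
    ((sigmaWords N).filter fun w => P w).map Encodable.encode,
    (sigmaWords N).flatMap fun v => sigmaLetters.flatMap fun c =>
      ((sigmaWords N).filter fun w => ∀ z ∈ sigmaWords (N * N), P (v ++ c :: z) ↔ P (w ++ z)).map
        fun w => (Encodable.encode v, c, Encodable.encode w))

theorem mem_indexAutomaton_edges {P : List (Fin 3) → Prop} {N : ℕ} (h : IndexLE P N)
    {v : List (Fin 3)} {c : Fin 3} {q : ℕ} :
    (Encodable.encode v, c, q) ∈ (indexAutomaton P N).2.2 ↔ v.length ≤ N ∧
      ∃ w : List (Fin 3), q = Encodable.encode w ∧ w.length ≤ N ∧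
        ∀ z, P (v ++ c :: z) ↔ P (w ++ z) := by
  simp only [indexAutomaton, List.mem_flatMap, List.mem_map, List.mem_filter, mem_sigmaWords,
    Prod.mk.injEq, decide_eq_true_eq]
  constructor
  · rintro ⟨v', hv, c', -, w, ⟨hw, H⟩, hv', rfl, rfl⟩
    obtain rfl := Encodable.encode_injective hv'
    refine ⟨hv, w, rfl, hw, fun z => ?_⟩
    have h1 := h.forall_append_iff (v := v' ++ [c']) (w := w) (fun z hz => by
      simpa using H z hz) z
    simpa using h1
  · rintro ⟨hv, w, rfl, hw, H⟩
    exact ⟨v, hv, c, mem_sigmaLetters c, w, ⟨hw, fun z _ => H z⟩, rfl, rfl, rfl⟩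

/-- States are codes of words of length at most `N`, which represent all residuals. Transitions go
to every word with the right residual, so the automaton is not deterministic, but all walks with a
given label end at equivalent words. -/
theorem mem_language_indexAutomaton {P : List (Fin 3) → Prop} {N : ℕ} (h : IndexLE P N)
    (w : List (Fin 3)) : w ∈ (indexAutomaton P N).language ↔ P w := by
  have h1 : ∀ w v q, Walk (indexAutomaton P N).2.2 (Encodable.encode (v : List (Fin 3))) w q →
      ∃ u : List (Fin 3), q = Encodable.encode u ∧ ∀ z, P (v ++ w ++ z) ↔ P (u ++ z) := by
    intro w
    induction w with
    | nil =>
      intro v q hq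
      exact ⟨v, (walk_nil_iff.1 hq).symm, by simp⟩
    | cons c w ih =>
      intro v q hq
      obtain ⟨r, hr, hq⟩ := walk_cons_iff.1 hq
      obtain ⟨-, u, rfl, -, hu⟩ := (mem_indexAutomaton_edges h).1 hr
      obtain ⟨t, ht, H⟩ := ih _ _ hq
      refine ⟨t, ht, fun z => ?_⟩
      rw [← H, List.append_assoc, List.cons_append, hu, List.append_assoc]
  have h2 : ∀ (w v : List (Fin 3)), v.length ≤ N → ∃ u : List (Fin 3), u.length ≤ N ∧
      Walk (indexAutomaton P N).2.2 (Encodable.encode v) w (Encodable.encode u) ∧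
        ∀ z, P (v ++ w ++ z) ↔ P (u ++ z) := by
    intro w
    induction w with
    | nil => exact fun v hv => ⟨v, hv, Walk.nil _, by simp⟩
    | cons c w ih =>
      intro v hv
      obtain ⟨t, ht, H⟩ := h.exists_append_iff (v ++ [c])
      obtain ⟨u, hu, hw, H'⟩ := ih t ht
      refine ⟨u, hu, Walk.cons ((mem_indexAutomaton_edges h).2
        ⟨hv, t, rfl, ht, fun z => by simpa using H z⟩) hw, fun z => ?_⟩
      rw [← H', List.append_assoc t, ← H]
      simp
  rw [SigmaAutomaton.mem_language_iff]
  constructor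
  · rintro ⟨q, hq, hw⟩
    obtain ⟨u, rfl, H⟩ := h1 w [] q hw
    simp only [indexAutomaton, List.mem_map, List.mem_filter, decide_eq_true_eq] at hq
    obtain ⟨u', ⟨-, hu⟩, heq⟩ := hq
    obtain rfl := Encodable.encode_injective heq
    simpa [hu] using H []
  · intro hP
    obtain ⟨u, hu, hw, H⟩ := h2 w [] (Nat.zero_le N)
    refine ⟨Encodable.encode u, ?_, hw⟩
    simp only [indexAutomaton, List.mem_map, List.mem_filter, decide_eq_true_eq, mem_sigmaWords]
    exact ⟨u, ⟨hu, by simpa [hP] using H []⟩, rfl⟩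

section Computability

variable {ι : Type} [Primcodable ι]

theorem primrec_sigmaWords {f : ι → ℕ} (hf : Primrec f) : Primrec fun i => sigmaWords (f i) :=
  (Primrec.wordsLE sigmaLetters).comp hf

theorem primrec_indexAutomaton {P : ι → List (Fin 3) → Prop} {N : ι → ℕ}
    (hP : PrimrecPred fun q : ι × List (Fin 3) => P q.1 q.2) (hN : Primrec N) :
    Primrec fun i => indexAutomaton (P i) (N i) := by
  classical
  refine Primrec.pair (Primrec.const _) (Primrec.pair ?_ ?_)
  · exact Primrec.list_map (Primrec.filter_apply (primrec_sigmaWords hN) hP)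
      (Primrec.encode.comp Primrec.snd)
  · refine Primrec.list_flatMap (primrec_sigmaWords hN) ?_
    refine Primrec.list_flatMap (Primrec.const sigmaLetters) ?_
    have hi : Primrec fun q : (ι × List (Fin 3)) × Fin 3 => q.1.1 :=
      Primrec.fst.comp Primrec.fst
    refine Primrec.list_map (Primrec.filter_apply (primrec_sigmaWords (hN.comp hi)) ?_) ?_
    · refine PrimrecPred.forall_mem_list_apply
        (primrec_sigmaWords (((hN.comp hi).mul (hN.comp hi)).comp Primrec.fst)) ?_
      have hi' : Primrec fun q : (((ι × List (Fin 3)) × Fin 3) × List (Fin 3)) × List (Fin 3) =>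
        q.1.1.1.1 := hi.comp (Primrec.fst.comp Primrec.fst)
      refine PrimrecPred.iff (hP.comp (Primrec.pair hi' (Primrec.append ?_ ?_)))
        (hP.comp (Primrec.pair hi' (Primrec.append ?_ Primrec.snd)))
      · exact Primrec.snd.comp (Primrec.fst.comp (Primrec.fst.comp Primrec.fst))
      · exact Primrec.list_cons.comp (Primrec.snd.comp (Primrec.fst.comp Primrec.fst)) Primrec.snd
      · exact Primrec.snd.comp Primrec.fst
    · exact Primrec.pair
        (Primrec.encode.comp (Primrec.snd.comp (Primrec.fst.comp Primrec.fst)))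
        (Primrec.pair (Primrec.snd.comp Primrec.fst) (Primrec.encode.comp Primrec.snd))

/-- A primitive recursive predicate with a primitive recursive index bound suffices: residuals are
compared on short words, which builds the automaton, and a word common to `R` and the language is
sought up to a computable length. -/
theorem solvableOverRational_of_index {Q : ι → MulAut F2 → Prop} (P : ι → List (Fin 3) → Prop)
    (N : ι → ℕ) (hP : PrimrecPred fun q : ι × List (Fin 3) => P q.1 q.2) (hN : Primrec N)
    (hI : ∀ i, IndexLE (P i) (N i)) (hPQ : ∀ i w, Q i (F2.value w) ↔ P i w) :
    SolvableOverRational Q := by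
  have himage : ∀ i, (indexAutomaton (P i) (N i)).rationalSubset =
      {μ : F2.SigmaStar | Q i μ} := by
    intro i
    ext μ
    constructor
    · rintro ⟨w, hw, rfl⟩
      exact (hPQ i w).2 ((mem_language_indexAutomaton (hI i) w).1 hw)
    · intro hμ
      obtain ⟨w, rfl⟩ := SigmaAutomaton.exists_value_eq μ
      exact ⟨w, (mem_language_indexAutomaton (hI i) w).2 ((hPQ i w).1 hμ), rfl⟩
  refine ⟨?_, fun i => himage i ▸ SigmaAutomaton.isRational_rationalSubset _,
    fun i => indexAutomaton (P i) (N i), (primrec_indexAutomaton hP hN).to_comp, fun i =>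
      ⟨himage i, fun w => (mem_language_indexAutomaton (hI i) w).trans (hPQ i w).symm⟩⟩
  have h : PrimrecPred fun p : SigmaAutomaton × ι =>
      ∃ w ∈ sigmaWords (2 ^ (p.1.2.2.length + 1) * N p.2), w ∈ p.1.language ∧ P p.2 w := by
    refine PrimrecPred.exists_mem_list_apply (primrec_sigmaWords ?_) ?_
    · exact ((Primrec.const 2).pow ((Primrec.list_length.comp
        (Primrec.snd.comp (Primrec.snd.comp Primrec.fst))).add (Primrec.const 1))).mul
          (hN.comp Primrec.snd)
    · exact (SigmaAutomaton.primrecPred_mem_language.comp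
        (Primrec.pair (Primrec.fst.comp Primrec.fst) Primrec.snd)).and
          (hP.comp (Primrec.pair (Primrec.snd.comp Primrec.fst) Primrec.snd))
  refine PrimrecPred.computablePred (h.of_eq ?_)
  rintro ⟨A, i⟩
  constructor
  · rintro ⟨w, -, hw, hPw⟩
    exact ⟨F2.value w, ⟨w, hw, rfl⟩, (hPQ i w).2 hPw⟩
  · rintro ⟨_, ⟨w, hw, rfl⟩, hQ⟩
    obtain ⟨v, hv, hvA, hPv⟩ := (hI i).exists_mem_language hw ((hPQ i w).1 hQ)
    exact ⟨v, mem_sigmaWords.2 hv, hvA, hPv⟩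

end Computability

/-! ### The seven problems -/

theorem Primrec.listBound_map_flipWord {α : Type} [Primcodable α] {L U : α → List F2Word}
    (hL : Primrec L) (hU : Primrec U) :
    Primrec fun a => _root_.listBound ((L a).map _root_.flipWord) ((U a).map _root_.flipWord) :=
  Primrec.listBound (Primrec.map_flipWord hL) (Primrec.map_flipWord hU)

/-- The words over `Σ` whose value `μ` satisfies `U ⊆ μ(H)`, where `H` is generated by `L`. -/
def LeWord (L U : List F2Word) (w : List (Fin 3)) : Prop :=
  Contains (L.map flipWord) ((U.map flipWord).map (foldWord (w.map flipLetter)))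

/-- The words over `Σ` whose value `μ` is such that a conjugate of `U` is contained in `μ(H)`,
where `H` is generated by `L`. -/
def ConjLeWord (L U : List F2Word) (w : List (Fin 3)) : Prop :=
  ContainsConj (L.map flipWord) ((U.map flipWord).map (foldWord (w.map flipLetter)))

theorem indexLE_leWord (L U : List F2Word) :
    IndexLE (LeWord L U) (listBound (L.map flipWord) (U.map flipWord)) :=
  (indexLE_contains _ _).comap flipLetter

theorem indexLE_conjLeWord (L U : List F2Word) :
    IndexLE (ConjLeWord L U) (listBound (L.map flipWord) (U.map flipWord)) :=
  (indexLE_containsConj _ _).comap flipLetter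

/-- The bound depends on `n` only, so that all the `u_j` of problem (4) share one index. -/
theorem indexLE_conjLeWord_singleton (L : List F2Word) (u : F2Word) {n : ℕ} (hn : u.length ≤ n) :
    IndexLE (ConjLeWord L [u]) (tupleBound (prefixCount (L.map flipWord)) n 1) := by
  have h := indexLE_conj (L.map flipWord) n (fun _ : Fin 1 => FreeGroup.mk (flipWord u))
    fun _ => FreeGroup.norm_mk_le.trans (by simpa [flipWord] using hn)
  refine (h.comap flipLetter).congr fun w => ?_
  rw [ConjLeWord, containsConj_iff]
  simp only [forall_const, List.map_cons, List.map_nil, List.forall_mem_singleton, mk_foldWord]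

section Primrec

variable {α : Type} [Primcodable α] {L U : α → List F2Word} {w : α → List (Fin 3)}

theorem PrimrecPred.leWord (hL : Primrec L) (hU : Primrec U) (hw : Primrec w) :
    PrimrecPred fun a => LeWord (L a) (U a) (w a) :=
  PrimrecPred.contains (Primrec.map_flipWord hL)
    (Primrec.map_foldWord (Primrec.map_flipLetter hw) (Primrec.map_flipWord hU))

theorem PrimrecPred.conjLeWord (hL : Primrec L) (hU : Primrec U) (hw : Primrec w) :
    PrimrecPred fun a => ConjLeWord (L a) (U a) (w a) :=
  PrimrecPred.containsConj (Primrec.map_flipWord hL)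
    (Primrec.map_foldWord (Primrec.map_flipLetter hw) (Primrec.map_flipWord hU))

end Primrec

theorem primrec_singleton_snd : Primrec fun i : List F2Word × F2Word => [i.2] :=
  Primrec.list_cons.comp Primrec.snd (Primrec.const [])

theorem solvable_mem : SolvableOverRational (fun (i : List F2Word × F2Word) (μ : MulAut F2) =>
    FreeGroup.mk i.2 ∈ (generatedSubgroup i.1).map μ.toMonoidHom) := by
  refine solvableOverRational_of_index (fun i => LeWord i.1 [i.2]) _ ?_
    (Primrec.listBound_map_flipWord Primrec.fst primrec_singleton_snd)
    (fun i => indexLE_leWord _ _) fun i w => ?_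
  · exact PrimrecPred.leWord (Primrec.fst.comp Primrec.fst)
      (primrec_singleton_snd.comp Primrec.fst) Primrec.snd
  · rw [LeWord, ← generatedSubgroup_le_map_value_iff, generatedSubgroup_le_iff,
      List.forall_mem_singleton]

theorem solvable_conj_mem : SolvableOverRational
    (fun (i : List F2Word × F2Word) (μ : MulAut F2) => ∃ g : F2,
      MulAut.conj g (FreeGroup.mk i.2) ∈ (generatedSubgroup i.1).map μ.toMonoidHom) := by
  refine solvableOverRational_of_index (fun i => ConjLeWord i.1 [i.2]) _ ?_
    (Primrec.listBound_map_flipWord Primrec.fst primrec_singleton_snd)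
    (fun i => indexLE_conjLeWord _ _) fun i w => ?_
  · exact PrimrecPred.conjLeWord (Primrec.fst.comp Primrec.fst)
      (primrec_singleton_snd.comp Primrec.fst) Primrec.snd
  · rw [ConjLeWord, ← exists_conj_mem_map_value_iff]
    simp only [List.forall_mem_singleton]

theorem solvable_le : SolvableOverRational
    (fun (i : List F2Word × List F2Word) (μ : MulAut F2) =>
      generatedSubgroup i.2 ≤ (generatedSubgroup i.1).map μ.toMonoidHom) := by
  refine solvableOverRational_of_index (fun i => LeWord i.1 i.2) _ ?_
    (Primrec.listBound_map_flipWord Primrec.fst Primrec.snd)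
    (fun i => indexLE_leWord _ _) fun i w => generatedSubgroup_le_map_value_iff _ _ _
  exact PrimrecPred.leWord (Primrec.fst.comp Primrec.fst) (Primrec.snd.comp Primrec.fst)
    Primrec.snd

theorem solvable_conj_le : SolvableOverRational
    (fun (i : List F2Word × List F2Word) (μ : MulAut F2) =>
      ∃ g : F2, (generatedSubgroup i.2).map (MulAut.conj g).toMonoidHom ≤
        (generatedSubgroup i.1).map μ.toMonoidHom) := by
  refine solvableOverRational_of_index (fun i => ConjLeWord i.1 i.2) _ ?_
    (Primrec.listBound_map_flipWord Primrec.fst Primrec.snd)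
    (fun i => indexLE_conjLeWord _ _) fun i w => ?_
  · exact PrimrecPred.conjLeWord (Primrec.fst.comp Primrec.fst) (Primrec.snd.comp Primrec.fst)
      Primrec.snd
  · rw [ConjLeWord, ← exists_conj_mem_map_value_iff]
    simp only [map_conj_generatedSubgroup_le_iff]

theorem primrec_equalityBound : Primrec fun i : List F2Word × List F2Word =>
    listBound (i.1.map flipWord) (i.2.map flipWord) * 2 ^ listBound i.2 i.1 :=
  (Primrec.listBound_map_flipWord Primrec.fst Primrec.snd).mul
    ((Primrec.const 2).pow (Primrec.listBound Primrec.snd Primrec.fst))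

theorem primrec_map_foldWord_reverse :
    Primrec fun q : (List F2Word × List F2Word) × List (Fin 3) =>
      q.1.1.map (foldWord q.2.reverse) :=
  Primrec.map_foldWord (Primrec.list_reverse.comp Primrec.snd) (Primrec.fst.comp Primrec.fst)

theorem solvable_eq : SolvableOverRational
    (fun (i : List F2Word × List F2Word) (μ : MulAut F2) =>
      generatedSubgroup i.2 = (generatedSubgroup i.1).map μ.toMonoidHom) := by
  refine solvableOverRational_of_index
    (fun i w => LeWord i.1 i.2 w ∧ Contains i.2 (i.1.map (foldWord w.reverse))) _ ?_
    primrec_equalityBound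
    (fun i => (indexLE_leWord _ _).and (indexLE_contains _ _).reverse)
    fun i w => eq_map_value_iff _ _ _
  exact (PrimrecPred.leWord (Primrec.fst.comp Primrec.fst) (Primrec.snd.comp Primrec.fst)
    Primrec.snd).and
      (PrimrecPred.contains (Primrec.snd.comp Primrec.fst) primrec_map_foldWord_reverse)

theorem solvable_conj_eq : SolvableOverRational
    (fun (i : List F2Word × List F2Word) (μ : MulAut F2) =>
      ∃ g : F2, (generatedSubgroup i.2).map (MulAut.conj g).toMonoidHom =
        (generatedSubgroup i.1).map μ.toMonoidHom) := by
  refine solvableOverRational_of_index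
    (fun i w => ConjLeWord i.1 i.2 w ∧ ContainsConj i.2 (i.1.map (foldWord w.reverse))) _ ?_
    primrec_equalityBound
    (fun i => (indexLE_conjLeWord _ _).and (indexLE_containsConj _ _).reverse)
    fun i w => exists_map_conj_eq_map_value_iff _ _ _
  exact (PrimrecPred.conjLeWord (Primrec.fst.comp Primrec.fst) (Primrec.snd.comp Primrec.fst)
    Primrec.snd).and
      (PrimrecPred.containsConj (Primrec.snd.comp Primrec.fst) primrec_map_foldWord_reverse)

theorem solvable_forall_conj_mem : SolvableOverRational
    (fun (i : List F2Word × List F2Word) (μ : MulAut F2) =>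
      ∃ w : Fin i.2.length → F2, ∀ j : Fin i.2.length,
        MulAut.conj (w j) (FreeGroup.mk (i.2.get j)) ∈
          (generatedSubgroup i.1).map μ.toMonoidHom) := by
  refine solvableOverRational_of_index (fun i w => ∀ u ∈ i.2, ConjLeWord i.1 [u] w)
    (fun i => tupleBound (prefixCount (i.1.map flipWord)) i.2.flatten.length 1 ^ i.2.length)
    ?_ ?_ (fun i => ?_) fun i w => ?_
  · refine PrimrecPred.forall_mem_list_apply (Primrec.snd.comp Primrec.fst) ?_
    exact PrimrecPred.conjLeWord (Primrec.fst.comp (Primrec.fst.comp Primrec.fst))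
      (Primrec.list_cons.comp Primrec.snd (Primrec.const [])) (Primrec.snd.comp Primrec.fst)
  · exact (Primrec.tupleBound (Primrec.prefixCount.comp (Primrec.map_flipWord Primrec.fst))
      (Primrec.list_length.comp (Primrec.list_flatten.comp Primrec.snd)) (Primrec.const 1)).pow
        (Primrec.list_length.comp Primrec.snd)
  · exact IndexLE.forall_mem i.2 fun u hu => indexLE_conjLeWord_singleton _ _
      (List.Sublist.length_le (List.sublist_flatten_of_mem hu))
  -- The conjugators are independent of each other, so problem (4) is the conjunction of (1') over
  -- the list.
  · rw [← Classical.skolem (p := fun (j : Fin i.2.length) g => MulAut.conj g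
      (FreeGroup.mk (i.2.get j)) ∈ (generatedSubgroup i.1).map (F2.value w : MulAut F2).toMonoidHom)]
    simp only [ConjLeWord, ← exists_conj_mem_map_value_iff, List.forall_mem_singleton]
    exact (List.forall_mem_iff_get (p := fun u => ∃ g : F2, MulAut.conj g
      (FreeGroup.mk u) ∈ (generatedSubgroup i.1).map (F2.value w : MulAut F2).toMonoidHom)).symm

theorem mainTheorem5 :
    -- (1) the instance is `(H, u)`: whether `u ∈ μ(H)`
    SolvableOverRational (fun (i : List F2Word × F2Word) (μ : MulAut F2) =>
      FreeGroup.mk i.2 ∈ (generatedSubgroup i.1).map μ.toMonoidHom) ∧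
    -- (1') the instance is `(H, u)`: whether a conjugate of `u` lies in `μ(H)`
    SolvableOverRational (fun (i : List F2Word × F2Word) (μ : MulAut F2) =>
      ∃ g : F2, MulAut.conj g (FreeGroup.mk i.2) ∈ (generatedSubgroup i.1).map μ.toMonoidHom) ∧
    -- (2) the instance is `(H, K)`: whether `K ⊆ μ(H)`
    SolvableOverRational (fun (i : List F2Word × List F2Word) (μ : MulAut F2) =>
      generatedSubgroup i.2 ≤ (generatedSubgroup i.1).map μ.toMonoidHom) ∧
    -- (2') the instance is `(H, K)`: whether a conjugate of `K` is contained in `μ(H)`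
    SolvableOverRational (fun (i : List F2Word × List F2Word) (μ : MulAut F2) =>
      ∃ g : F2, (generatedSubgroup i.2).map (MulAut.conj g).toMonoidHom ≤
        (generatedSubgroup i.1).map μ.toMonoidHom) ∧
    -- (3) the instance is `(H, K)`: whether `K = μ(H)`
    SolvableOverRational (fun (i : List F2Word × List F2Word) (μ : MulAut F2) =>
      generatedSubgroup i.2 = (generatedSubgroup i.1).map μ.toMonoidHom) ∧
    -- (3') the instance is `(H, K)`: whether a conjugate of `K` is equal to `μ(H)`
    SolvableOverRational (fun (i : List F2Word × List F2Word) (μ : MulAut F2) =>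
      ∃ g : F2, (generatedSubgroup i.2).map (MulAut.conj g).toMonoidHom =
        (generatedSubgroup i.1).map μ.toMonoidHom) ∧
    -- (4) the instance is `(H, (u₁, …, u_k))`, with `k` arbitrary: whether there are
    -- `w₁, …, w_k` such that each `w_j u_j w_j⁻¹` lies in `μ(H)`
    SolvableOverRational (fun (i : List F2Word × List F2Word) (μ : MulAut F2) =>
      ∃ w : Fin i.2.length → F2, ∀ j : Fin i.2.length,
        MulAut.conj (w j) (FreeGroup.mk (i.2.get j)) ∈
          (generatedSubgroup i.1).map μ.toMonoidHom) := by
  exact ⟨solvable_mem, solvable_conj_mem, solvable_le, solvable_conj_le, solvable_eq,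
    solvable_conj_eq, solvable_forall_conj_mem⟩
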